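/- **Proposition 1.2.** Let $\mathfrak H$ be a complex separable Hilbert space with a conjugation $x\mapsto\bar x$ (an antiunitary involution; e.g. the complexification of a real Hilbert space), with inner products linear in the first argument. Let $Z=\{Z(x):x\in\mathfrak H\}$ be a complex isonormal Gaussian process on a probability space, i.e. a centered jointly Gaussian complex family with $E[Z(x)\overline{Z(y)}]=\langle x,y\rangle$ and $E[Z(x)Z(y)]=0$. Denote by $I_{m,n}$ the complex Wiener–Itô integral, i.e. the continuous linear map from $\mathfrak H^{\odot m}\otimes\mathfrak H^{\odot n}$ to $L^2(\Omega)$ with $$I_{m,n}(x^{\otimes m}\otimes\bar x^{\otimes n})=J_{m,n}(Z(x),\|x\|^2)\quad(x\in\mathfrak H),\qquad J_{m,n}(z,\rho)=\sum_{k=0}^{m\wedge n}(-1)^k k!\binom mk\binom nk\rho^k z^{m-k}\bar z^{\,n-k}.$$ Fix an orthonormal basis $(e_k)$ of $\mathfrak H$. For $u\in\mathfrak H^{\otimes a}\otimes\mathfrak H^{\otimes b}$, $v\in\mathfrak H^{\otimes c}\otimes\mathfrak H^{\otimes d}$, $i\le a\wedge d$, $j\le b\wedge c$, the contraction is $$u\otimes_{i,j}v=\sum_{k\in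 K^i,\;l\in K^j}\langle u,\,e_{k_1}\otimes\cdots\otimes e_{k_i}\otimes\bar e_{l_1}\otimes\cdots\otimes\bar e_{l_j}\rangle\otimes\langle v,\,e_{l_1}\otimes\cdots\otimes e_{l_j}\otimes\bar e_{k_1}\otimes\cdots\otimes\bar e_{k_i}\rangle\in\mathfrak H^{\otimes(a+c-i-j)}\otimes\mathfrak H^{\otimes(b+d-i-j)}$$ ($K$ is the index set of the basis; the vectors $e$ are paired with the last $i$, resp. $j$, of the first $a$, resp. $c$, slots, the vectors $\bar e$ with the last $j$, resp. $i$, of the remaining $b$, resp. $d$, slots; the free slots keep their order within $u$ and $v$, those of $u$ preceding those of $v$, in each of the two factors). $u\tilde\otimes_{i,j}v$ is its symmetrization, separately in the first $a+c-i-j$ and in the last $b+d-i-j$ slots. Let $m\ge1$, $n\ge0$, let $F=I_{m,n}(f)$ with $f\in\mathfrak H^{\odot m}\otimes\mathfrak H^{\odot n}$, and let $\bar F=I_{n,m}(h)$ with $h\in\mathfrak H^{\odot n}\otimes\mathfrak H^{\odot m}$. Put $l=m+n$ and $l'=2(m\wedge n)$. Then $E[|F|^4]<\infty$ and $$E[|F|^4]-2\big(E[|F|^2]\big)^2-\big|E[F^2]\big|^2=2\sum_{r=1}^{l-1}[(l-r)!]^2\langle\vartheta_r,\psi_r\rangle_{\mathfrak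 H^{\otimes 2(l-r)}}+\sum_{r=1}^{l'\wedge(l-1)}(2m-r)!\,(2n-r)!\,\langle\varsigma_r,\varphi_r\rangle_{\mathfrak H^{\otimes 2(l-r)}},$$ where $$\vartheta_r=\sum_{i+j=r}\frac im\binom mi^2\binom nj^2 i!\,j!\,f\tilde\otimes_{i,j}h,\qquad \psi_r=\sum_{i+j=r}\binom mi^2\binom nj^2 i!\,j!\,f\tilde\otimes_{i,j}h,$$ $$\varsigma_r=\sum_{i+j=r}\frac im\binom mi\binom ni\binom mj\binom nj i!\,j!\,f\tilde\otimes_{i,j}f,\qquad \varphi_r=\sum_{i+j=r}\binom mi\binom ni\binom nj\binom mj i!\,j!\,f\tilde\otimes_{i,j}f,$$ the sums being over $i,j\ge0$ with $i+j=r$ for which all the binomial coefficients are non-zero. (The upper limit $l'\wedge(l-1)$ is $l'-1$ if $m=n$ and $l'$ if $m\ne n$.) -/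

import Mathlib

open MeasureTheory ProbabilityTheory Filter Topology
open scoped ENNReal NNReal

namespace ComplexWiener

/-! ### Hilbert tensor powers

Let `H` be a complex Hilbert space with a conjugation `J` (as on the complexification of a real
Hilbert space; `J x` is written `x̄` in the comments), and let `e` be an orthonormal (Hilbert) basis
of `H` indexed by `ι`.  Then `ē = J ∘ e` is an orthonormal basis as well, and the vectors
`e_{α₁} ⊗ ⋯ ⊗ e_{α_p} ⊗ ē_{β₁} ⊗ ⋯ ⊗ ē_{β_q}` form an orthonormal basis of the Hilbert space tensor
product `H^{⊗p} ⊗ H^{⊗q}`.  We realize this space as the space of square summable coefficient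
arrays in that basis; `elemTensor` gives the elementary tensors, `inner_elemTensor` their inner products, and
`dense_span_elemTensor` says that they span a dense subspace. -/

/-- The Hilbert space tensor power `H^{⊗p} ⊗ H^{⊗q}`, in coordinates: the entry at `(α, β)` is the
coefficient of `e_{α₁} ⊗ ⋯ ⊗ e_{α_p} ⊗ ē_{β₁} ⊗ ⋯ ⊗ ē_{β_q}`. -/
abbrev HTensor (ι : Type*) (p q : ℕ) : Type _ :=
  lp (fun _ : (Fin p → ι) × (Fin q → ι) => ℂ) 2

section helpers

theorem memlp_two_iff {I : Type*} {u : I → ℂ} :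
    Memℓp (E := fun _ : I => ℂ) u 2 ↔ Summable fun x => ‖u x‖ ^ 2 := by
  rw [memℓp_gen_iff (by norm_num)]
  simp

theorem summable_sq {I : Type*} (f : lp (fun _ : I => ℂ) 2) : Summable fun x => ‖f x‖ ^ 2 :=
  memlp_two_iff.1 (lp.memℓp f)

theorem hasSum_pi {ι : Type*} {p : ℕ} (u : Fin p → ι → ℂ) (hu : ∀ k, Summable fun i => ‖u k i‖) :
    (Summable fun α : Fin p → ι => ‖∏ k, u k (α k)‖) ∧
      ∑' α : Fin p → ι, ∏ k, u k (α k) = ∏ k, ∑' i, u k i := by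
  induction p with
  | zero => simp [(hasSum_unique _).summable]
  | succ p ih =>
    obtain ⟨h1, h2⟩ := ih (fun k => u k.succ) (fun k => hu k.succ)
    let E : ι × (Fin p → ι) ≃ (Fin (p + 1) → ι) := Fin.consEquiv (fun _ => ι)
    have hE : ∀ x, ∏ k, u k (E x k) = u 0 x.1 * ∏ k, u k.succ (x.2 k) := by
      intro x
      rw [Fin.prod_univ_succ]
      simp [E, Fin.consEquiv]
    constructor
    · rw [← E.summable_iff]
      refine (summable_mul_of_summable_norm (R := ℂ) (hu 0) h1).norm.congr ?_
      intro x
      simp only [Function.comp, hE]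
    · rw [← E.tsum_eq, Fin.prod_univ_succ, ← h2, tsum_mul_tsum_of_summable_norm (hu 0) h1]
      exact tsum_congr hE

theorem inner_conj_conj {H : Type*} [NormedAddCommGroup H] [InnerProductSpace ℂ H]
    (J : H ≃ₗᵢ⋆[ℂ] H) (x y : H) : inner ℂ (J x) (J y) = inner ℂ y x := by
  rw [← inner_conj_symm y x, inner_eq_sum_norm_sq_div_four, inner_eq_sum_norm_sq_div_four]
  have h1 : J x - Complex.I • J y = J (x + Complex.I • y) := by
    simp [map_smulₛₗ, sub_eq_add_neg]
  have h2 : J x + Complex.I • J y = J (x - Complex.I • y) := by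
    simp [map_smulₛₗ, sub_eq_add_neg]
  simp only [RCLike.I_to_complex, h1, h2, ← map_add, ← map_sub, LinearIsometryEquiv.norm_map]
  simp only [map_div₀, map_add, map_sub, map_mul, map_pow, Complex.coe_algebraMap,
    Complex.conj_ofReal, Complex.conj_I, map_ofNat]
  ring

theorem orthonormal_conj {H : Type*} [NormedAddCommGroup H] [InnerProductSpace ℂ H]
    (J : H ≃ₗᵢ⋆[ℂ] H) {ι : Type*} {v : ι → H} (hv : Orthonormal ℂ v) :
    Orthonormal ℂ fun i => J (v i) := by
  refine ⟨fun i => by simpa using hv.1 i, fun i j hij => ?_⟩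
  exact (inner_conj_conj J _ _).trans (hv.2 (Ne.symm hij))

theorem append_inj {ι : Type*} {a b : ℕ} {x x' : Fin a → ι} {y y' : Fin b → ι}
    (h : Fin.append x y = Fin.append x' y') : x = x' ∧ y = y' :=
  ⟨funext fun k => by simpa using congrFun h (Fin.castAdd b k),
    funext fun k => by simpa using congrFun h (Fin.natAdd a k)⟩

theorem contraction_summable {A B G : Type*} {u : A × G → ℂ} {v : B × G → ℂ}
    (hu : Summable fun x => ‖u x‖ ^ 2) (hv : Summable fun x => ‖v x‖ ^ 2) :
    Summable fun x : A × B => ‖∑' g, u (x.1, g) * v (x.2, g)‖ ^ 2 := by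
  have hua := fun a => hu.comp_injective (Prod.mk_right_injective a)
  have hvb := fun b => hv.comp_injective (Prod.mk_right_injective b)
  have hU : Summable fun a => ∑' g, ‖u (a, g)‖ ^ 2 := hu.prod
  have hV : Summable fun b => ∑' g, ‖v (b, g)‖ ^ 2 := hv.prod
  refine Summable.of_nonneg_of_le (fun _ => by positivity) ?_
    (hU.mul_of_nonneg hV (fun a => tsum_nonneg fun g => by positivity)
      (fun b => tsum_nonneg fun g => by positivity))
  rintro ⟨a, b⟩
  obtain ⟨h1, h2⟩ := Real.summable_and_inner_le_Lp_mul_Lq_tsum_of_nonneg (f := fun g => ‖u (a, g)‖)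
    (g := fun g => ‖v (b, g)‖) (p := 2) (q := 2) ⟨by norm_num, by norm_num, by norm_num⟩
    (fun _ => norm_nonneg _) (fun _ => norm_nonneg _)
    (by simpa [Function.comp_def] using hua a) (by simpa [Function.comp_def] using hvb b)
  have h3 : ‖∑' g, u (a, g) * v (b, g)‖ ≤ ∑' g, ‖u (a, g)‖ * ‖v (b, g)‖ := by
    refine (norm_tsum_le_tsum_norm (by simpa using h1)).trans_eq ?_
    simp
  have h4 := h3.trans h2
  have hs : ∀ x : ℝ, x ^ (1 / (2 : ℝ)) = √x := fun x => (Real.sqrt_eq_rpow x).symm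
  simp only [hs, Real.rpow_two] at h4
  calc ‖∑' g, u (a, g) * v (b, g)‖ ^ 2
      ≤ (√(∑' g, ‖u (a, g)‖ ^ 2) * √(∑' g, ‖v (b, g)‖ ^ 2)) ^ 2 := by gcongr
    _ = (∑' g, ‖u (a, g)‖ ^ 2) * ∑' g, ‖v (b, g)‖ ^ 2 := by
      rw [mul_pow, Real.sq_sqrt (tsum_nonneg fun g => by positivity),
        Real.sq_sqrt (tsum_nonneg fun g => by positivity)]

end helpers

section tensors

variable {ι : Type*}

/-- Re-indexing of a coefficient array along an injective map of the index sets. -/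
noncomputable def pull {p q p' q' : ℕ}
    (φ : (Fin p' → ι) × (Fin q' → ι) → (Fin p → ι) × (Fin q → ι)) (hφ : Function.Injective φ)
    (f : HTensor ι p q) : HTensor ι p' q' :=
  ⟨fun x => f (φ x), memlp_two_iff.2 ((summable_sq f).comp_injective hφ)⟩

/-- Transport of a tensor along equalities of the orders. -/
noncomputable def castTensor {p q p' q' : ℕ} (hp : p = p') (hq : q = q') (f : HTensor ι p q) :
    HTensor ι p' q' :=
  pull (fun x => (fun k => x.1 (Fin.cast hp k), fun k => x.2 (Fin.cast hq k)))
    (by subst hp hq; exact fun _ _ h => h) f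

/-- Permutation of the first `p` slots by `σ` and of the last `q` slots by `τ`. -/
noncomputable def permute {p q : ℕ} (σ : Equiv.Perm (Fin p)) (τ : Equiv.Perm (Fin q))
    (f : HTensor ι p q) : HTensor ι p q :=
  pull (fun x => (fun k => x.1 (σ k), fun k => x.2 (τ k)))
    (by
      rintro ⟨a, b⟩ ⟨a', b'⟩ h
      simp only [Prod.mk.injEq] at h
      exact Prod.ext (σ.surjective.injective_comp_right h.1)
        (τ.surjective.injective_comp_right h.2)) f

/-- Membership in `H^{⊙p} ⊗ H^{⊙q}`: invariance under permutations of the first `p` slots and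
under permutations of the last `q` slots. -/
def IsSymm {p q : ℕ} (f : HTensor ι p q) : Prop :=
  ∀ (σ : Equiv.Perm (Fin p)) (τ : Equiv.Perm (Fin q)), permute σ τ f = f

/-- Symmetrization: the orthogonal projection of `H^{⊗p} ⊗ H^{⊗q}` onto `H^{⊙p} ⊗ H^{⊙q}`. -/
noncomputable def symmetrize {p q : ℕ} (f : HTensor ι p q) : HTensor ι p q :=
  ((p.factorial : ℂ) * (q.factorial : ℂ))⁻¹ •
    ∑ σ : Equiv.Perm (Fin p), ∑ τ : Equiv.Perm (Fin q), permute σ τ f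

/-- The contraction of `i` unbarred slots of `f` with `i` barred slots of `g` and of `j` barred
slots of `f` with `j` unbarred slots of `g`, i.e. (with `k`, `l` running over multi-indices)
`∑_{k, l} ⟨f, e_{k₁} ⊗ ⋯ ⊗ e_{k_i} ⊗ ē_{l₁} ⊗ ⋯ ⊗ ē_{l_j}⟩ ⊗ ⟨g, e_{l₁} ⊗ ⋯ ⊗ e_{l_j} ⊗ ē_{k₁} ⊗ ⋯ ⊗ ē_{k_i}⟩`,
where the free slots are arranged with the unbarred ones first. -/
noncomputable def contractAux {a b c d : ℕ} (i j : ℕ) (f : HTensor ι (a + i) (b + j))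
    (g : HTensor ι (c + j) (d + i)) : HTensor ι (a + c) (b + d) :=
  ⟨fun x => ∑' y : (Fin i → ι) × (Fin j → ι),
      f (Fin.append (fun k => x.1 (Fin.castAdd c k)) y.1,
          Fin.append (fun k => x.2 (Fin.castAdd d k)) y.2) *
        g (Fin.append (fun k => x.1 (Fin.natAdd a k)) y.2,
          Fin.append (fun k => x.2 (Fin.natAdd b k)) y.1), by
    refine memlp_two_iff.2 ?_
    have hu : Summable fun x : ((Fin a → ι) × (Fin b → ι)) × ((Fin i → ι) × (Fin j → ι)) =>
        ‖f (Fin.append x.1.1 x.2.1, Fin.append x.1.2 x.2.2)‖ ^ 2 := by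
      refine (summable_sq f).comp_injective
        (i := fun x : ((Fin a → ι) × (Fin b → ι)) × ((Fin i → ι) × (Fin j → ι)) =>
          (Fin.append x.1.1 x.2.1, Fin.append x.1.2 x.2.2)) ?_
      rintro ⟨⟨x1, x2⟩, x3, x4⟩ ⟨⟨y1, y2⟩, y3, y4⟩ h
      obtain ⟨rfl, rfl⟩ := append_inj (congrArg Prod.fst h)
      obtain ⟨rfl, rfl⟩ := append_inj (congrArg Prod.snd h)
      rfl
    have hv : Summable fun x : ((Fin c → ι) × (Fin d → ι)) × ((Fin i → ι) × (Fin j → ι)) =>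
        ‖g (Fin.append x.1.1 x.2.2, Fin.append x.1.2 x.2.1)‖ ^ 2 := by
      refine (summable_sq g).comp_injective
        (i := fun x : ((Fin c → ι) × (Fin d → ι)) × ((Fin i → ι) × (Fin j → ι)) =>
          (Fin.append x.1.1 x.2.2, Fin.append x.1.2 x.2.1)) ?_
      rintro ⟨⟨x1, x2⟩, x3, x4⟩ ⟨⟨y1, y2⟩, y3, y4⟩ h
      obtain ⟨rfl, rfl⟩ := append_inj (congrArg Prod.fst h)
      obtain ⟨rfl, rfl⟩ := append_inj (congrArg Prod.snd h)
      rfl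
    refine (contraction_summable hu hv).comp_injective
      (i := fun x : (Fin (a + c) → ι) × (Fin (b + d) → ι) =>
        (((fun k => x.1 (Fin.castAdd c k), fun k => x.2 (Fin.castAdd d k)),
          (fun k => x.1 (Fin.natAdd a k), fun k => x.2 (Fin.natAdd b k))) :
          ((Fin a → ι) × (Fin b → ι)) × ((Fin c → ι) × (Fin d → ι)))) ?_
    rintro ⟨x1, x2⟩ ⟨y1, y2⟩ h
    simp only [Prod.mk.injEq, funext_iff] at h
    obtain ⟨⟨h1, h2⟩, h3, h4⟩ := h
    refine Prod.ext (funext fun k => ?_) (funext fun k => ?_)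
    · exact Fin.addCases (motive := fun k => x1 k = y1 k) h1 h3 k
    · exact Fin.addCases (motive := fun k => x2 k = y2 k) h2 h4 k⟩

open Classical in
/-- The contraction `f ⊗_{i,j} g` of `f ∈ H^{⊗a} ⊗ H^{⊗b}` and `g ∈ H^{⊗c} ⊗ H^{⊗d}`, as an
element of `H^{⊗p} ⊗ H^{⊗q}`.  It is meaningful when `i ≤ min a d`, `j ≤ min b c`,
`p = a + c - i - j` and `q = b + d - i - j`, and set to `0` otherwise. -/
noncomputable def contract {a b c d : ℕ} (p q i j : ℕ) (f : HTensor ι a b) (g : HTensor ι c d) :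
    HTensor ι p q :=
  if h : ((i ≤ a ∧ i ≤ d) ∧ (j ≤ b ∧ j ≤ c)) ∧ (a - i) + (c - j) = p ∧ (b - j) + (d - i) = q then
    castTensor h.2.1 h.2.2
      (contractAux i j
        (castTensor (Nat.sub_add_cancel h.1.1.1).symm (Nat.sub_add_cancel h.1.2.1).symm f)
        (castTensor (Nat.sub_add_cancel h.1.2.2).symm (Nat.sub_add_cancel h.1.1.2).symm g))
  else 0

/-- The symmetrized contraction `f ⊗̃_{i,j} g ∈ H^{⊙p} ⊗ H^{⊙q}`. -/
noncomputable def symContract {a b c d : ℕ} (p q i j : ℕ) (f : HTensor ι a b)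
    (g : HTensor ι c d) : HTensor ι p q :=
  symmetrize (contract p q i j f g)

/-- `ϑ_r = ∑_{i+j=r} (i/m) C(m,i)² C(n,j)² i! j! f ⊗̃_{i,j} h`. -/
noncomputable def vartheta {m n : ℕ} (f : HTensor ι m n) (h : HTensor ι n m) (r : ℕ) :
    HTensor ι (m + n - r) (m + n - r) :=
  ∑ x ∈ Finset.HasAntidiagonal.antidiagonal r,
    ((x.1 : ℂ) / m * (m.choose x.1) ^ 2 * (n.choose x.2) ^ 2 * x.1.factorial * x.2.factorial) •
      symContract (m + n - r) (m + n - r) x.1 x.2 f h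

/-- `ψ_r = ∑_{i+j=r} C(m,i)² C(n,j)² i! j! f ⊗̃_{i,j} h`. -/
noncomputable def psi {m n : ℕ} (f : HTensor ι m n) (h : HTensor ι n m) (r : ℕ) :
    HTensor ι (m + n - r) (m + n - r) :=
  ∑ x ∈ Finset.HasAntidiagonal.antidiagonal r,
    ((m.choose x.1 : ℂ) ^ 2 * (n.choose x.2) ^ 2 * x.1.factorial * x.2.factorial) •
      symContract (m + n - r) (m + n - r) x.1 x.2 f h

/-- `ς_r = ∑_{i+j=r} (i/m) C(m,i) C(n,i) C(m,j) C(n,j) i! j! f ⊗̃_{i,j} f`. -/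
noncomputable def varsigma {m n : ℕ} (f : HTensor ι m n) (r : ℕ) :
    HTensor ι (2 * m - r) (2 * n - r) :=
  ∑ x ∈ Finset.HasAntidiagonal.antidiagonal r,
    ((x.1 : ℂ) / m * m.choose x.1 * n.choose x.1 * m.choose x.2 * n.choose x.2 *
      x.1.factorial * x.2.factorial) •
      symContract (2 * m - r) (2 * n - r) x.1 x.2 f f

/-- `φ_r = ∑_{i+j=r} C(m,i) C(n,i) C(n,j) C(m,j) i! j! f ⊗̃_{i,j} f`. -/
noncomputable def phi {m n : ℕ} (f : HTensor ι m n) (r : ℕ) :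
    HTensor ι (2 * m - r) (2 * n - r) :=
  ∑ x ∈ Finset.HasAntidiagonal.antidiagonal r,
    ((m.choose x.1 : ℂ) * n.choose x.1 * n.choose x.2 * m.choose x.2 *
      x.1.factorial * x.2.factorial) •
      symContract (2 * m - r) (2 * n - r) x.1 x.2 f f

end tensors

section elementary

variable {ι H : Type*} [NormedAddCommGroup H] [InnerProductSpace ℂ H]

theorem summable_elem (e : HilbertBasis ι ℂ H) (J : H ≃ₗᵢ⋆[ℂ] H) {p q : ℕ}
    (x : Fin p → H) (y : Fin q → H) :
    Summable fun z : (Fin p → ι) × (Fin q → ι) =>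
      ‖((∏ k, inner ℂ (e (z.1 k)) (x k)) * ∏ k, inner ℂ (J (e (z.2 k))) (y k) : ℂ)‖ ^ 2 := by
  have key : ∀ {v : ι → H}, Orthonormal ℂ v → ∀ {s : ℕ} (w : Fin s → H),
      Summable fun α : Fin s → ι => ‖(∏ k, inner ℂ (v (α k)) (w k) : ℂ)‖ ^ 2 := by
    intro v hv s w
    refine ((hasSum_pi (fun k i => (inner ℂ (v i) (w k) : ℂ) ^ 2) fun k => ?_).1).congr ?_
    · simpa using hv.inner_products_summable (w k)
    · intro α
      simp [Finset.prod_pow]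
  refine ((key e.orthonormal x).mul_of_nonneg (key (orthonormal_conj J e.orthonormal) y)
    (fun _ => by positivity) (fun _ => by positivity)).congr ?_
  intro z
  rw [norm_mul, mul_pow]

/-- The elementary tensor `x₁ ⊗ ⋯ ⊗ x_p ⊗ y₁ ⊗ ⋯ ⊗ y_q`. -/
noncomputable def elemTensor (e : HilbertBasis ι ℂ H) (J : H ≃ₗᵢ⋆[ℂ] H) {p q : ℕ}
    (x : Fin p → H) (y : Fin q → H) : HTensor ι p q :=
  ⟨fun z => (∏ k, inner ℂ (e (z.1 k)) (x k)) * ∏ k, inner ℂ (J (e (z.2 k))) (y k),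
    memlp_two_iff.2 (summable_elem e J x y)⟩

/-- Inner products of elementary tensors. -/
theorem inner_elemTensor (e : HilbertBasis ι ℂ H) (J : H ≃ₗᵢ⋆[ℂ] H) (hJ : ∀ x, J (J x) = x)
    {p q : ℕ} (x x' : Fin p → H) (y y' : Fin q → H) :
    inner ℂ (elemTensor e J x y) (elemTensor e J x' y') =
      (∏ k, inner ℂ (x k) (x' k)) * ∏ k, inner ℂ (y k) (y' k) := by
  have h1 : ∀ z w : H, Summable fun i => ‖(inner ℂ z (e i) * inner ℂ (e i) w : ℂ)‖ := fun z w =>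
    (e.summable_inner_mul_inner z w).norm
  obtain ⟨s1, t1⟩ := hasSum_pi (fun k i => (inner ℂ (x k) (e i) * inner ℂ (e i) (x' k) : ℂ))
    fun k => h1 _ _
  obtain ⟨s2, t2⟩ := hasSum_pi
    (fun k i => (inner ℂ (J (y' k)) (e i) * inner ℂ (e i) (J (y k)) : ℂ)) fun k => h1 _ _
  simp only [e.tsum_inner_mul_inner, inner_conj_conj] at t1 t2
  rw [← t1, ← t2, tsum_mul_tsum_of_summable_norm s1 s2, lp.inner_eq_tsum]
  refine tsum_congr fun z => ?_
  have h2 : ∀ i (w : H), (inner ℂ (J (e i)) w : ℂ) = inner ℂ (J w) (e i) := fun i w => by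
    conv_lhs => rw [← hJ w]
    exact inner_conj_conj J _ _
  simp only [elemTensor, RCLike.inner_apply, map_mul, map_prod, inner_conj_symm, h2,
    Finset.prod_mul_distrib]
  ring

/-- The elementary tensors span a dense subspace. -/
theorem dense_span_elemTensor (e : HilbertBasis ι ℂ H) (J : H ≃ₗᵢ⋆[ℂ] H) (p q : ℕ) :
    (Submodule.span ℂ {t : HTensor ι p q | ∃ x y, t = elemTensor e J x y}).topologicalClosure =
      ⊤ := by
  classical
  have hv : Orthonormal ℂ fun i => J (e i) := orthonormal_conj J e.orthonormal
  have hs : ∀ z : (Fin p → ι) × (Fin q → ι), elemTensor e J (fun k => e (z.1 k))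
      (fun k => J (e (z.2 k))) = lp.single 2 z (1 : ℂ) := by
    intro z
    ext w
    have hv' := orthonormal_iff_ite.1 hv
    simp only [elemTensor, orthonormal_iff_ite.1 e.orthonormal, hv', Finset.prod_ite_zero,
      Finset.prod_const_one, lp.single_apply]
    by_cases h : w = z
    · subst h; simp
    · have h' : ¬ ((∀ k, w.1 k = z.1 k) ∧ ∀ k, w.2 k = z.2 k) := fun h' =>
        h (Prod.ext (funext h'.1) (funext h'.2))
      simp only [Finset.mem_univ, true_imp_iff]
      by_cases h1 : ∀ k, w.1 k = z.1 k
      · have h2 : ¬ ∀ k, w.2 k = z.2 k := fun h2 => h' ⟨h1, h2⟩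
        rw [if_neg h2, mul_zero, Pi.single_eq_of_ne h]
      · rw [if_neg h1, zero_mul, Pi.single_eq_of_ne h]
  refine (Submodule.eq_top_iff').2 fun t => ?_
  have ht := lp.hasSum_single (by norm_num : (2 : ℝ≥0∞) ≠ ⊤) t
  refine mem_closure_of_tendsto ht (Eventually.of_forall fun s => ?_)
  refine Submodule.sum_mem _ fun z _ => ?_
  have : lp.single (E := fun _ => ℂ) 2 z (t z) = t z • lp.single 2 z (1 : ℂ) := by
    rw [← lp.single_smul]; simp
  rw [this, ← hs]
  exact Submodule.smul_mem _ _ (Submodule.subset_span ⟨_, _, rfl⟩)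

end elementary

section probability

variable {Ω H : Type*} [MeasurableSpace Ω] [NormedAddCommGroup H] [InnerProductSpace ℂ H]

/-- `Z` is a complex isonormal Gaussian process over `H`: a centered (jointly) Gaussian family of
complex random variables with `E[Z(g) conj Z(h)] = ⟨g, h⟩` and `E[Z(g) Z(h)] = 0`.  The inner
product `⟨g, h⟩`, linear in `g`, is `inner ℂ h g` in Lean. -/
structure IsComplexIsonormal (Z : H → Ω → ℂ) (P : Measure Ω) : Prop where
  gaussian : IsGaussianProcess Z P
  centered : ∀ h, ∫ ω, Z h ω ∂P = 0
  covariance : ∀ g h, ∫ ω, Z g ω * (starRingEnd ℂ) (Z h ω) ∂P = inner ℂ h g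
  relation : ∀ g h, ∫ ω, Z g ω * Z h ω ∂P = 0

/-- The complex Hermite (Itô) polynomial
`J_{m,n}(z, ρ) = ∑_k (-1)^k k! C(m,k) C(n,k) ρ^k z^{m-k} (conj z)^{n-k}`. -/
noncomputable def itoHermite (m n : ℕ) (z : ℂ) (ρ : ℝ) : ℂ :=
  ∑ k ∈ Finset.range (min m n + 1),
    (-1) ^ k * (k.factorial : ℂ) * (m.choose k) * (n.choose k) * (ρ : ℂ) ^ k *
      z ^ (m - k) * (starRingEnd ℂ) z ^ (n - k)

/-- `F = I_{m,n}(f)` (almost surely), where `I_{m,n}` is the complex multiple Wiener-Itô integral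
with respect to `Z`: the continuous linear map from `H^{⊙m} ⊗ H^{⊙n}` to `L²(P)` with
`I_{m,n}(h^{⊗m} ⊗ h̄^{⊗n}) = J_{m,n}(Z(h), ‖h‖²)` for all `h ∈ H`.  Its graph is described as the
closure of its restriction to the (dense) linear span of the tensors `h^{⊗m} ⊗ h̄^{⊗n}`: there are
finite linear combinations of such tensors converging to `f` whose integrals converge to `F`
in `L²(P)`. -/
def IsWienerIto {ι : Type*} (e : HilbertBasis ι ℂ H) (J : H ≃ₗᵢ⋆[ℂ] H) (Z : H → Ω → ℂ)
    (P : Measure Ω) (m n : ℕ) (f : HTensor ι m n) (F : Ω → ℂ) : Prop :=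
  MemLp F 2 P ∧ ∃ c : ℕ → H →₀ ℂ,
    Tendsto (fun k => (c k).sum fun h a =>
      a • elemTensor e J (fun _ : Fin m => h) (fun _ : Fin n => J h)) atTop (𝓝 f) ∧
    Tendsto (fun k => eLpNorm
      (fun ω => F ω - (c k).sum fun h a => a * itoHermite m n (Z h ω) (‖h‖ ^ 2)) 2 P) atTop (𝓝 0)

end probability

end ComplexWiener

/-! The identity is Gaussian integration by parts, carried out once on a marked slot, followed by
counting contraction patterns. By multilinearity and density it suffices to treat products of four
variables `J_{m,n}(Z(x), ‖x‖²)`, the second and fourth being of bidegree (n, m). Number the factors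
F, F̄, F, F̄ as vertices 0, 1, 2, 3.

Integration by parts (`wick_integration_by_parts`) shows that the expectation of such a product
counts the ways of matching the unbarred slots of each vertex with barred slots of other vertices.
Self-contractions cancel because of the lower-order terms of the Hermite polynomials
(`hermiteExpect_add_single`, `hermiteExpect_eq_coeff`). Now mark one unbarred slot of vertex 0. Its
partner lies in vertex 1, 3 or 2. If the partner lies in vertex 1, sort the patterns by the numbers
i, j of contractions of the two kinds inside {0, 1}: the marked slot is among the i contracted ones
in a fraction i/m of the patterns, which is the origin of the factor i/m
(`hermiteExpect_contract_zero_one`). The remaining matching between {0, 1} and {2, 3} is a product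
of two block permanents, which is the inner product of two symmetrized contractions
(`inner_symContract_powTensor`). Summation gives ⟨ϑ_r, ψ_r⟩. Vertex 3 gives the same contribution,
whence the factor 2, and vertex 2 gives ⟨ς_r, φ_r⟩ (`hermiteExpect_fourfold`).

In the resulting formula for E|F|⁴ the terms with r = 0 vanish because i/m = 0. The terms with r = l
are complete contractions inside the two pairs: they equal (E|F|²)² for each of the two ϑψ-sums and
|E F²|² for the ςφ-sum. Subtracting them gives the formula (`fourthMoment_sub`).

For general kernels, contractions are bounded bilinear maps, so the fourth moment is a continuous
function of the kernel. Applied to differences, this turns L² approximation into L⁴ approximation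
(`memLp_four_and_tendsto`). The kernel h is the conjugate of f by the isometry of the integral
(`IsWienerIto.conj_kernel_eq`). -/

namespace ComplexWiener

/-! ### Wick calculus for a linear functional on polynomials -/

section wick

variable {A : Type*} [CommRing A] [Algebra ℂ A] (L : A →ₗ[ℂ] ℂ)

/-- The polynomial `τ ↦ L ((u + τ v) ^ k)`. -/
noncomputable def linePoly (u v : A) (k : ℕ) : Polynomial ℂ :=
  ∑ j ∈ Finset.range (k + 1), Polynomial.monomial j ((k.choose j : ℂ) * L (v ^ j * u ^ (k - j)))

theorem eval_linePoly (u v : A) (k : ℕ) (τ : ℂ) :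
    (linePoly L u v k).eval τ = L ((u + τ • v) ^ k) := by
  rw [add_comm u, add_pow, linePoly, Polynomial.eval_finsetSum, map_sum]
  refine Finset.sum_congr rfl fun j _ => ?_
  have : (τ • v) ^ j * u ^ (k - j) * (k.choose j : A) =
      ((k.choose j : ℂ) * τ ^ j) • (v ^ j * u ^ (k - j)) := by
    rw [smul_pow, smul_mul_assoc, mul_smul, Nat.cast_smul_eq_nsmul, nsmul_eq_mul, mul_comm]
  rw [Polynomial.eval_monomial, this, map_smul, smul_eq_mul]
  ring

theorem coeff_zero_linePoly (u v : A) (k : ℕ) : (linePoly L u v k).coeff 0 = L (u ^ k) := by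
  rw [Polynomial.coeff_zero_eq_eval_zero, eval_linePoly]
  simp

theorem coeff_one_linePoly (u v : A) (k : ℕ) :
    (linePoly L u v (k + 1)).coeff 1 = (k + 1) * L (v * u ^ k) := by
  simp only [linePoly, Polynomial.finsetSum_coeff, Polynomial.coeff_monomial]
  rw [Finset.sum_eq_single 1]
  · simp
  · intro b _ hb; simp [hb]
  · simp

/-- The moment recursion of a centered Gaussian variable. -/
def GaussRec (w : A) : Prop :=
  L w = 0 ∧ ∀ k : ℕ, L (w ^ (k + 2)) = (k + 1) * (L (w ^ 2) * L (w ^ k))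

/-- The recursion for u + τv is a polynomial identity in τ, so infinitely many values of τ determine
it. -/
theorem linePoly_eq_of_infinite {u v : A} {S : Set ℂ} (hS : S.Infinite)
    (h : ∀ τ ∈ S, GaussRec L (u + τ • v)) :
    linePoly L u v 1 = 0 ∧ ∀ k : ℕ, linePoly L u v (k + 2) =
      Polynomial.C (k + 1 : ℂ) * (linePoly L u v 2 * linePoly L u v k) := by
  constructor
  · refine Polynomial.eq_of_infinite_eval_eq _ _ (hS.mono fun τ hτ => ?_)
    simp only [Set.mem_ofPred_eq, eval_linePoly, Polynomial.eval_zero, pow_one]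
    exact (h τ hτ).1
  · intro k
    refine Polynomial.eq_of_infinite_eval_eq _ _ (hS.mono fun τ hτ => ?_)
    simp only [Set.mem_ofPred_eq, eval_linePoly, Polynomial.eval_mul, Polynomial.eval_C]
    exact (h τ hτ).2 k

/-- This is the passage from real to complex coefficients: real τ form an infinite set, and the
recursion then persists at τ = i. -/
theorem gaussRec_of_infinite {u v : A} {S : Set ℂ} (hS : S.Infinite)
    (h : ∀ τ ∈ S, GaussRec L (u + τ • v)) (τ : ℂ) : GaussRec L (u + τ • v) := by
  obtain ⟨h1, h2⟩ := linePoly_eq_of_infinite L hS h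
  refine ⟨by simpa [eval_linePoly] using congrArg (Polynomial.eval τ) h1, fun k => ?_⟩
  simpa [eval_linePoly] using congrArg (Polynomial.eval τ) (h2 k)

/-- Polarization: the coefficient of τ in the recursion for the powers of u + τv is an identity for
L (v u^k). -/
theorem gaussRec_mul_pow (hL : L 1 = 1) {u v : A} (h : ∀ τ : ℂ, GaussRec L (u + τ • v)) (k : ℕ) :
    L (v * u ^ k) = k * (L (v * u) * L (u ^ (k - 1))) := by
  obtain ⟨h1, h2⟩ := linePoly_eq_of_infinite L (S := Set.univ) Set.infinite_univ fun τ _ => h τ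
  have hv : L v = 0 := by
    have := congrArg (fun p => Polynomial.coeff p 1) h1
    simpa [coeff_one_linePoly L u v 0] using this
  have hu : GaussRec L u := by simpa using h 0
  -- The coefficient comparison expresses the case k + 2 through the case k.
  induction k using Nat.twoStepInduction with
  | zero => simpa using hv
  | one => simp [hL]
  | more k ih _ =>
    have h3 := congrArg (fun p => Polynomial.coeff p 1) (h2 (k + 1))
    have h6 := coeff_one_linePoly L u v 1
    rw [one_add_one_eq_two] at h6
    simp only [Polynomial.coeff_C_mul] at h3
    rw [Polynomial.mul_coeff_one, h6, coeff_one_linePoly, coeff_one_linePoly, coeff_zero_linePoly,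
      coeff_zero_linePoly, ih] at h3
    -- For k = 0 the exponent k - 1 is truncated; both sides vanish, the left one because L u = 0.
    have h4 : L (u ^ (k + 1)) = k * (L (u ^ 2) * L (u ^ (k - 1))) := by
      rcases k with _ | k
      · simpa using hu.1
      · rw [show k + 1 + 1 = k + 2 by rfl, hu.2 k]; push_cast; simp
    have h5 : (k + 3 : ℂ) ≠ 0 := by exact_mod_cast (by omega : k + 3 ≠ 0)
    apply mul_left_cancel₀ h5
    rw [pow_one] at h3
    rw [show k + 2 - 1 = k + 1 from rfl]
    push_cast at h3 ⊢
    linear_combination h3 - (k + 2) * (k + 1) * L (v * u) * h4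

variable {σ : Type*} [Fintype σ]

/-- A linear functional on polynomials that vanishes on all powers of linear forms is zero. -/
theorem eq_zero_of_linear_pow (L : MvPolynomial σ ℂ →ₗ[ℂ] ℂ)
    (h : ∀ (s : σ → ℂ) (k : ℕ), L ((∑ i, s i • MvPolynomial.X i) ^ k) = 0) : L = 0 := by
  classical
  refine (MvPolynomial.basisMonomials σ ℂ).ext fun α => ?_
  rw [MvPolynomial.coe_basisMonomials, LinearMap.zero_apply]
  set k := ∑ i, α i with hk
  -- Regarded as a function of s, L of the k-th power of the linear form is a polynomial. Its
  -- coefficient at α is a nonzero multinomial number times L of the monomial of exponent α.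
  let q : MvPolynomial σ ℂ := ∑ κ ∈ Finset.piAntidiag Finset.univ k,
    MvPolynomial.monomial (Finsupp.equivFunOnFinite.symm κ) ((Nat.multinomial Finset.univ κ : ℂ) *
      L (MvPolynomial.monomial (Finsupp.equivFunOnFinite.symm κ) 1))
  have hq : q = 0 := by
    refine MvPolynomial.funext fun s => ?_
    rw [map_zero, ← h s k, Finset.sum_pow_eq_sum_piAntidiag, map_sum, map_sum]
    refine Finset.sum_congr rfl fun κ _ => ?_
    have h1 : (Nat.multinomial Finset.univ κ : MvPolynomial σ ℂ) *
        ∏ i, (s i • MvPolynomial.X i : MvPolynomial σ ℂ) ^ κ i =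
        ((Nat.multinomial Finset.univ κ : ℂ) * ∏ i, s i ^ κ i) •
          MvPolynomial.monomial (Finsupp.equivFunOnFinite.symm κ) (1 : ℂ) := by
      rw [MvPolynomial.monomial_eq, Finsupp.prod_fintype _ _ (by simp)]
      simp only [MvPolynomial.smul_eq_C_mul, mul_pow, Finset.prod_mul_distrib, map_mul, map_prod,
        map_pow, Finsupp.equivFunOnFinite_symm_apply_apply, map_natCast, map_one]
      ring
    rw [h1, map_smul, MvPolynomial.eval_monomial, Finsupp.prod_fintype _ _ (by simp), smul_eq_mul]
    simp only [Finsupp.equivFunOnFinite_symm_apply_apply]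
    ring
  have h2 := congrArg (MvPolynomial.coeff α) hq
  simp only [q, MvPolynomial.coeff_sum, MvPolynomial.coeff_monomial, MvPolynomial.coeff_zero] at h2
  rw [Finset.sum_eq_single (α : σ → ℕ)] at h2
  · rw [if_pos (by ext; simp)] at h2
    have h3 : (Nat.multinomial Finset.univ (α : σ → ℕ) : ℂ) ≠ 0 := by
      exact_mod_cast (Nat.multinomial_pos _ _).ne'
    have h4 : Finsupp.equivFunOnFinite.symm (α : σ → ℕ) = α := by ext; simp
    rw [h4] at h2
    exact (mul_eq_zero.1 h2).resolve_left h3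
  · intro κ _ hκ
    rw [if_neg]
    rintro rfl
    exact hκ (by ext; simp)
  · intro hα
    exact absurd (by simp [hk]) hα

/-- Gaussian integration by parts for polynomials. -/
theorem wick_integration_by_parts (L : MvPolynomial σ ℂ →ₗ[ℂ] ℂ) (hL : L 1 = 1)
    (h : ∀ s : σ → ℂ, GaussRec L (∑ i, s i • MvPolynomial.X i)) (i : σ) (Φ : MvPolynomial σ ℂ) :
    L (MvPolynomial.X i * Φ) =
      ∑ j, L (MvPolynomial.X i * MvPolynomial.X j) * L (MvPolynomial.pderiv j Φ) := by
  classical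
  -- The difference of the two sides is linear in Φ, so only powers of linear forms need to be
  -- tested; there the claim is `gaussRec_mul_pow` with v = X i.
  let M : MvPolynomial σ ℂ →ₗ[ℂ] ℂ := L ∘ₗ LinearMap.mulLeft ℂ (MvPolynomial.X i) -
    ∑ j, L (MvPolynomial.X i * MvPolynomial.X j) • (L ∘ₗ ((MvPolynomial.pderiv j : Derivation ℂ (MvPolynomial σ ℂ) (MvPolynomial σ ℂ)) :
      MvPolynomial σ ℂ →ₗ[ℂ] MvPolynomial σ ℂ))
  suffices hM : M = 0 by
    have := LinearMap.congr_fun hM Φ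
    simpa [M, sub_eq_zero, LinearMap.sum_apply] using this
  refine eq_zero_of_linear_pow M fun s k => ?_
  have h1 := gaussRec_mul_pow L hL (u := ∑ i, s i • MvPolynomial.X i) (v := MvPolynomial.X i)
    (fun τ => by
      convert h (fun j => s j + if j = i then τ else 0) using 1
      simp [add_smul, Finset.sum_add_distrib]) k
  simp only [M, LinearMap.sub_apply, LinearMap.coe_comp, Function.comp_apply,
    LinearMap.mulLeft_apply, LinearMap.sum_apply, LinearMap.smul_apply, smul_eq_mul, sub_eq_zero, h1,
    Derivation.coeFn_coe, MvPolynomial.pderiv_pow, map_sum,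
    Derivation.map_smul, MvPolynomial.pderiv_X, Finset.mul_sum, mul_smul_comm, map_smul]
  generalize (∑ i, s i • MvPolynomial.X i : MvPolynomial σ ℂ) ^ (k - 1) = W
  rw [Finset.sum_mul, Finset.mul_sum]
  refine Finset.sum_congr rfl fun j _ => ?_
  rw [Finset.sum_eq_single j]
  · have h3 : ∀ w : MvPolynomial σ ℂ, L ((k : MvPolynomial σ ℂ) * w) = k * L w := fun w => by
      rw [← nsmul_eq_mul, map_nsmul, nsmul_eq_mul]
    rw [Pi.single_eq_same, mul_one, h3]
    ring
  · intro x _ hx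
    simp [Pi.single_eq_of_ne hx]
  · simp

end wick

/-! ### Moments of a complex isonormal process -/

section moments

/-- The moment generating function solves M' = v t M. Differentiating this equation repeatedly and
putting t = 0 relates the moments of orders k + 2 and k. -/
theorem gaussianReal_moment_recursion (v : ℝ≥0) (k : ℕ) :
    ∫ x, x ^ (k + 2) ∂gaussianReal 0 v = (k + 1) * (v * ∫ x, x ^ k ∂gaussianReal 0 v) := by
  set M : ℝ → ℝ := mgf (fun x => x) (gaussianReal 0 v) with hM
  have hMe : M = fun t : ℝ => Real.exp (v * t ^ 2 / 2) := by
    rw [hM, mgf_fun_id_gaussianReal]; simp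
  have hsm : ContDiff ℝ ((⊤ : ℕ∞) : WithTop ℕ∞) M := by rw [hMe]; fun_prop
  have hd : ∀ n t, HasDerivAt (iteratedDeriv n M) (iteratedDeriv (n + 1) M t) t := by
    intro n t
    rw [iteratedDeriv_succ]
    refine DifferentiableAt.hasDerivAt ?_
    exact (hsm.differentiable_iteratedDeriv n (by exact_mod_cast ENat.natCast_lt_top n)) t
  have h1 : ∀ t, iteratedDeriv 1 M t = v * (t * iteratedDeriv 0 M t) := by
    intro t
    rw [iteratedDeriv_one, iteratedDeriv_zero, hMe]
    have : HasDerivAt (fun t : ℝ => Real.exp (v * t ^ 2 / 2))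
        (Real.exp (v * t ^ 2 / 2) * (v * (2 * t) / 2)) t := by
      simpa using ((((hasDerivAt_id t).pow 2).const_mul (v : ℝ)).div_const 2).exp
    rw [this.deriv]
    ring
  have h2 : ∀ n t, iteratedDeriv (n + 2) M t =
      v * (t * iteratedDeriv (n + 1) M t + (n + 1) * iteratedDeriv n M t) := by
    intro n
    induction n with
    | zero =>
      intro t
      refine (hd 1 t).unique ?_
      have h3 := ((hasDerivAt_id t).mul (hd 0 t)).const_mul (v : ℝ)
      refine (h3.congr_of_eventuallyEq (Eventually.of_forall h1)).congr_deriv ?_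
      simp only [id, one_mul, Nat.cast_zero]; ring
    | succ n ih =>
      intro t
      refine (hd (n + 2) t).unique ?_
      have h3 := (((hasDerivAt_id t).mul (hd (n + 1) t)).add
        ((hd n t).const_mul (n + 1 : ℝ))).const_mul (v : ℝ)
      refine (h3.congr_of_eventuallyEq (Eventually.of_forall ih)).congr_deriv ?_
      simp only [id, one_mul, Nat.cast_add, Nat.cast_one]; ring
  have h4 := h2 k 0
  rw [hM, iteratedDeriv_mgf_zero (by simp), iteratedDeriv_mgf_zero (by simp),
    iteratedDeriv_mgf_zero (by simp)] at h4
  simp only [Pi.pow_apply] at h4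
  rw [h4]; ring

theorem gaussian_moment_recursion {Ω : Type*} [MeasurableSpace Ω] {P : Measure Ω}
    {X : Ω → ℝ} (hX : HasGaussianLaw X P) (h0 : ∫ ω, X ω ∂P = 0) (k : ℕ) :
    ∫ ω, X ω ^ (k + 2) ∂P = (k + 1) * ((∫ ω, X ω ^ 2 ∂P) * ∫ ω, X ω ^ k ∂P) := by
  have h1 : P.map X = gaussianReal 0 Var[X; P].toNNReal := by rw [hX.map_eq_gaussianReal, h0]
  have h2 : ∀ n : ℕ, ∫ ω, X ω ^ n ∂P = ∫ x, x ^ n ∂gaussianReal 0 Var[X; P].toNNReal := fun n => by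
    rw [← h1, integral_map hX.aemeasurable (by fun_prop)]
  rw [h2, h2, h2, gaussianReal_moment_recursion _ k, gaussianReal_moment_recursion _ 0]
  simp

variable {Ω : Type*} [MeasurableSpace Ω] {P : Measure Ω}

/-- All absolute moments are finite. -/
def HasMoments (f : Ω → ℂ) (P : Measure Ω) : Prop := ∀ p : ℝ≥0∞, p ≠ ∞ → MemLp f p P

theorem HasMoments.add {f g : Ω → ℂ} (hf : HasMoments f P) (hg : HasMoments g P) :
    HasMoments (fun ω => f ω + g ω) P := fun p hp => (hf p hp).add (hg p hp)

theorem HasMoments.mul {f g : Ω → ℂ} (hf : HasMoments f P) (hg : HasMoments g P) :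
    HasMoments (fun ω => f ω * g ω) P := by
  intro p hp
  have : ENNReal.HolderTriple (2 * p) (2 * p) p := ⟨by
    rcases eq_or_ne p 0 with rfl | h0
    · simp
    · rw [ENNReal.mul_inv (by simp) (by simp), ← add_mul, ENNReal.inv_two_add_inv_two, one_mul]⟩
  exact MemLp.mul' (hg (2 * p) (ENNReal.mul_ne_top (by simp) hp))
    (hf (2 * p) (ENNReal.mul_ne_top (by simp) hp))

theorem HasMoments.const [IsFiniteMeasure P] (c : ℂ) : HasMoments (fun _ : Ω => c) P :=
  fun _ _ => memLp_const c

theorem HasMoments.conj {f : Ω → ℂ} (hf : HasMoments f P) :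
    HasMoments (fun ω => (starRingEnd ℂ) (f ω)) P := fun p hp => (hf p hp).star

theorem HasMoments.sum [IsFiniteMeasure P] {κ : Type*} {f : κ → Ω → ℂ} {s : Finset κ}
    (hf : ∀ i, HasMoments (f i) P) : HasMoments (fun ω => ∑ i ∈ s, f i ω) P := fun p hp =>
  memLp_finsetSum s fun i _ => hf i p hp

theorem HasMoments.integrable {f : Ω → ℂ} (hf : HasMoments f P) : Integrable f P :=
  memLp_one_iff_integrable.1 (hf 1 (by simp))

variable {H : Type*} [NormedAddCommGroup H] [InnerProductSpace ℂ H] {Z : H → Ω → ℂ}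

theorem IsComplexIsonormal.hasMoments (hZ : IsComplexIsonormal Z P) (x : H) :
    HasMoments (Z x) P := fun _ hp => (hZ.gaussian.hasGaussianLaw_eval x).memLp hp

variable {B : Type*} [IsProbabilityMeasure P]

/-- The values of the variables: `Z (x b)` for `inl b` and its conjugate for `inr b`. -/
def zval (Z : H → Ω → ℂ) (x : B → H) (ω : Ω) : B ⊕ B → ℂ :=
  Sum.elim (fun b => Z (x b) ω) fun b => (starRingEnd ℂ) (Z (x b) ω)

theorem hasMoments_eval (hZ : IsComplexIsonormal Z P) (x : B → H) (Φ : MvPolynomial (B ⊕ B) ℂ) :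
    HasMoments (fun ω => MvPolynomial.eval (zval Z x ω) Φ) P := by
  induction Φ using MvPolynomial.induction_on with
  | C a => simpa using HasMoments.const a
  | add p q hp hq => simpa using hp.add hq
  | mul_X p i hp =>
    simp only [map_mul, MvPolynomial.eval_X]
    refine hp.mul ?_
    rcases i with i | i
    · exact hZ.hasMoments _
    · exact (hZ.hasMoments _).conj

/-- The expectation of a polynomial in the `Z (x b)` and their conjugates. -/
noncomputable def expect (hZ : IsComplexIsonormal Z P) (x : B → H) :
    MvPolynomial (B ⊕ B) ℂ →ₗ[ℂ] ℂ where
  toFun Φ := ∫ ω, MvPolynomial.eval (zval Z x ω) Φ ∂P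
  map_add' Φ Ψ := by
    simp only [map_add]
    exact integral_add (hasMoments_eval hZ x Φ).integrable (hasMoments_eval hZ x Ψ).integrable
  map_smul' c Φ := by
    simp only [MvPolynomial.smul_eval, RingHom.id_apply, smul_eq_mul]
    exact integral_const_mul _ _

theorem expect_apply (hZ : IsComplexIsonormal Z P) (x : B → H) (Φ : MvPolynomial (B ⊕ B) ℂ) :
    expect hZ x Φ = ∫ ω, MvPolynomial.eval (zval Z x ω) Φ ∂P := rfl

theorem expect_one (hZ : IsComplexIsonormal Z P) (x : B → H) : expect hZ x 1 = 1 := by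
  simp [expect_apply]

variable [Fintype B]

/-- The real linear form `∑ (s z + s̄ w)`. -/
noncomputable def realForm (s : B → ℂ) : MvPolynomial (B ⊕ B) ℂ :=
  ∑ b, (s b • MvPolynomial.X (Sum.inl b) + (starRingEnd ℂ) (s b) • MvPolynomial.X (Sum.inr b))

/-- Conjugate coefficients make the form real-valued: it is the sum of the 2 Re(s_b Z(x_b)), a
centered real Gaussian variable. -/
theorem gaussRec_realForm (hZ : IsComplexIsonormal Z P) (x : B → H) (s : B → ℂ) :
    GaussRec (expect hZ x) (realForm s) := by
  let Y : B → Ω → ℝ := fun b ω => (2 * s b * Z (x b) ω).re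
  have hY : HasGaussianLaw (fun ω => ∑ b, Y b ω) P := by
    have h1 := (hZ.gaussian.comp_right x).comp_left
      fun b => Complex.reCLM.comp ((2 * s b) • ContinuousLinearMap.id ℝ ℂ)
    have h2 := h1.hasGaussianLaw_fun_sum (I := Finset.univ)
    refine h2.congr (Eventually.of_forall fun ω => ?_)
    simp [Y]
  have hint : ∀ b, Integrable (fun ω => 2 * s b * Z (x b) ω) P := fun b =>
    (hZ.hasMoments (x b)).integrable.const_mul _
  have h0 : ∫ ω, ∑ b, Y b ω ∂P = 0 := by
    rw [integral_finsetSum _ fun b _ => (show Integrable (Y b) P from (hint b).re)]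
    refine Finset.sum_eq_zero fun b _ => ?_
    have := integral_re (𝕜 := ℂ) (hint b)
    simp only [RCLike.re_to_complex] at this
    rw [show ∫ ω, Y b ω ∂P = _ from this, integral_const_mul, hZ.centered]
    simp
  have hev : ∀ k : ℕ, expect hZ x (realForm s ^ k) = ((∫ ω, (∑ b, Y b ω) ^ k ∂P : ℝ) : ℂ) := by
    intro k
    rw [expect_apply, ← integral_complex_ofReal]
    refine integral_congr_ae (Eventually.of_forall fun ω => ?_)
    simp only [map_pow, Complex.ofReal_pow, realForm, map_sum, map_add, MvPolynomial.smul_eval,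
      MvPolynomial.eval_X, zval, Sum.elim_inl, Sum.elim_inr, Complex.ofReal_sum]
    congr 1
    refine Finset.sum_congr rfl fun b _ => ?_
    rw [← map_mul, Complex.add_conj, ← Complex.re_ofReal_mul, ← mul_assoc]
    simp [Y]
  constructor
  · have := hev 1
    simp only [pow_one] at this
    rw [this, h0, Complex.ofReal_zero]
  · intro k
    rw [hev, hev, hev, gaussian_moment_recursion hY h0 k]
    push_cast
    ring

/-- An arbitrary complex linear form is R + iR' with real forms R and R'. The combinations R + τR'
with τ real are real forms, and `gaussRec_of_infinite` reaches τ = i. -/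
theorem gaussRec_linear (hZ : IsComplexIsonormal Z P) (x : B → H) (s : B ⊕ B → ℂ) :
    GaussRec (expect hZ x) (∑ i, s i • MvPolynomial.X i) := by
  -- The solutions of p + i q = s (inl b) and p̄ + i q̄ = s (inr b).
  let p : B → ℂ := fun b => (s (Sum.inl b) + (starRingEnd ℂ) (s (Sum.inr b))) / 2
  let q : B → ℂ := fun b => (s (Sum.inl b) - (starRingEnd ℂ) (s (Sum.inr b))) / (2 * Complex.I)
  have h1 := gaussRec_of_infinite (expect hZ x) (u := realForm p) (v := realForm q)
    (S := Set.range ((↑) : ℝ → ℂ)) (Set.infinite_range_of_injective Complex.ofReal_injective)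
    (by
      rintro _ ⟨τ, rfl⟩
      convert gaussRec_realForm hZ x (fun b => p b + τ * q b) using 1
      rw [realForm, realForm, realForm, Finset.smul_sum, ← Finset.sum_add_distrib]
      refine Finset.sum_congr rfl fun b _ => ?_
      simp only [map_add, map_mul, Complex.conj_ofReal]
      module) Complex.I
  convert h1 using 1
  rw [Fintype.sum_sum_type, realForm, realForm, Finset.smul_sum, ← Finset.sum_add_distrib,
    ← Finset.sum_add_distrib]
  refine Finset.sum_congr rfl fun b _ => ?_
  have e1 : p b + Complex.I * q b = s (Sum.inl b) := by
    simp only [p, q]; field_simp; ring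
  have e2 : (starRingEnd ℂ) (p b) + Complex.I * (starRingEnd ℂ) (q b) = s (Sum.inr b) := by
    simp only [p, q, map_div₀, map_add, map_sub, map_mul, Complex.conj_conj, Complex.conj_I,
      map_ofNat]
    field_simp; ring
  rw [← e1, ← e2]
  module

/-- Integration by parts in `Z (x a)`. -/
theorem expect_inl_mul (hZ : IsComplexIsonormal Z P) (x : B → H) (a : B)
    (Φ : MvPolynomial (B ⊕ B) ℂ) :
    expect hZ x (MvPolynomial.X (Sum.inl a) * Φ) =
      ∑ b, inner ℂ (x b) (x a) * expect hZ x (MvPolynomial.pderiv (Sum.inr b) Φ) := by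
  rw [wick_integration_by_parts (expect hZ x) (expect_one hZ x) (gaussRec_linear hZ x) _ Φ,
    Fintype.sum_sum_type, Finset.sum_eq_zero, zero_add]
  · refine Finset.sum_congr rfl fun b _ => ?_
    congr 1
    simpa [expect_apply, zval] using hZ.covariance (x a) (x b)
  · intro b _
    have : expect hZ x (MvPolynomial.X (Sum.inl a) * MvPolynomial.X (Sum.inl b)) = 0 := by
      simpa [expect_apply, zval] using hZ.relation (x a) (x b)
    rw [this, zero_mul]

/-- Integration by parts in the conjugate of `Z (x a)`. -/
theorem expect_inr_mul (hZ : IsComplexIsonormal Z P) (x : B → H) (a : B)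
    (Φ : MvPolynomial (B ⊕ B) ℂ) :
    expect hZ x (MvPolynomial.X (Sum.inr a) * Φ) =
      ∑ b, inner ℂ (x a) (x b) * expect hZ x (MvPolynomial.pderiv (Sum.inl b) Φ) := by
  rw [wick_integration_by_parts (expect hZ x) (expect_one hZ x) (gaussRec_linear hZ x) _ Φ,
    Fintype.sum_sum_type, add_comm, Finset.sum_eq_zero, zero_add]
  · refine Finset.sum_congr rfl fun b _ => ?_
    congr 1
    simpa [expect_apply, zval, mul_comm] using hZ.covariance (x b) (x a)
  · intro b _
    have : expect hZ x (MvPolynomial.X (Sum.inr a) * MvPolynomial.X (Sum.inr b)) = 0 := by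
      have h1 := congrArg (starRingEnd ℂ) (hZ.relation (x a) (x b))
      rw [← integral_conj] at h1
      simpa [expect_apply, zval] using h1
    rw [this, zero_mul]

end moments

/-! ### Expectations of products of complex Hermite polynomials -/

section hermite

variable {B : Type*}

/-- The `k`-th term of the complex Hermite polynomial in the variables `inl b`, `inr b`. -/
noncomputable def hermiteTerm (ρ : ℝ) (b : B) (m n k : ℕ) : MvPolynomial (B ⊕ B) ℂ :=
  MvPolynomial.C ((-1) ^ k * (k.factorial : ℂ) * (m.choose k) * (n.choose k) * (ρ : ℂ) ^ k) *
    (MvPolynomial.X (Sum.inl b) ^ (m - k) * MvPolynomial.X (Sum.inr b) ^ (n - k))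

/-- The complex Hermite polynomial in the variables `inl b`, `inr b`. -/
noncomputable def hermitePoly (ρ : ℝ) (b : B) (m n : ℕ) : MvPolynomial (B ⊕ B) ℂ :=
  ∑ k ∈ Finset.range (min m n + 1), hermiteTerm ρ b m n k

theorem hermitePoly_eq_sum_range (ρ : ℝ) (b : B) {m n N : ℕ} (h : min m n + 1 ≤ N) :
    hermitePoly ρ b m n = ∑ k ∈ Finset.range N, hermiteTerm ρ b m n k := by
  refine Finset.sum_subset (Finset.range_mono h) fun k _ hk => ?_
  rw [Finset.mem_range, not_lt, Nat.succ_le_iff, min_lt_iff] at hk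
  rcases hk with hk | hk <;> simp [hermiteTerm, Nat.choose_eq_zero_of_lt hk]

/-- Pascal's rule for C(m+1, k+1) splits each term in two; the second half is absorbed by (k+1)!
C(n, k+1) = n k! C(n-1, k). The subtracted polynomial is what later removes self-contractions. -/
theorem hermitePoly_succ (ρ : ℝ) (b : B) (m n : ℕ) :
    hermitePoly ρ b (m + 1) n = MvPolynomial.X (Sum.inl b) * hermitePoly ρ b m n -
      ((n : ℂ) * ρ) • hermitePoly ρ b m (n - 1) := by
  have hl : min (m + 1) n + 1 ≤ m + n + 2 := by omega
  have hr : min m n + 1 ≤ m + n + 2 := by omega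
  have hr' : min m (n - 1) + 1 ≤ m + n + 1 := by omega
  rw [hermitePoly_eq_sum_range ρ b hl, hermitePoly_eq_sum_range ρ b hr,
    hermitePoly_eq_sum_range ρ b hr', Finset.sum_range_succ', Finset.sum_range_succ' _ (m + n + 1),
    mul_add, Finset.mul_sum, Finset.smul_sum, add_sub_right_comm, ← Finset.sum_sub_distrib]
  congr 1
  · refine Finset.sum_congr rfl fun k _ => ?_
    have h1 : ((k + 1 : ℕ).factorial : ℂ) * (n.choose (k + 1)) =
        n * (k.factorial * (n - 1).choose k) := by
      rcases n with _ | n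
      · simp
      · have := Nat.add_one_mul_choose_eq n k
        rw [Nat.factorial_succ]
        push_cast
        have h2 : ((n + 1 : ℂ)) * n.choose k = (n + 1).choose (k + 1) * (k + 1) := by
          exact_mod_cast this
        linear_combination -(k.factorial : ℂ) * h2
    have h3 : (m + 1) - (k + 1) = m - k := by omega
    have h4 : n - (k + 1) = n - 1 - k := by omega
    -- The binomial coefficient is kept as a factor because it vanishes exactly when the exponent m
    -- - (k + 1) is truncated.
    have h5 : MvPolynomial.C (m.choose (k + 1) : ℂ) * (MvPolynomial.X (Sum.inl b) ^ (m - k)) =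
        MvPolynomial.C (m.choose (k + 1) : ℂ) * (MvPolynomial.X (Sum.inl b) *
          MvPolynomial.X (Sum.inl b : B ⊕ B) ^ (m - (k + 1))) := by
      rcases le_or_gt (k + 1) m with h | h
      · rw [← pow_succ']; congr 2; omega
      · simp [Nat.choose_eq_zero_of_lt h]
    have h6 := congrArg (MvPolynomial.C (σ := B ⊕ B)) h1
    simp only [hermiteTerm, h3, h4, Nat.choose_succ_succ' m k, MvPolynomial.smul_eq_C_mul]
    simp only [map_mul, map_natCast, map_pow, Nat.cast_add, map_add, map_neg, map_one] at h5 h6 ⊢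
    linear_combination (-1) ^ (k + 1) * ((k + 1).factorial : MvPolynomial (B ⊕ B) ℂ) *
      (n.choose (k + 1)) * MvPolynomial.C (ρ : ℂ) ^ (k + 1) * MvPolynomial.X (Sum.inr b) ^ (n - 1 - k) * h5
      + (-1) ^ (k + 1) * (m.choose k : MvPolynomial (B ⊕ B) ℂ) *
        MvPolynomial.C (ρ : ℂ) ^ (k + 1) * MvPolynomial.X (Sum.inl b) ^ (m - k) *
        MvPolynomial.X (Sum.inr b) ^ (n - 1 - k) * h6
  · simp [hermiteTerm, pow_succ']
    ring

theorem hermitePoly_zero (ρ : ℝ) (b : B) (n : ℕ) :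
    hermitePoly ρ b 0 n = MvPolynomial.X (Sum.inr b) ^ n := by
  simp [hermitePoly, hermiteTerm]

theorem pderiv_hermitePoly (ρ : ℝ) (b : B) (m n : ℕ) :
    MvPolynomial.pderiv (Sum.inr b) (hermitePoly ρ b m n) = (n : ℂ) • hermitePoly ρ b m (n - 1) := by
  have hr : min m n + 1 ≤ m + n + 1 := by omega
  have hr' : min m (n - 1) + 1 ≤ m + n + 1 := by omega
  rw [hermitePoly_eq_sum_range ρ b hr, hermitePoly_eq_sum_range ρ b hr', map_sum, Finset.smul_sum]
  refine Finset.sum_congr rfl fun k _ => ?_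
  have h1 : (n.choose k : ℂ) * (n - k : ℕ) = n * (n - 1).choose k := by
    rcases n with _ | n
    · simp
    · have := Nat.choose_mul_succ_eq n k
      rw [Nat.add_sub_cancel]
      exact_mod_cast (by linarith : (n + 1).choose k * (n + 1 - k) = (n + 1) * n.choose k)
  have h2 := congrArg (MvPolynomial.C (σ := B ⊕ B)) h1
  simp only [map_mul, map_natCast] at h2
  rw [hermiteTerm, MvPolynomial.pderiv_C_mul, MvPolynomial.pderiv_mul, MvPolynomial.pderiv_pow,
    MvPolynomial.pderiv_pow, MvPolynomial.pderiv_X_self, MvPolynomial.pderiv_X_of_ne (by simp),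
    hermiteTerm, MvPolynomial.smul_eq_C_mul, show n - 1 - k = n - k - 1 by omega]
  simp only [map_mul, map_natCast]
  linear_combination MvPolynomial.C ((-1) ^ k) * (k.factorial : MvPolynomial (B ⊕ B) ℂ) *
    (m.choose k) * MvPolynomial.C ((ρ : ℂ) ^ k) * MvPolynomial.X (Sum.inl b) ^ (m - k) *
    MvPolynomial.X (Sum.inr b) ^ (n - k - 1) * h2

theorem pderiv_hermitePoly_of_ne (ρ : ℝ) {b c : B} (h : b ≠ c) (m n : ℕ) :
    MvPolynomial.pderiv (Sum.inr c) (hermitePoly ρ b m n) = 0 := by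
  rw [hermitePoly, map_sum]
  refine Finset.sum_eq_zero fun k _ => ?_
  rw [hermiteTerm, MvPolynomial.pderiv_C_mul, MvPolynomial.pderiv_mul, MvPolynomial.pderiv_pow,
    MvPolynomial.pderiv_pow, MvPolynomial.pderiv_X_of_ne (by simp),
    MvPolynomial.pderiv_X_of_ne (by simpa using h)]
  simp

theorem pderiv_prod_eq_zero {σ κ : Type*} (i : σ) (s : Finset κ) (F : κ → MvPolynomial σ ℂ)
    (h : ∀ k ∈ s, MvPolynomial.pderiv i (F k) = 0) :
    MvPolynomial.pderiv i (∏ k ∈ s, F k) = 0 := by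
  classical
  induction s using Finset.induction_on with
  | empty => simp
  | insert a s ha ih =>
    rw [Finset.prod_insert ha, MvPolynomial.pderiv_mul, h a (Finset.mem_insert_self _ _),
      ih fun k hk => h k (Finset.mem_insert_of_mem hk)]
    simp

variable [Fintype B] (ρ : B → ℝ)

/-- The product of the complex Hermite polynomials of bidegrees `(m b, n b)`. -/
noncomputable def hermiteProd (m n : B → ℕ) : MvPolynomial (B ⊕ B) ℂ :=
  ∏ b, hermitePoly (ρ b) b (m b) (n b)

variable {Ω : Type*} [MeasurableSpace Ω] {P : Measure Ω} [IsProbabilityMeasure P]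
  {H : Type*} [NormedAddCommGroup H] [InnerProductSpace ℂ H] {Z : H → Ω → ℂ}

/-- The expectation of the product of the variables `J_{m b, n b}(Z (x b), ‖x b‖²)`. -/
noncomputable def hermiteExpect (hZ : IsComplexIsonormal Z P) (x : B → H) (m n : B → ℕ) : ℂ :=
  expect hZ x (hermiteProd (fun b => ‖x b‖ ^ 2) m n)

theorem hermiteExpect_eq_integral (hZ : IsComplexIsonormal Z P) (x : B → H) (m n : B → ℕ) :
    hermiteExpect hZ x m n =
      ∫ ω, ∏ b, itoHermite (m b) (n b) (Z (x b) ω) (‖x b‖ ^ 2) ∂P := by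
  rw [hermiteExpect, expect_apply]
  refine integral_congr_ae (Eventually.of_forall fun ω => ?_)
  simp only [hermiteProd, map_prod, hermitePoly, map_sum, hermiteTerm, itoHermite, map_mul,
    map_pow, MvPolynomial.eval_C, MvPolynomial.eval_X, zval, Sum.elim_inl, Sum.elim_inr, mul_assoc]

variable [DecidableEq B]

theorem hermiteProd_eq_mul (m n : B → ℕ) (a : B) : hermiteProd ρ m n =
    hermitePoly (ρ a) a (m a) (n a) *
      ∏ b ∈ Finset.univ.erase a, hermitePoly (ρ b) b (m b) (n b) :=
  (Finset.mul_prod_erase _ _ (Finset.mem_univ a)).symm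

theorem hermiteProd_sub_single (m n : B → ℕ) (a : B) : hermiteProd ρ m (n - Pi.single a 1) =
    hermitePoly (ρ a) a (m a) (n a - 1) *
      ∏ b ∈ Finset.univ.erase a, hermitePoly (ρ b) b (m b) (n b) := by
  rw [hermiteProd_eq_mul ρ _ _ a]
  congr 1
  · simp
  · refine Finset.prod_congr rfl fun b hb => ?_
    simp [Pi.single_eq_of_ne (Finset.ne_of_mem_erase hb)]

theorem hermiteProd_add_single (m n : B → ℕ) (a : B) : hermiteProd ρ (m + Pi.single a 1) n =
    MvPolynomial.X (Sum.inl a) * hermiteProd ρ m n -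
      ((n a : ℂ) * ρ a) • hermiteProd ρ m (n - Pi.single a 1) := by
  rw [hermiteProd_sub_single, hermiteProd_eq_mul ρ m n a, hermiteProd_eq_mul ρ _ n a]
  have h1 : ∏ b ∈ Finset.univ.erase a, hermitePoly (ρ b) b ((m + Pi.single a 1 : B → ℕ) b) (n b) =
      ∏ b ∈ Finset.univ.erase a, hermitePoly (ρ b) b (m b) (n b) := by
    refine Finset.prod_congr rfl fun b hb => ?_
    simp [Pi.single_eq_of_ne (Finset.ne_of_mem_erase hb)]
  rw [h1, Pi.add_apply, Pi.single_eq_same, hermitePoly_succ, sub_mul, mul_assoc, smul_mul_assoc]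

theorem pderiv_hermiteProd (m n : B → ℕ) (a : B) :
    MvPolynomial.pderiv (Sum.inr a) (hermiteProd ρ m n) =
      (n a : ℂ) • hermiteProd ρ m (n - Pi.single a 1) := by
  rw [hermiteProd_sub_single, hermiteProd_eq_mul ρ m n a, MvPolynomial.pderiv_mul,
    pderiv_hermitePoly, pderiv_prod_eq_zero, mul_zero, add_zero, smul_mul_assoc]
  exact fun b hb => pderiv_hermitePoly_of_ne _ (Finset.ne_of_mem_erase hb) _ _

/-- Integration by parts in Z (x a) yields a sum over all b. The term b = a has coefficient ‖x a‖²
and cancels the correction term of the Hermite recursion, so a slot is never contracted with its own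
vertex. -/
theorem hermiteExpect_add_single (hZ : IsComplexIsonormal Z P) (x : B → H) (m n : B → ℕ) (a : B) :
    hermiteExpect hZ x (m + Pi.single a 1) n =
      ∑ b ∈ Finset.univ.erase a,
        inner ℂ (x b) (x a) * (n b * hermiteExpect hZ x m (n - Pi.single b 1)) := by
  rw [hermiteExpect, hermiteProd_add_single, map_sub, expect_inl_mul, map_smul, smul_eq_mul,
    ← Finset.add_sum_erase _ _ (Finset.mem_univ a)]
  simp only [pderiv_hermiteProd, map_smul, smul_eq_mul, hermiteExpect, inner_self_eq_norm_sq_to_K]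
  push_cast
  simp only [Complex.coe_algebraMap]
  ring

/-- Only conjugate variables remain. Integrating by parts in one of them differentiates in the
unconjugated variables, which do not occur. -/
theorem hermiteExpect_zero (hZ : IsComplexIsonormal Z P) (x : B → H) (n : B → ℕ) :
    hermiteExpect hZ x 0 n = if n = 0 then 1 else 0 := by
  split_ifs with h
  · subst h
    simp [hermiteExpect, hermiteProd, hermitePoly_zero, expect_one]
  · obtain ⟨b, hb⟩ := Function.ne_iff.1 h
    obtain ⟨k, hk⟩ := Nat.exists_eq_succ_of_ne_zero hb
    rw [hermiteExpect, hermiteProd_eq_mul _ _ _ b]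
    simp only [Pi.zero_apply, hermitePoly_zero]
    rw [hk, pow_succ', mul_assoc, expect_inr_mul]
    refine Finset.sum_eq_zero fun c _ => ?_
    have h1 : ∀ (a : B) (k : ℕ), MvPolynomial.pderiv (Sum.inl c)
        (MvPolynomial.X (Sum.inr a : B ⊕ B) ^ k : MvPolynomial (B ⊕ B) ℂ) = 0 := fun a k => by
      rw [MvPolynomial.pderiv_pow, MvPolynomial.pderiv_X_of_ne (by simp)]; simp
    rw [MvPolynomial.pderiv_mul, h1, pderiv_prod_eq_zero _ _ _ fun a _ => h1 a _]
    simp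

/-- The generating polynomial of the contraction patterns without self-contractions. -/
noncomputable def rowProd (g : B → B → ℂ) (m : B → ℕ) : MvPolynomial B ℂ :=
  ∏ a, (∑ b ∈ Finset.univ.erase a, g a b • MvPolynomial.X b) ^ m a

/-- Expectations of products of complex Hermite polynomials count contraction patterns. -/
theorem hermiteExpect_eq_coeff (hZ : IsComplexIsonormal Z P) (x : B → H) (m n : B → ℕ) :
    hermiteExpect hZ x m n = (∏ b, ((n b).factorial : ℂ)) *
      MvPolynomial.coeff (Finsupp.equivFunOnFinite.symm n)
        (rowProd (fun a b => inner ℂ (x b) (x a)) m) := by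
  -- Induction on the total number of unbarred slots; integration by parts removes one factor from
  -- the row of a, and extracting X b from the generating polynomial lowers n b.
  induction hk : ∑ a, m a generalizing m n with
  | zero =>
    have hm : m = 0 := funext fun a => by
      simpa using (Finset.sum_eq_zero_iff.1 hk) a (Finset.mem_univ a)
    subst hm
    rw [hermiteExpect_zero, rowProd]
    simp only [Pi.zero_apply, pow_zero, Finset.prod_const_one, MvPolynomial.coeff_one]
    by_cases hn : n = 0
    · subst hn
      have : (0 : B →₀ ℕ) = Finsupp.equivFunOnFinite.symm 0 := by ext; simp
      simp [this]
    · rw [if_neg hn, if_neg, mul_zero]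
      intro h
      exact hn (by ext b; simpa using (DFunLike.congr_fun h b).symm)
  | succ k ih =>
    obtain ⟨a, ha⟩ : ∃ a, m a ≠ 0 := by
      by_contra! h
      simp [h] at hk
    obtain ⟨m', rfl⟩ : ∃ m' : B → ℕ, m = m' + Pi.single a 1 := by
      refine ⟨m - Pi.single a 1, funext fun b => ?_⟩
      by_cases hb : b = a
      · subst hb; simp; omega
      · simp [hb]
    have hk' : ∑ b, m' b = k := by
      simp [Finset.sum_add_distrib] at hk; exact hk
    have hrow : rowProd (fun a b => inner ℂ (x b) (x a)) (m' + Pi.single a 1) =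
        ∑ b ∈ Finset.univ.erase a, (inner ℂ (x b) (x a) : ℂ) •
          (MvPolynomial.X b * rowProd (fun a b => inner ℂ (x b) (x a)) m') := by
      have : ∀ b ∈ Finset.univ.erase a, (m' + Pi.single a 1 : B → ℕ) b = m' b := fun b hb => by
        simp [Pi.single_eq_of_ne (Finset.ne_of_mem_erase hb)]
      rw [rowProd, rowProd, ← Finset.mul_prod_erase _ _ (Finset.mem_univ a),
        ← Finset.mul_prod_erase Finset.univ (fun c => (∑ b ∈ Finset.univ.erase c,
          (inner ℂ (x b) (x c) : ℂ) • (MvPolynomial.X b : MvPolynomial B ℂ)) ^ m' c)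
          (Finset.mem_univ a), Finset.prod_congr rfl fun b hb => by rw [this b hb]]
      rw [Pi.add_apply, Pi.single_eq_same, pow_succ', mul_assoc, Finset.sum_mul]
      simp only [smul_mul_assoc]
    rw [hermiteExpect_add_single, hrow, MvPolynomial.coeff_sum, Finset.mul_sum]
    refine Finset.sum_congr rfl fun b _ => ?_
    rw [MvPolynomial.coeff_smul, MvPolynomial.coeff_X_mul', smul_eq_mul, ih _ _ hk']
    by_cases hb : n b = 0
    · rw [if_neg (by simpa using hb), hb]; simp
    · rw [if_pos (by simpa using hb)]
      have h1 : Finsupp.equivFunOnFinite.symm (n - Pi.single b 1) =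
          Finsupp.equivFunOnFinite.symm n - Finsupp.single b 1 := by
        ext c; simp [Finsupp.single_apply, Pi.single_apply, eq_comm]
      have h2 : ∏ c, ((n c).factorial : ℂ) =
          n b * ∏ c, (((n - Pi.single b 1 : B → ℕ) c).factorial : ℂ) := by
        have h3 : ∏ c ∈ Finset.univ.erase b, (((n - Pi.single b 1 : B → ℕ) c).factorial : ℂ) =
            ∏ c ∈ Finset.univ.erase b, ((n c).factorial : ℂ) :=
          Finset.prod_congr rfl fun c hc => by
            simp [Pi.single_eq_of_ne (Finset.ne_of_mem_erase hc)]
        rw [← Finset.mul_prod_erase _ _ (Finset.mem_univ b),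
          ← Finset.mul_prod_erase _ _ (Finset.mem_univ b), h3, ← mul_assoc]
        congr 1
        obtain ⟨k, hk⟩ := Nat.exists_eq_succ_of_ne_zero hb
        simp [hk, Nat.factorial_succ]
      rw [h1, h2]
      ring

end hermite

/-! ### Permanents of block matrices and expectations of fourfold products -/

section permanent

/-- The polynomial `(a X + b) ^ α (c X + d) ^ β`. -/
noncomputable def blockPoly (α β : ℕ) (a b c d : ℂ) : Polynomial ℂ :=
  (Polynomial.C a * Polynomial.X + Polynomial.C b) ^ α *
    (Polynomial.C c * Polynomial.X + Polynomial.C d) ^ β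

/-- The permanent of the matrix with constant blocks `a`, `b`, `c`, `d`, with `α` and `β` rows and
`γ` and `δ` columns. -/
noncomputable def blockPerm (α β γ δ : ℕ) (a b c d : ℂ) : ℂ :=
  if γ + δ = α + β then (γ.factorial : ℂ) * δ.factorial * (blockPoly α β a b c d).coeff γ else 0

/-- Every γ-element set is the preimage of the first γ columns under exactly γ! (p - γ)!
permutations. -/
theorem sum_perm_prefix {p γ : ℕ} (hγ : γ ≤ p) (φ : Finset (Fin p) → ℂ) :
    ∑ σ : Equiv.Perm (Fin p), φ (Finset.univ.filter fun k => (σ k : ℕ) < γ) =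
      (γ.factorial : ℂ) * (p - γ).factorial *
        ∑ S ∈ Finset.powersetCard γ (Finset.univ : Finset (Fin p)), φ S := by
  have hcard : ∀ σ : Equiv.Perm (Fin p),
      (Finset.univ.filter fun k => (σ k : ℕ) < γ).card = γ := by
    intro σ
    rw [← Finset.card_map σ.toEmbedding]
    have : (Finset.univ.filter fun k => (σ k : ℕ) < γ).map σ.toEmbedding =
        Finset.univ.filter fun k : Fin p => (k : ℕ) < γ := by
      ext k
      simp only [Finset.mem_map_equiv, Finset.mem_filter, Finset.mem_univ, true_and,
        Equiv.apply_symm_apply]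
    rw [this, Fin.card_filter_val_lt, min_eq_right hγ]
  rw [← Finset.sum_fiberwise_of_maps_to (t := Finset.powersetCard γ Finset.univ)
    (g := fun σ : Equiv.Perm (Fin p) => Finset.univ.filter fun k => (σ k : ℕ) < γ)
    (fun σ _ => Finset.mem_powersetCard.2 ⟨Finset.subset_univ _, hcard σ⟩), Finset.mul_sum]
  refine Finset.sum_congr rfl fun S hS => ?_
  have hSc := (Finset.mem_powersetCard.1 hS).2
  rw [Finset.sum_congr rfl (g := fun _ => φ S)
    fun σ hσ => congrArg φ (Finset.mem_filter.1 hσ).2, Finset.sum_const, nsmul_eq_mul]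
  congr 1
  have h1 := Numbering.card_prefixed S
  rw [hSc, Fintype.card_fin] at h1
  rw [← Nat.cast_mul, ← h1]
  congr 1
  refine Finset.card_equiv ((Equiv.refl _).equivCongr (finCongr (Fintype.card_fin p).symm))
    fun σ => ?_
  simp only [Finset.mem_filter, Finset.mem_univ, true_and, Numbering.mem_prefixed,
    Numbering.IsPrefix, hSc, Finset.ext_iff]
  exact forall_congr' fun k => iff_comm

/-- The product depends only on the set of rows sent to the first γ columns. Summing over these sets
reads off the coefficient of X^γ in the product of one linear factor per row. -/
theorem sum_perm_block {p α β γ δ : ℕ} (h1 : α + β = p) (h2 : γ + δ = p) (G : Bool → Bool → ℂ) :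
    ∑ σ : Equiv.Perm (Fin p), ∏ k : Fin p, G (decide ((k : ℕ) < α)) (decide ((σ k : ℕ) < γ)) =
      blockPerm α β γ δ (G true true) (G true false) (G false true) (G false false) := by
  rw [blockPerm, if_pos (h2.trans h1.symm)]
  have h3 := sum_perm_prefix (p := p) (γ := γ) (by omega)
    fun S => ∏ k : Fin p, G (decide ((k : ℕ) < α)) (decide (k ∈ S))
  simp only [Finset.mem_filter, Finset.mem_univ, true_and] at h3
  rw [h3, show p - γ = δ by omega]
  congr 1
  have h4 : blockPoly α β (G true true) (G true false) (G false true) (G false false) =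
      ∏ k : Fin p, (Polynomial.C (G (decide ((k : ℕ) < α)) true) * Polynomial.X +
        Polynomial.C (G (decide ((k : ℕ) < α)) false)) := by
    subst h1
    rw [Fin.prod_univ_add]
    simp [blockPoly]
  rw [h4, Finset.prod_add, Polynomial.finsetSum_coeff, Finset.powersetCard_eq_filter,
    Finset.sum_filter]
  refine Finset.sum_congr rfl fun S _ => ?_
  rw [Finset.prod_mul_distrib, Finset.prod_const, ← map_prod, ← map_prod, mul_right_comm, ← map_mul,
    Polynomial.coeff_C_mul_X_pow]
  refine if_congr eq_comm ?_ rfl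
  rw [← Finset.prod_mul_prod_compl S]
  congr 1
  · exact Finset.prod_congr rfl fun k hk => by simp [hk]
  · exact Finset.prod_congr (Finset.compl_eq_univ_sdiff _) fun k hk => by
      simp [Finset.mem_compl.1 (by simpa using hk)]

variable {R : Type*} [CommRing R] [Algebra ℂ R]

/-- The value at `(X, Y)` of the homogenization of degree `N` of `p`. -/
noncomputable def homEval (N : ℕ) (p : Polynomial ℂ) (X Y : R) : R :=
  ∑ γ ∈ Finset.range (N + 1), p.coeff γ • (X ^ γ * Y ^ (N - γ))

/-- The inductive step for `pow_mul_pow_eq_homEval`. The degree bound ensures that the truncated sum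
defining `homEval` loses no coefficient. -/
theorem homEval_linear_mul {N : ℕ} {p : Polynomial ℂ} (hp : p.natDegree ≤ N) (a b : ℂ) (X Y : R) :
    homEval (N + 1) ((Polynomial.C a * Polynomial.X + Polynomial.C b) * p) X Y =
      (a • X + b • Y) * homEval N p X Y := by
  have h0 : ((Polynomial.C a * Polynomial.X + Polynomial.C b) * p).coeff 0 = b * p.coeff 0 := by
    simp [add_mul, mul_assoc]
  have h1 : ∀ γ, ((Polynomial.C a * Polynomial.X + Polynomial.C b) * p).coeff (γ + 1) =
      a * p.coeff γ + b * p.coeff (γ + 1) := by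
    intro γ
    rw [add_mul, mul_assoc, Polynomial.coeff_add, Polynomial.coeff_C_mul, Polynomial.coeff_X_mul,
      Polynomial.coeff_C_mul]
  have h2 : b • Y * homEval N p X Y =
      ∑ γ ∈ Finset.range (N + 2), (b * p.coeff γ) • (X ^ γ * Y ^ (N + 1 - γ)) := by
    rw [Finset.sum_range_succ, Polynomial.coeff_eq_zero_of_natDegree_lt (by omega), mul_zero,
      zero_smul, add_zero, homEval, Finset.mul_sum]
    refine Finset.sum_congr rfl fun γ hγ => ?_
    rw [show N + 1 - γ = N - γ + 1 by have := Finset.mem_range.1 hγ; omega, pow_succ]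
    simp only [Algebra.smul_def, map_mul]
    ring
  rw [add_mul (a • X), h2, homEval, Finset.sum_range_succ', Finset.sum_range_succ' _ (N + 1), ← add_assoc]
  congr 1
  · rw [homEval, Finset.mul_sum, ← Finset.sum_add_distrib]
    refine Finset.sum_congr rfl fun γ _ => ?_
    rw [h1, show N + 1 - (γ + 1) = N - γ by omega, pow_succ]
    simp only [Algebra.smul_def, map_mul, map_add]
    ring
  · rw [h0]

theorem natDegree_blockPoly_le (α β : ℕ) (a b c d : ℂ) :
    (blockPoly α β a b c d).natDegree ≤ α + β := by
  refine Polynomial.natDegree_mul_le.trans (add_le_add ?_ ?_) <;>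
  · refine Polynomial.natDegree_pow_le.trans ?_
    exact (Nat.mul_le_mul_left _ Polynomial.natDegree_linear_le).trans_eq (mul_one _)

theorem pow_mul_pow_eq_homEval (α β : ℕ) (a b c d : ℂ) (X Y : R) :
    (a • X + b • Y) ^ α * (c • X + d • Y) ^ β = homEval (α + β) (blockPoly α β a b c d) X Y := by
  induction α with
  | zero =>
    induction β with
    | zero => simp [homEval, blockPoly]
    | succ β ih =>
      have h := homEval_linear_mul (natDegree_blockPoly_le 0 β a b c d) c d X Y
      rw [← ih] at h
      rw [show 0 + (β + 1) = 0 + β + 1 by ring]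
      convert h.symm using 1
      · ring
      · congr 1
        simp only [blockPoly]; ring
  | succ α ih =>
    have h := homEval_linear_mul (natDegree_blockPoly_le α β a b c d) a b X Y
    rw [← ih] at h
    rw [show α + 1 + β = α + β + 1 by ring]
    convert h.symm using 1
    · ring
    · congr 1
      simp only [blockPoly]; ring

theorem sum_coeff_ite (P : Polynomial ℂ) (A u v s t : ℕ) :
    ∑ γ ∈ Finset.range (A + 1), P.coeff γ * (if s = u + γ ∧ t = v + (A - γ) then 1 else 0) =
      if u ≤ s ∧ v ≤ t ∧ (s - u) + (t - v) = A then P.coeff (s - u) else 0 := by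
  by_cases h : u ≤ s ∧ v ≤ t ∧ (s - u) + (t - v) = A
  · rw [if_pos h, Finset.sum_eq_single (s - u)]
    · rw [if_pos (by omega), mul_one]
    · intro γ hγ hne
      rw [if_neg (by omega), mul_zero]
    · intro h'
      exact absurd (Finset.mem_range.2 (by omega)) h'
  · rw [if_neg h]
    refine Finset.sum_eq_zero fun γ hγ => ?_
    have := Finset.mem_range.1 hγ
    rw [if_neg (by omega), mul_zero]

theorem coeff_fin_four (n : Fin 4 → ℕ) (a b c d : ℕ) :
    MvPolynomial.coeff (Finsupp.equivFunOnFinite.symm n)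
      (MvPolynomial.X 0 ^ a * MvPolynomial.X 1 ^ b * MvPolynomial.X 2 ^ c * MvPolynomial.X 3 ^ d :
        MvPolynomial (Fin 4) ℂ) =
      if (n 0 = a ∧ n 1 = b) ∧ (n 2 = c ∧ n 3 = d) then 1 else 0 := by
  have h : (MvPolynomial.X 0 ^ a * MvPolynomial.X 1 ^ b * MvPolynomial.X 2 ^ c *
      MvPolynomial.X 3 ^ d : MvPolynomial (Fin 4) ℂ) =
      MvPolynomial.monomial (Finsupp.equivFunOnFinite.symm ![a, b, c, d]) 1 := by
    rw [MvPolynomial.monomial_eq, Finsupp.prod_fintype _ _ (by simp), Fin.prod_univ_four]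
    simp
  rw [h, MvPolynomial.coeff_monomial]
  refine if_congr ?_ rfl rfl
  rw [Equiv.apply_eq_iff_eq, funext_iff, Fin.forall_fin_succ, Fin.forall_fin_succ,
    Fin.forall_fin_succ, Fin.forall_fin_succ]
  simp [eq_comm, and_assoc]

/-- The two homogeneous forms involve disjoint pairs of variables, so the coefficient factorizes,
and each factor selects a single coefficient. -/
theorem coeff_mul_homEval (n : Fin 4 → ℕ) (i j i' j' A A' : ℕ) (P P' : Polynomial ℂ) :
    MvPolynomial.coeff (Finsupp.equivFunOnFinite.symm n)
      (MvPolynomial.X 1 ^ i * MvPolynomial.X 0 ^ j * MvPolynomial.X 3 ^ i' * MvPolynomial.X 2 ^ j' *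
        (homEval A P (MvPolynomial.X 3) (MvPolynomial.X 2) *
          homEval A' P' (MvPolynomial.X 0) (MvPolynomial.X 1)) : MvPolynomial (Fin 4) ℂ) =
      (if i' ≤ n 3 ∧ j' ≤ n 2 ∧ (n 3 - i') + (n 2 - j') = A then P.coeff (n 3 - i') else 0) *
        (if j ≤ n 0 ∧ i ≤ n 1 ∧ (n 0 - j) + (n 1 - i) = A' then P'.coeff (n 0 - j) else 0) := by
  rw [← sum_coeff_ite, ← sum_coeff_ite, Finset.sum_mul_sum, homEval, homEval, Finset.sum_mul_sum,
    Finset.mul_sum, MvPolynomial.coeff_sum]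
  refine Finset.sum_congr rfl fun γ _ => ?_
  rw [Finset.mul_sum, MvPolynomial.coeff_sum]
  refine Finset.sum_congr rfl fun γ' _ => ?_
  have h := coeff_fin_four n (j + γ') (i + (A' - γ')) (j' + (A - γ)) (i' + γ)
  have h1 : (MvPolynomial.X 1 ^ i * MvPolynomial.X 0 ^ j * MvPolynomial.X 3 ^ i' *
      MvPolynomial.X 2 ^ j' * (P.coeff γ • (MvPolynomial.X 3 ^ γ * MvPolynomial.X 2 ^ (A - γ)) *
        P'.coeff γ' • (MvPolynomial.X 0 ^ γ' * MvPolynomial.X 1 ^ (A' - γ'))) :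
        MvPolynomial (Fin 4) ℂ) = (P.coeff γ * P'.coeff γ') •
      (MvPolynomial.X 0 ^ (j + γ') * MvPolynomial.X 1 ^ (i + (A' - γ')) *
        MvPolynomial.X 2 ^ (j' + (A - γ)) * MvPolynomial.X 3 ^ (i' + γ)) := by
    simp only [MvPolynomial.smul_eq_C_mul, map_mul]
    ring
  rw [h1, MvPolynomial.coeff_smul, h, smul_eq_mul]
  by_cases h2 : n 3 = i' + γ ∧ n 2 = j' + (A - γ)
  · by_cases h3 : n 0 = j + γ' ∧ n 1 = i + (A' - γ')
    · rw [if_pos h2, if_pos h3, if_pos ⟨h3, h2.symm⟩]; ring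
    · rw [if_neg h3, if_neg fun h => h3 h.1]; ring
  · rw [if_neg h2, if_neg fun h => h2 h.2.symm]; ring

/-- The weight of the contraction patterns of two kernels of bidegrees `(m₁, n₁)` and `(m₂, n₂)`
with `i` and `j` contractions of the two types. -/
noncomputable def contrWeight (m₁ n₁ m₂ n₂ i j : ℕ) : ℂ :=
  (m₁.choose i : ℂ) * n₂.choose i * i.factorial * (m₂.choose j * n₁.choose j * j.factorial)

/-- The contribution to a fourfold expectation of the contraction patterns with prescribed numbers
of contractions between the first two and between the last two kernels. -/
noncomputable def patternValue (g : Fin 4 → Fin 4 → ℂ) (m n : Fin 4 → ℕ) (i j i' j' : ℕ) : ℂ :=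
  g 0 1 ^ i * g 1 0 ^ j * g 2 3 ^ i' * g 3 2 ^ j' *
    (blockPerm (m 0 - i) (m 1 - j) (n 3 - i') (n 2 - j') (g 0 3) (g 0 2) (g 1 3) (g 1 2) *
      blockPerm (m 3 - j') (m 2 - i') (n 0 - j) (n 1 - i) (g 3 0) (g 3 1) (g 2 0) (g 2 1))

/-- Writing s! = C(s, u) u! (s - u)! leaves precisely the factorials needed for a block permanent;
when u > s or v > t, both sides are zero. -/
theorem factorial_mul_ite (P : Polynomial ℂ) (s t u v A : ℕ) :
    ((s.factorial : ℂ) * t.factorial) *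
      (if u ≤ s ∧ v ≤ t ∧ (s - u) + (t - v) = A then P.coeff (s - u) else 0) =
    (s.choose u * u.factorial) * (t.choose v * v.factorial) *
      (if (s - u) + (t - v) = A then
        ((s - u).factorial : ℂ) * (t - v).factorial * P.coeff (s - u) else 0) := by
  rcases le_or_gt u s with hu | hu
  · rcases le_or_gt v t with hv | hv
    · simp only [hu, hv, true_and, mul_ite, mul_zero]
      congr 1
      rw [← Nat.choose_mul_factorial_mul_factorial hu, ← Nat.choose_mul_factorial_mul_factorial hv]
      push_cast
      ring
    · rw [if_neg (by omega), Nat.choose_eq_zero_of_lt hv]; simp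
  · rw [if_neg (by omega), Nat.choose_eq_zero_of_lt hu]; simp

theorem sum_mul_sum_four {R : Type*} [CommSemiring R] (s t u v : Finset ℕ) (a b c d : ℕ → R) :
    (∑ i ∈ s, a i) * (∑ i ∈ t, b i) * (∑ i ∈ u, c i) * (∑ i ∈ v, d i) =
      ∑ i ∈ s, ∑ j ∈ t, ∑ k ∈ u, ∑ l ∈ v, a i * b j * c k * d l := by
  simp only [← Finset.mul_sum, ← Finset.sum_mul]

/-- In each row the variable of the partner within {0, 1} or {2, 3} is separated by the binomial
theorem, which produces i, j, i', j'. What remains of rows 0 and 1 involves only X 3 and X 2, what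
remains of rows 2 and 3 only X 0 and X 1; these two parts become the block permanents. -/
theorem coeff_rowProd_fin_four (g : Fin 4 → Fin 4 → ℂ) (m n : Fin 4 → ℕ) :
    (∏ b, ((n b).factorial : ℂ)) *
      MvPolynomial.coeff (Finsupp.equivFunOnFinite.symm n) (rowProd g m) =
    ∑ i ∈ Finset.range (m 0 + 1), ∑ j ∈ Finset.range (m 1 + 1),
      ∑ i' ∈ Finset.range (m 2 + 1), ∑ j' ∈ Finset.range (m 3 + 1),
        contrWeight (m 0) (n 0) (m 1) (n 1) i j * contrWeight (m 2) (n 2) (m 3) (n 3) i' j' *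
          patternValue g m n i j i' j' := by
  have h0 : ∑ b ∈ Finset.univ.erase (0 : Fin 4), g 0 b • (MvPolynomial.X b : MvPolynomial _ ℂ) =
      g 0 1 • MvPolynomial.X 1 + (g 0 3 • MvPolynomial.X 3 + g 0 2 • MvPolynomial.X 2) := by
    rw [show Finset.univ.erase (0 : Fin 4) = {1, 3, 2} by decide]
    simp
  have h1 : ∑ b ∈ Finset.univ.erase (1 : Fin 4), g 1 b • (MvPolynomial.X b : MvPolynomial _ ℂ) =
      g 1 0 • MvPolynomial.X 0 + (g 1 3 • MvPolynomial.X 3 + g 1 2 • MvPolynomial.X 2) := by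
    rw [show Finset.univ.erase (1 : Fin 4) = {0, 3, 2} by decide]
    simp
  have h2 : ∑ b ∈ Finset.univ.erase (2 : Fin 4), g 2 b • (MvPolynomial.X b : MvPolynomial _ ℂ) =
      g 2 3 • MvPolynomial.X 3 + (g 2 0 • MvPolynomial.X 0 + g 2 1 • MvPolynomial.X 1) := by
    rw [show Finset.univ.erase (2 : Fin 4) = {3, 0, 1} by decide]
    simp
  have h3 : ∑ b ∈ Finset.univ.erase (3 : Fin 4), g 3 b • (MvPolynomial.X b : MvPolynomial _ ℂ) =
      g 3 2 • MvPolynomial.X 2 + (g 3 0 • MvPolynomial.X 0 + g 3 1 • MvPolynomial.X 1) := by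
    rw [show Finset.univ.erase (3 : Fin 4) = {2, 0, 1} by decide]
    simp
  rw [rowProd, Fin.prod_univ_four (fun a => (∑ b ∈ Finset.univ.erase a,
    g a b • (MvPolynomial.X b : MvPolynomial _ ℂ)) ^ m a), h0, h1, h2, h3, add_pow,
    add_pow _ _ (m 1), add_pow _ _ (m 2), add_pow _ _ (m 3), sum_mul_sum_four]
  simp only [MvPolynomial.coeff_sum, Finset.mul_sum]
  refine Finset.sum_congr rfl fun i _ => Finset.sum_congr rfl fun j _ =>
    Finset.sum_congr rfl fun i' _ => Finset.sum_congr rfl fun j' _ => ?_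
  have e1 := pow_mul_pow_eq_homEval (m 0 - i) (m 1 - j) (g 0 3) (g 0 2) (g 1 3) (g 1 2)
    (MvPolynomial.X 3 : MvPolynomial (Fin 4) ℂ) (MvPolynomial.X 2)
  have e2 := pow_mul_pow_eq_homEval (m 3 - j') (m 2 - i') (g 3 0) (g 3 1) (g 2 0) (g 2 1)
    (MvPolynomial.X 0 : MvPolynomial (Fin 4) ℂ) (MvPolynomial.X 1)
  have e3 := coeff_mul_homEval n i j i' j' (m 0 - i + (m 1 - j)) (m 3 - j' + (m 2 - i'))
    (blockPoly (m 0 - i) (m 1 - j) (g 0 3) (g 0 2) (g 1 3) (g 1 2))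
    (blockPoly (m 3 - j') (m 2 - i') (g 3 0) (g 3 1) (g 2 0) (g 2 1))
  rw [← e1, ← e2] at e3
  set K : ℂ := (m 0).choose i * (m 1).choose j * (m 2).choose i' * (m 3).choose j' *
    (g 0 1 ^ i * g 1 0 ^ j * g 2 3 ^ i' * g 3 2 ^ j') with hK
  have e4 : ∀ q q' : ℂ, (∏ b, ((n b).factorial : ℂ)) * (K * (q * q')) =
      K * ((((n 3).factorial : ℂ) * (n 2).factorial * q) *
        (((n 0).factorial : ℂ) * (n 1).factorial * q')) := by
    intro q q'
    rw [Fin.prod_univ_four]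
    ring
  rw [patternValue, contrWeight, contrWeight, blockPerm, blockPerm]
  refine Eq.trans (congrArg (fun q => (∏ b, ((n b).factorial : ℂ)) * q)
    (Eq.trans ?_ (congrArg (fun q => K * q) e3))) ((e4 _ _).trans ?_)
  · rw [← smul_eq_mul K, ← MvPolynomial.coeff_smul]
    congr 1
    simp only [hK, MvPolynomial.smul_eq_C_mul, map_mul, map_pow, map_natCast, mul_pow]
    ring
  · rw [factorial_mul_ite, factorial_mul_ite, hK]
    ring

end permanent

/-! ### Contractions of elementary tensors -/

section elementaryContractions

variable {ι H : Type*} [NormedAddCommGroup H] [InnerProductSpace ℂ H]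
  (e : HilbertBasis ι ℂ H) (J : H ≃ₗᵢ⋆[ℂ] H)

/-- The tensor `x^{⊗m} ⊗ (J x)^{⊗n}`. -/
noncomputable def powTensor (m n : ℕ) (x : H) : HTensor ι m n :=
  elemTensor e J (fun _ => x) fun _ => J x

theorem elemTensor_apply {p q : ℕ} (x : Fin p → H) (y : Fin q → H)
    (z : (Fin p → ι) × (Fin q → ι)) :
    elemTensor e J x y z = (∏ k, inner ℂ (e (z.1 k)) (x k)) * ∏ k, inner ℂ (J (e (z.2 k))) (y k) :=
  rfl

theorem powTensor_apply {p q : ℕ} (x : H) (z : (Fin p → ι) × (Fin q → ι)) :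
    powTensor e J p q x z = (∏ k, inner ℂ (e (z.1 k)) x) * ∏ k, inner ℂ x (e (z.2 k)) := by
  rw [powTensor, elemTensor_apply]
  simp only [inner_conj_conj]

theorem permute_apply {p q : ℕ} (σ : Equiv.Perm (Fin p)) (τ : Equiv.Perm (Fin q))
    (f : HTensor ι p q) (x : (Fin p → ι) × (Fin q → ι)) :
    permute σ τ f x = f (fun k => x.1 (σ k), fun k => x.2 (τ k)) := rfl

theorem contractAux_apply {a b c d : ℕ} (i j : ℕ) (f : HTensor ι (a + i) (b + j))
    (g : HTensor ι (c + j) (d + i)) (x : (Fin (a + c) → ι) × (Fin (b + d) → ι)) :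
    contractAux i j f g x = ∑' y : (Fin i → ι) × (Fin j → ι),
      f (Fin.append (fun k => x.1 (Fin.castAdd c k)) y.1,
          Fin.append (fun k => x.2 (Fin.castAdd d k)) y.2) *
        g (Fin.append (fun k => x.1 (Fin.natAdd a k)) y.2,
          Fin.append (fun k => x.2 (Fin.natAdd b k)) y.1) := rfl

theorem castTensor_powTensor {p q p' q' : ℕ} (hp : p = p') (hq : q = q') (x : H) :
    castTensor hp hq (powTensor e J p q x) = powTensor e J p' q' x := by
  subst hp hq
  rfl

theorem tsum_prod_inner (x y : H) (i : ℕ) :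
    (Summable fun α : Fin i → ι => ‖∏ k, (inner ℂ x (e (α k)) * inner ℂ (e (α k)) y : ℂ)‖) ∧
    ∑' α : Fin i → ι, ∏ k, (inner ℂ x (e (α k)) * inner ℂ (e (α k)) y : ℂ) = inner ℂ x y ^ i := by
  obtain ⟨h1, h2⟩ := hasSum_pi (fun (_ : Fin i) l => (inner ℂ x (e l) * inner ℂ (e l) y : ℂ))
    fun _ => (e.summable_inner_mul_inner x y).norm
  refine ⟨h1, h2.trans ?_⟩
  simp [e.tsum_inner_mul_inner]

/-- By Parseval, each contracted pair contributes an inner product of x and y, and the free slots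
factor out. -/
theorem contractAux_powTensor {a b c d : ℕ} (i j : ℕ) (x y : H) :
    contractAux i j (powTensor e J (a + i) (b + j) x) (powTensor e J (c + j) (d + i) y) =
      (inner ℂ y x ^ i * inner ℂ x y ^ j : ℂ) •
        elemTensor e J (fun k : Fin (a + c) => if (k : ℕ) < a then x else y)
          (fun k : Fin (b + d) => if (k : ℕ) < b then J x else J y) := by
  ext z
  obtain ⟨s1, t1⟩ := tsum_prod_inner e y x i
  obtain ⟨s2, t2⟩ := tsum_prod_inner e x y j
  rw [lp.coeFn_smul, Pi.smul_apply, smul_eq_mul, ← t1, ← t2,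
    tsum_mul_tsum_of_summable_norm s1 s2, ← tsum_mul_right, contractAux_apply]
  refine tsum_congr fun w => ?_
  rw [elemTensor_apply, powTensor_apply, powTensor_apply]
  simp only [Fin.prod_univ_add, Fin.append_left, Fin.append_right, Fin.val_castAdd, Fin.is_lt,
    if_true, Fin.val_natAdd, Nat.not_lt.2 (Nat.le_add_right _ _), if_false, inner_conj_conj,
    Finset.prod_mul_distrib]
  ring

theorem contract_powTensor {a b c d p q i j : ℕ} (h1 : i ≤ a) (h2 : i ≤ d) (h3 : j ≤ b)
    (h4 : j ≤ c) (hp : (a - i) + (c - j) = p) (hq : (b - j) + (d - i) = q) (x y : H) :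
    contract p q i j (powTensor e J a b x) (powTensor e J c d y) =
      (inner ℂ y x ^ i * inner ℂ x y ^ j : ℂ) •
        elemTensor e J (fun k : Fin p => if (k : ℕ) < a - i then x else y)
          (fun k : Fin q => if (k : ℕ) < b - j then J x else J y) := by
  rw [contract, dif_pos ⟨⟨⟨h1, h2⟩, h3, h4⟩, hp, hq⟩, castTensor_powTensor, castTensor_powTensor,
    contractAux_powTensor]
  subst hp hq
  rfl

theorem permute_elemTensor {p q : ℕ} (σ : Equiv.Perm (Fin p)) (τ : Equiv.Perm (Fin q))
    (x : Fin p → H) (y : Fin q → H) :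
    permute σ τ (elemTensor e J x y) =
      elemTensor e J (fun k => x (σ⁻¹ k)) fun k => y (τ⁻¹ k) := by
  ext z
  rw [permute_apply, elemTensor_apply, elemTensor_apply]
  congr 1
  · rw [← Equiv.prod_comp σ fun k => inner ℂ (e (z.1 k)) (x (σ⁻¹ k))]
    simp
  · rw [← Equiv.prod_comp τ fun k => inner ℂ (J (e (z.2 k))) (y (τ⁻¹ k))]
    simp

/-- The inner sum does not depend on σ': substituting the inverse of σ multiplied by σ' reduces it
to a single permanent. -/
theorem sum_perm_prod_inner {p : ℕ} (u u' : Fin p → H) :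
    ∑ σ' : Equiv.Perm (Fin p), ∑ σ : Equiv.Perm (Fin p),
      ∏ k, (inner ℂ (u' (σ'⁻¹ k)) (u (σ⁻¹ k)) : ℂ) =
    p.factorial * ∑ σ : Equiv.Perm (Fin p), ∏ k, (inner ℂ (u' k) (u (σ k)) : ℂ) := by
  have h : ∀ σ' : Equiv.Perm (Fin p), ∑ σ : Equiv.Perm (Fin p),
      ∏ k, (inner ℂ (u' (σ'⁻¹ k)) (u (σ⁻¹ k)) : ℂ) =
      ∑ σ : Equiv.Perm (Fin p), ∏ k, (inner ℂ (u' k) (u (σ k)) : ℂ) := by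
    intro σ'
    rw [← Equiv.sum_comp ((Equiv.inv _).trans (Equiv.mulLeft σ'))]
    refine Finset.sum_congr rfl fun σ _ => ?_
    rw [← Equiv.prod_comp σ']
    simp
  rw [Finset.sum_congr rfl fun σ' _ => h σ']
  simp [Fintype.card_perm]

theorem inner_symmetrize_elemTensor (hJ : ∀ x, J (J x) = x) {p q : ℕ} (u u' : Fin p → H)
    (v v' : Fin q → H) :
    (p.factorial : ℂ) * q.factorial *
      inner ℂ (symmetrize (elemTensor e J u' v')) (symmetrize (elemTensor e J u v)) =
    (∑ σ : Equiv.Perm (Fin p), ∏ k, (inner ℂ (u' k) (u (σ k)) : ℂ)) *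
      ∑ τ : Equiv.Perm (Fin q), ∏ k, (inner ℂ (v' k) (v (τ k)) : ℂ) := by
  have h : inner ℂ (∑ σ : Equiv.Perm (Fin p), ∑ τ : Equiv.Perm (Fin q),
        permute σ τ (elemTensor e J u' v'))
      (∑ σ : Equiv.Perm (Fin p), ∑ τ : Equiv.Perm (Fin q), permute σ τ (elemTensor e J u v)) =
      ((p.factorial : ℂ) * ∑ σ : Equiv.Perm (Fin p), ∏ k, (inner ℂ (u' k) (u (σ k)) : ℂ)) *
        (q.factorial * ∑ τ : Equiv.Perm (Fin q), ∏ k, (inner ℂ (v' k) (v (τ k)) : ℂ)) := by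
    rw [← sum_perm_prod_inner, ← sum_perm_prod_inner, Finset.sum_mul_sum, sum_inner]
    refine Finset.sum_congr rfl fun σ' _ => ?_
    rw [sum_inner]
    refine Finset.sum_congr rfl fun τ' _ => ?_
    rw [Finset.sum_mul_sum, inner_sum]
    refine Finset.sum_congr rfl fun σ _ => ?_
    rw [inner_sum]
    refine Finset.sum_congr rfl fun τ _ => ?_
    rw [permute_elemTensor, permute_elemTensor, inner_elemTensor e J hJ]
  rw [symmetrize, symmetrize, inner_smul_left, inner_smul_right, h]
  have h1 : (p.factorial : ℂ) ≠ 0 := by exact_mod_cast p.factorial_ne_zero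
  have h2 : (q.factorial : ℂ) ≠ 0 := by exact_mod_cast q.factorial_ne_zero
  simp only [map_inv₀, map_mul, map_natCast]
  field_simp

theorem symmetrize_smul {p q : ℕ} (c : ℂ) (f : HTensor ι p q) :
    symmetrize (c • f) = c • symmetrize f := by
  have h : ∀ (σ : Equiv.Perm (Fin p)) (τ : Equiv.Perm (Fin q)),
      permute σ τ (c • f) = c • permute σ τ f := fun _ _ => rfl
  simp only [symmetrize, h, ← Finset.smul_sum]
  rw [smul_comm]

/-- Both contractions are scalar multiples of elementary tensors with two distinct vectors per group
of slots, so the inner product of their symmetrizations is a product of two block permanents. The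
scalar of the first argument of `inner` is conjugated, which turns it into the i' and j' powers of
the pattern. -/
theorem inner_symContract_powTensor (hJ : ∀ x, J (J x) = x) (x : Fin 4 → H) (m n : Fin 4 → ℕ)
    {p q i j i' j' : ℕ} (h1 : i ≤ m 0) (h2 : i ≤ n 1) (h3 : j ≤ n 0) (h4 : j ≤ m 1)
    (h5 : i' ≤ n 3) (h6 : i' ≤ m 2) (h7 : j' ≤ m 3) (h8 : j' ≤ n 2)
    (hp : (m 0 - i) + (m 1 - j) = p) (hq : (n 0 - j) + (n 1 - i) = q)
    (hp' : (n 3 - i') + (n 2 - j') = p) (hq' : (m 3 - j') + (m 2 - i') = q) :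
    (p.factorial : ℂ) * q.factorial *
      inner ℂ
        (symContract p q i' j' (powTensor e J (n 3) (m 3) (x 3)) (powTensor e J (n 2) (m 2) (x 2)))
        (symContract p q i j (powTensor e J (m 0) (n 0) (x 0)) (powTensor e J (m 1) (n 1) (x 1))) =
    patternValue (fun a b => inner ℂ (x b) (x a)) m n i j i' j' := by
  rw [symContract, symContract, contract_powTensor e J h5 h6 h7 h8 hp' hq',
    contract_powTensor e J h1 h2 h3 h4 hp hq, symmetrize_smul, symmetrize_smul, inner_smul_left,
    inner_smul_right]
  have key := inner_symmetrize_elemTensor e J hJ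
    (fun k : Fin p => if (k : ℕ) < m 0 - i then x 0 else x 1)
    (fun k : Fin p => if (k : ℕ) < n 3 - i' then x 3 else x 2)
    (fun k : Fin q => if (k : ℕ) < n 0 - j then J (x 0) else J (x 1))
    (fun k : Fin q => if (k : ℕ) < m 3 - j' then J (x 3) else J (x 2))
  have k1 := sum_perm_block hp hp' fun r c => inner ℂ (bif c then x 3 else x 2)
    (bif r then x 0 else x 1)
  have k2 := sum_perm_block hq' hq fun r c => inner ℂ (bif c then x 0 else x 1)
    (bif r then x 3 else x 2)
  -- Passing to inverse permutations transposes the matrix, so that the rows belong to the vertices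
  -- 0 and 1.
  have k3 : ∑ σ : Equiv.Perm (Fin p), ∏ k : Fin p, (inner ℂ
      (if (k : ℕ) < n 3 - i' then x 3 else x 2)
      (if ((σ k : Fin p) : ℕ) < m 0 - i then x 0 else x 1) : ℂ) =
      ∑ σ : Equiv.Perm (Fin p), ∏ k : Fin p, (inner ℂ
        (bif decide ((σ k : ℕ) < n 3 - i') then x 3 else x 2)
        (bif decide ((k : ℕ) < m 0 - i) then x 0 else x 1) : ℂ) := by
    rw [← Equiv.sum_comp (Equiv.inv _)]
    refine Finset.sum_congr rfl fun σ _ => ?_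
    rw [← Equiv.prod_comp σ]
    simp [Bool.cond_decide]
  -- No transposition is needed here: J reverses inner products, so vertices 3 and 2 already index
  -- the rows.
  have k4 : ∑ τ : Equiv.Perm (Fin q), ∏ k : Fin q, (inner ℂ
      (if (k : ℕ) < m 3 - j' then J (x 3) else J (x 2))
      (if ((τ k : Fin q) : ℕ) < n 0 - j then J (x 0) else J (x 1)) : ℂ) =
      ∑ τ : Equiv.Perm (Fin q), ∏ k : Fin q, (inner ℂ
        (bif decide ((τ k : ℕ) < n 0 - j) then x 0 else x 1)
        (bif decide ((k : ℕ) < m 3 - j') then x 3 else x 2) : ℂ) := by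
    refine Finset.sum_congr rfl fun σ _ => Finset.prod_congr rfl fun k _ => ?_
    rw [Bool.cond_decide, Bool.cond_decide, ← apply_ite J, ← apply_ite J, inner_conj_conj]
  rw [k3, k4, k1, k2] at key
  rw [mul_left_comm, mul_left_comm (_ * _ : ℂ) (_ * _ : ℂ) (inner ℂ _ _), key, patternValue]
  simp only [cond_true, cond_false, map_mul, map_pow, inner_conj_symm]
  ring

end elementaryContractions

/-! ### The fourfold identity for powers of vectors -/

section fourfold

variable {ι H : Type*} [NormedAddCommGroup H] [InnerProductSpace ℂ H]
  (e : HilbertBasis ι ℂ H) (J : H ≃ₗᵢ⋆[ℂ] H)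

/-- The weighted sum of the symmetrized contractions with `r` contracted pairs. -/
noncomputable def weightedContract {a b c d : ℕ} (w : ℕ → ℕ → ℂ) (p q r : ℕ) (f : HTensor ι a b)
    (g : HTensor ι c d) : HTensor ι p q :=
  ∑ x ∈ Finset.HasAntidiagonal.antidiagonal r, w x.1 x.2 • symContract p q x.1 x.2 f g

/-- The weight `contrWeight`, with an additional factor `i / m₁`. -/
noncomputable def derivWeight (m₁ n₁ m₂ n₂ i j : ℕ) : ℂ :=
  (i : ℂ) / m₁ * contrWeight m₁ n₁ m₂ n₂ i j

theorem psi_eq {m n : ℕ} (f : HTensor ι m n) (h : HTensor ι n m) (r : ℕ) :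
    psi f h r = weightedContract (contrWeight m n n m) (m + n - r) (m + n - r) r f h := by
  refine Finset.sum_congr rfl fun x _ => ?_
  congr 1
  simp only [contrWeight]
  ring

theorem vartheta_eq {m n : ℕ} (f : HTensor ι m n) (h : HTensor ι n m) (r : ℕ) :
    vartheta f h r = weightedContract (derivWeight m n n m) (m + n - r) (m + n - r) r f h := by
  refine Finset.sum_congr rfl fun x _ => ?_
  congr 1
  simp only [derivWeight, contrWeight]
  ring

theorem phi_eq {m n : ℕ} (f : HTensor ι m n) (r : ℕ) :
    phi f r = weightedContract (contrWeight m n m n) (2 * m - r) (2 * n - r) r f f := by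
  refine Finset.sum_congr rfl fun x _ => ?_
  congr 1
  simp only [contrWeight]
  ring

theorem varsigma_eq {m n : ℕ} (f : HTensor ι m n) (r : ℕ) :
    varsigma f r = weightedContract (derivWeight m n m n) (2 * m - r) (2 * n - r) r f f := by
  refine Finset.sum_congr rfl fun x _ => ?_
  congr 1
  simp only [derivWeight, contrWeight]
  ring

theorem contrWeight_eq_zero {m₁ n₁ m₂ n₂ i j : ℕ} (h : ¬ ((i ≤ m₁ ∧ i ≤ n₂) ∧ j ≤ m₂ ∧ j ≤ n₁)) :
    contrWeight m₁ n₁ m₂ n₂ i j = 0 := by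
  have : m₁ < i ∨ n₂ < i ∨ m₂ < j ∨ n₁ < j := by omega
  rcases this with h | h | h | h <;> simp [contrWeight, Nat.choose_eq_zero_of_lt h]

/-- The unbarred slots left in {0, 1} must be matched with the barred slots left in {2, 3}, so their
numbers have to agree. -/
theorem patternValue_eq_zero (g : Fin 4 → Fin 4 → ℂ) (m n : Fin 4 → ℕ) {i j i' j' : ℕ}
    (h : (n 3 - i') + (n 2 - j') ≠ (m 0 - i) + (m 1 - j)) : patternValue g m n i j i' j' = 0 := by
  rw [patternValue, blockPerm, if_neg h]
  ring

theorem conj_contrWeight (m₁ n₁ m₂ n₂ i j : ℕ) :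
    (starRingEnd ℂ) (contrWeight m₁ n₁ m₂ n₂ i j) = contrWeight m₁ n₁ m₂ n₂ i j := by
  simp [contrWeight]

/-- The sum over contraction patterns as a sum of inner products of contractions. -/
theorem sum_patternValue_eq (hJ : ∀ x, J (J x) = x) (x : Fin 4 → H) (m n : Fin 4 → ℕ)
    (h1 : m 0 + m 1 = n 3 + n 2) (h2 : n 0 + n 1 = m 3 + m 2) {s t N : ℕ}
    (hs : m 0 + m 1 = s) (ht : n 0 + n 1 = t) (hN : s ≤ N) :
    ∑ i ∈ Finset.range (m 0 + 1), ∑ j ∈ Finset.range (m 1 + 1),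
      ∑ i' ∈ Finset.range (m 2 + 1), ∑ j' ∈ Finset.range (m 3 + 1),
        derivWeight (m 0) (n 0) (m 1) (n 1) i j * contrWeight (m 2) (n 2) (m 3) (n 3) i' j' *
          patternValue (fun a b => inner ℂ (x b) (x a)) m n i j i' j' =
    ∑ r ∈ Finset.range (N + 1),
      ((s - r).factorial : ℂ) * ((t - r).factorial : ℂ) *
        inner ℂ
          (weightedContract (contrWeight (n 3) (m 3) (n 2) (m 2)) (s - r) (t - r) r
            (powTensor e J (n 3) (m 3) (x 3)) (powTensor e J (n 2) (m 2) (x 2)))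
          (weightedContract (derivWeight (m 0) (n 0) (m 1) (n 1)) (s - r) (t - r) r
            (powTensor e J (m 0) (n 0) (x 0)) (powTensor e J (m 1) (n 1) (x 1))) := by
  subst hs ht
  set g : Fin 4 → Fin 4 → ℂ := fun a b => inner ℂ (x b) (x a) with hg
  let T : ℕ × ℕ → ℕ × ℕ → ℂ := fun y z =>
    derivWeight (m 0) (n 0) (m 1) (n 1) y.1 y.2 * contrWeight (m 2) (n 2) (m 3) (n 3) z.1 z.2 *
      patternValue g m n y.1 y.2 z.1 z.2
  -- Only patterns with i + j = i' + j' and nonvanishing binomials contribute. This support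
  -- condition makes truncated subtractions and differing summation ranges harmless below.
  have hT : ∀ y z, ¬ ((((y.1 ≤ m 0 ∧ y.1 ≤ n 1) ∧ y.2 ≤ m 1 ∧ y.2 ≤ n 0) ∧
      ((z.1 ≤ m 2 ∧ z.1 ≤ n 3) ∧ z.2 ≤ m 3 ∧ z.2 ≤ n 2)) ∧ y.1 + y.2 = z.1 + z.2) → T y z = 0 := by
    intro y z h
    simp only [T]
    by_cases ha : (y.1 ≤ m 0 ∧ y.1 ≤ n 1) ∧ y.2 ≤ m 1 ∧ y.2 ≤ n 0
    · by_cases hb : (z.1 ≤ m 2 ∧ z.1 ≤ n 3) ∧ z.2 ≤ m 3 ∧ z.2 ≤ n 2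
      · rw [patternValue_eq_zero g m n (by omega), mul_zero]
      · rw [contrWeight_eq_zero hb]; ring
    · rw [derivWeight, contrWeight_eq_zero ha]; ring
  have hterm : ∀ r, ∀ y ∈ Finset.HasAntidiagonal.antidiagonal r,
      ∀ z ∈ Finset.HasAntidiagonal.antidiagonal r,
      ((m 0 + m 1 - r).factorial : ℂ) * ((n 0 + n 1 - r).factorial : ℂ) *
        (derivWeight (m 0) (n 0) (m 1) (n 1) y.1 y.2 *
          (contrWeight (n 3) (m 3) (n 2) (m 2) z.1 z.2 *
          inner ℂ (symContract (m 0 + m 1 - r) (n 0 + n 1 - r) z.1 z.2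
              (powTensor e J (n 3) (m 3) (x 3)) (powTensor e J (n 2) (m 2) (x 2)))
            (symContract (m 0 + m 1 - r) (n 0 + n 1 - r) y.1 y.2
              (powTensor e J (m 0) (n 0) (x 0)) (powTensor e J (m 1) (n 1) (x 1))))) = T y z := by
    intro r y hy z hz
    rw [Finset.HasAntidiagonal.mem_antidiagonal] at hy hz
    have hw : contrWeight (n 3) (m 3) (n 2) (m 2) z.1 z.2 =
        contrWeight (m 2) (n 2) (m 3) (n 3) z.1 z.2 := by simp only [contrWeight]; ring
    by_cases ha : (y.1 ≤ m 0 ∧ y.1 ≤ n 1) ∧ y.2 ≤ m 1 ∧ y.2 ≤ n 0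
    · by_cases hb : (z.1 ≤ m 2 ∧ z.1 ≤ n 3) ∧ z.2 ≤ m 3 ∧ z.2 ≤ n 2
      · have := inner_symContract_powTensor e J hJ x m n (p := m 0 + m 1 - r)
          (q := n 0 + n 1 - r) ha.1.1 ha.1.2 ha.2.2 ha.2.1 hb.1.2 hb.1.1 hb.2.1 hb.2.2
          (by omega) (by omega) (by omega) (by omega)
        simp only [T, hg]
        rw [← this, hw]
        ring
      · rw [hT y z fun h => hb h.1.2, hw, contrWeight_eq_zero hb]; ring
    · rw [hT y z fun h => ha h.1.1, derivWeight, contrWeight_eq_zero ha]; ring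
  have hR : ∀ r, ((m 0 + m 1 - r).factorial : ℂ) * ((n 0 + n 1 - r).factorial : ℂ) *
        inner ℂ
          (weightedContract (contrWeight (n 3) (m 3) (n 2) (m 2)) (m 0 + m 1 - r) (n 0 + n 1 - r) r
            (powTensor e J (n 3) (m 3) (x 3)) (powTensor e J (n 2) (m 2) (x 2)))
          (weightedContract (derivWeight (m 0) (n 0) (m 1) (n 1)) (m 0 + m 1 - r) (n 0 + n 1 - r) r
            (powTensor e J (m 0) (n 0) (x 0)) (powTensor e J (m 1) (n 1) (x 1))) =
      ∑ y ∈ Finset.HasAntidiagonal.antidiagonal r, ∑ z ∈ Finset.HasAntidiagonal.antidiagonal r,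
        T y z := by
    intro r
    rw [weightedContract, weightedContract, inner_sum, Finset.mul_sum]
    refine Finset.sum_congr rfl fun y hy => ?_
    rw [inner_smul_right, sum_inner, Finset.mul_sum, Finset.mul_sum]
    refine Finset.sum_congr rfl fun z hz => ?_
    rw [inner_smul_left, conj_contrWeight, hterm r y hy z hz]
  rw [Finset.sum_congr rfl fun r _ => hR r]
  -- The rectangle and the antidiagonal both contain the support in z, so the sums over them agree.
  have hL : ∀ y : ℕ × ℕ, ∑ i' ∈ Finset.range (m 2 + 1), ∑ j' ∈ Finset.range (m 3 + 1),
      T y (i', j') = ∑ z ∈ Finset.HasAntidiagonal.antidiagonal (y.1 + y.2), T y z := by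
    intro y
    rw [← Finset.sum_product']
    refine Finset.sum_congr_of_eq_on_inter (fun z _ hz => ?_) (fun z _ hz => ?_) fun _ _ _ => rfl
    · refine hT y z fun h => hz ?_
      rw [Finset.HasAntidiagonal.mem_antidiagonal]; omega
    · refine hT y z fun h => hz ?_
      rw [Finset.mem_product, Finset.mem_range, Finset.mem_range]; omega
  have hL' : ∀ y : ℕ × ℕ, y.1 + y.2 ∈ Finset.range (N + 1) ∨
      ∑ z ∈ Finset.HasAntidiagonal.antidiagonal (y.1 + y.2), T y z = 0 := by
    intro y
    by_cases h : y.1 ≤ m 0 ∧ y.2 ≤ m 1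
    · left; rw [Finset.mem_range]; omega
    · right; exact Finset.sum_eq_zero fun z _ => hT y z (by omega)
  calc _ = ∑ i ∈ Finset.range (m 0 + 1), ∑ j ∈ Finset.range (m 1 + 1),
        ∑ z ∈ Finset.HasAntidiagonal.antidiagonal (i + j), T (i, j) z :=
        Finset.sum_congr rfl fun i _ => Finset.sum_congr rfl fun j _ => hL (i, j)
    _ = _ := by
      -- The pairs (i, j) are grouped by r = i + j, which is at most m 0 + m 1 ≤ N.
      rw [← Finset.sum_product' (f := fun i j =>
        ∑ z ∈ Finset.HasAntidiagonal.antidiagonal (i + j), T (i, j) z),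
        ← Finset.sum_fiberwise_of_maps_to (t := Finset.range (N + 1))
          (g := fun y : ℕ × ℕ => y.1 + y.2)]
      · refine Finset.sum_congr rfl fun r _ => ?_
        refine Finset.sum_congr_of_eq_on_inter (fun y hy hy' => ?_) (fun y hy hy' => ?_)
          fun y hy _ => ?_
        · exact absurd (Finset.HasAntidiagonal.mem_antidiagonal.2 (Finset.mem_filter.1 hy).2) hy'
        · refine Finset.sum_eq_zero fun z _ => hT y z fun h => hy' ?_
          rw [Finset.HasAntidiagonal.mem_antidiagonal] at hy
          rw [Finset.mem_filter, Finset.mem_product, Finset.mem_range, Finset.mem_range]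
          omega
        · rw [(Finset.mem_filter.1 hy).2]
      · intro y hy
        rw [Finset.mem_product, Finset.mem_range, Finset.mem_range] at hy
        rw [Finset.mem_range]; omega

variable {Ω : Type*} [MeasurableSpace Ω] {P : Measure Ω} [IsProbabilityMeasure P] {Z : H → Ω → ℂ}

theorem hermiteExpect_reindex {B : Type*} [Fintype B] (hZ : IsComplexIsonormal Z P)
    (σ : Equiv.Perm B) (x : B → H) (m n : B → ℕ) :
    hermiteExpect hZ (fun b => x (σ b)) (fun b => m (σ b)) (fun b => n (σ b)) =
      hermiteExpect hZ x m n := by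
  rw [hermiteExpect_eq_integral, hermiteExpect_eq_integral]
  refine integral_congr_ae (Eventually.of_forall fun ω => ?_)
  exact Equiv.prod_comp σ fun b => itoHermite (m b) (n b) (Z (x b) ω) (‖x b‖ ^ 2)

/-- After one contraction between vertices 0 and 1, having i further ones amounts to i + 1 in all.
The absorption identities for binomials change the weight into (i + 1)/m₀ times the full weight,
with m₀ = m 0; this is the fraction of patterns in which the marked slot is used. -/
theorem hermiteExpect_contract_zero_one (hZ : IsComplexIsonormal Z P) (x : Fin 4 → H)
    (m n : Fin 4 → ℕ) (hm : m 0 ≠ 0) :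
    inner ℂ (x 1) (x 0) *
        (n 1 * hermiteExpect hZ x (m - Pi.single 0 1) (n - Pi.single 1 1)) =
      ∑ i ∈ Finset.range (m 0 + 1), ∑ j ∈ Finset.range (m 1 + 1),
      ∑ i' ∈ Finset.range (m 2 + 1), ∑ j' ∈ Finset.range (m 3 + 1),
        derivWeight (m 0) (n 0) (m 1) (n 1) i j * contrWeight (m 2) (n 2) (m 3) (n 3) i' j' *
          patternValue (fun a b => inner ℂ (x b) (x a)) m n i j i' j' := by
  obtain ⟨k, hk⟩ := Nat.exists_eq_succ_of_ne_zero hm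
  rw [hermiteExpect_eq_coeff, coeff_rowProd_fin_four, Finset.sum_range_succ' _ (m 0)]
  -- The summand i = 0 on the right has weight zero, so both sums can be matched by i ↦ i + 1.
  have h0 : ∀ j, derivWeight (m 0) (n 0) (m 1) (n 1) 0 j = 0 := fun j => by simp [derivWeight]
  simp only [h0, zero_mul, Finset.sum_const_zero, add_zero]
  have e0 : (m - Pi.single 0 1 : Fin 4 → ℕ) 0 + 1 = m 0 := by simp [hk]
  have e1 : (m - Pi.single 0 1 : Fin 4 → ℕ) 1 = m 1 := by simp
  have e2 : (m - Pi.single 0 1 : Fin 4 → ℕ) 2 = m 2 := by simp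
  have e3 : (m - Pi.single 0 1 : Fin 4 → ℕ) 3 = m 3 := by simp
  have f0 : (n - Pi.single 1 1 : Fin 4 → ℕ) 0 = n 0 := by simp
  have f1 : (n - Pi.single 1 1 : Fin 4 → ℕ) 1 = n 1 - 1 := by simp
  have f2 : (n - Pi.single 1 1 : Fin 4 → ℕ) 2 = n 2 := by simp
  have f3 : (n - Pi.single 1 1 : Fin 4 → ℕ) 3 = n 3 := by simp
  have e0' : (m - Pi.single 0 1 : Fin 4 → ℕ) 0 = k := by simp [hk]
  rw [e0, e1, e2, e3]
  simp only [Finset.mul_sum]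
  refine Finset.sum_congr rfl fun i _ => Finset.sum_congr rfl fun j _ =>
    Finset.sum_congr rfl fun i' _ => Finset.sum_congr rfl fun j' _ => ?_
  simp only [patternValue, e0', e1, e2, e3, f0, f1, f2, f3, hk, Nat.succ_eq_add_one,
    Nat.add_sub_add_right]
  have hw : (n 1 : ℂ) * contrWeight k (n 0) (m 1) (n 1 - 1) i j =
      derivWeight (k + 1) (n 0) (m 1) (n 1) (i + 1) j := by
    have h1 : (n 1 : ℂ) * (n 1 - 1).choose i = (n 1).choose (i + 1) * (i + 1) := by
      rcases n 1 with _ | l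
      · simp
      · exact_mod_cast Nat.add_one_mul_choose_eq l i
    have h2 : ((k + 1 : ℕ) : ℂ) * k.choose i = (k + 1).choose (i + 1) * (i + 1) := by
      exact_mod_cast Nat.add_one_mul_choose_eq k i
    have h3 : ((k + 1 : ℕ) : ℂ) ≠ 0 := by exact_mod_cast k.succ_ne_zero
    simp only [derivWeight, contrWeight, Nat.factorial_succ]
    rw [div_mul_eq_mul_div, eq_div_iff h3]
    push_cast at h2 ⊢
    linear_combination (k.choose i : ℂ) * i.factorial * ((m 1).choose j * (n 0).choose j *
      j.factorial) * (k + 1) * h1 + ((n 1).choose (i + 1) : ℂ) * (i + 1) * i.factorial *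
      ((m 1).choose j * (n 0).choose j * j.factorial) * h2
  rw [← hw, show n 1 - 1 - i = n 1 - (i + 1) by omega, pow_succ]
  ring

/-- The sum of the inner products of the tensors `vartheta` and `psi`, made fourlinear. -/
noncomputable def thetaPsi {m n : ℕ} (f : HTensor ι m n) (h : HTensor ι n m) (f' : HTensor ι m n)
    (h' : HTensor ι n m) (r : ℕ) : ℂ :=
  ((m + n - r).factorial : ℂ) ^ 2 * inner ℂ (psi f' h' r) (vartheta f h r)

/-- The sum of the inner products of the tensors `varsigma` and `phi`, made fourlinear. -/
noncomputable def sigmaPhi {m n : ℕ} (f g f' g' : HTensor ι m n) (r : ℕ) : ℂ :=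
  ((2 * m - r).factorial : ℂ) * ((2 * n - r).factorial : ℂ) *
    inner ℂ (weightedContract (contrWeight m n m n) (2 * m - r) (2 * n - r) r f' g')
      (weightedContract (derivWeight m n m n) (2 * m - r) (2 * n - r) r f g)

/-- The marked unbarred slot of vertex 0 has its partner in vertex 1, 3 or 2. A transposition of
vertices brings the last two cases to the first one. The bound on N covers the order 2m occurring
when vertices 0 and 2 are paired. -/
theorem hermiteExpect_fourfold (hJ : ∀ x, J (J x) = x) (hZ : IsComplexIsonormal Z P) (m n : ℕ)
    (hm : 1 ≤ m) (x : Fin 4 → H) {N : ℕ} (hN : 2 * (m + n) ≤ N) :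
    hermiteExpect hZ x ![m, n, m, n] ![n, m, n, m] =
      ∑ r ∈ Finset.range (N + 1),
        (thetaPsi (powTensor e J m n (x 0)) (powTensor e J n m (x 1)) (powTensor e J m n (x 3))
            (powTensor e J n m (x 2)) r +
          thetaPsi (powTensor e J m n (x 0)) (powTensor e J n m (x 3)) (powTensor e J m n (x 1))
            (powTensor e J n m (x 2)) r +
          sigmaPhi (powTensor e J m n (x 0)) (powTensor e J m n (x 2)) (powTensor e J m n (x 3))
            (powTensor e J m n (x 1)) r) := by
  -- One unbarred slot of vertex 0 is singled out; this is where m ≥ 1 enters.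
  have hsplit : (![m, n, m, n] : Fin 4 → ℕ) = (![m, n, m, n] - Pi.single 0 1) + Pi.single 0 1 := by
    funext b
    fin_cases b
    · exact (Nat.sub_add_cancel hm).symm
    all_goals rfl
  have hA : ∀ (x : Fin 4 → H) (m' n' : Fin 4 → ℕ) (s t : ℕ), m' 0 ≠ 0 →
      m' 0 + m' 1 = n' 3 + n' 2 → n' 0 + n' 1 = m' 3 + m' 2 → m' 0 + m' 1 = s → n' 0 + n' 1 = t →
      s ≤ N → _ := fun x m' n' s t h1 h2 h3 hs ht h4 =>
    (hermiteExpect_contract_zero_one hZ x m' n' h1).trans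
      (sum_patternValue_eq e J hJ x m' n' h2 h3 hs ht h4)
  rw [hsplit, hermiteExpect_add_single,
    show Finset.univ.erase (0 : Fin 4) = {1, 3, 2} by decide,
    Finset.sum_insert (by decide), Finset.sum_insert (by decide), Finset.sum_singleton,
    Finset.sum_add_distrib, Finset.sum_add_distrib, ← add_assoc]
  congr 1
  · congr 1
    · have h := hA x ![m, n, m, n] ![n, m, n, m] (m + n) (m + n) (Nat.ne_of_gt hm) rfl rfl
        rfl (add_comm n m) (by omega)
      rw [h]
      refine Finset.sum_congr rfl fun r _ => ?_
      rw [thetaPsi, psi_eq, vartheta_eq]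
      simp only [Matrix.cons_val, sq]
    · have h := hA (fun b => x (Equiv.swap 1 3 b)) ![m, n, m, n] ![n, m, n, m] (m + n) (m + n)
        (Nat.ne_of_gt hm) rfl rfl rfl (add_comm n m) (by omega)
      have h2 := hermiteExpect_reindex hZ (Equiv.swap 1 3) x (![m, n, m, n] - Pi.single 0 1)
        (![n, m, n, m] - Pi.single 3 1)
      have h3 : (fun b => (![m, n, m, n] - Pi.single 0 1 : Fin 4 → ℕ) (Equiv.swap 1 3 b)) =
          ![m, n, m, n] - Pi.single 0 1 := by
        funext b; fin_cases b <;> rfl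
      have h4 : (fun b => (![n, m, n, m] - Pi.single 3 1 : Fin 4 → ℕ) (Equiv.swap 1 3 b)) =
          ![n, m, n, m] - Pi.single 1 1 := by
        funext b; fin_cases b <;> rfl
      rw [h3, h4] at h2
      rw [h2] at h
      refine h.trans (Finset.sum_congr rfl fun r _ => ?_)
      rw [thetaPsi, psi_eq, vartheta_eq]
      simp only [Matrix.cons_val, sq]
      rfl
  -- After the exchange of 1 and 2 the first pair consists of two kernels of bidegree (m, n), so the
  -- free slots number 2m - r and 2n - r.
  · have h := hA (fun b => x (Equiv.swap 1 2 b)) ![m, m, n, n] ![n, n, m, m] (2 * m) (2 * n)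
      (Nat.ne_of_gt hm) rfl rfl (two_mul m).symm (two_mul n).symm (by omega)
    have h2 := hermiteExpect_reindex hZ (Equiv.swap 1 2) x (![m, n, m, n] - Pi.single 0 1)
      (![n, m, n, m] - Pi.single 2 1)
    have h3 : (fun b => (![m, n, m, n] - Pi.single 0 1 : Fin 4 → ℕ) (Equiv.swap 1 2 b)) =
        ![m, m, n, n] - Pi.single 0 1 := by
      funext b; fin_cases b <;> rfl
    have h4 : (fun b => (![n, m, n, m] - Pi.single 2 1 : Fin 4 → ℕ) (Equiv.swap 1 2 b)) =
        ![n, n, m, m] - Pi.single 1 1 := by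
      funext b; fin_cases b <;> rfl
    rw [h3, h4] at h2
    rw [h2] at h
    refine h.trans (Finset.sum_congr rfl fun r _ => ?_)
    rw [sigmaPhi]
    simp only [Matrix.cons_val]
    rfl

end fourfold

/-! ### Continuity of the contractions -/

section continuity

variable {ι : Type*}

theorem norm_sq_eq_tsum {I : Type*} (f : lp (fun _ : I => ℂ) 2) : ‖f‖ ^ 2 = ∑' x, ‖f x‖ ^ 2 := by
  have := lp.norm_rpow_eq_tsum (p := 2) (by norm_num) f
  simpa using this

theorem tsum_norm_sq_comp_le {I K : Type*} (f : lp (fun _ : I => ℂ) 2) {φ : K → I}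
    (hφ : Function.Injective φ) : ∑' x, ‖f (φ x)‖ ^ 2 ≤ ‖f‖ ^ 2 := by
  rw [norm_sq_eq_tsum]
  exact tsum_comp_le_tsum_of_inj (summable_sq f) (fun _ => by positivity) hφ

theorem summable_contraction {A B G : Type*} {u : A × G → ℂ} {v : B × G → ℂ}
    (hu : Summable fun x => ‖u x‖ ^ 2) (hv : Summable fun x => ‖v x‖ ^ 2) (a : A) (b : B) :
    (Summable fun g => u (a, g) * v (b, g)) ∧
      ‖∑' g, u (a, g) * v (b, g)‖ ^ 2 ≤ (∑' g, ‖u (a, g)‖ ^ 2) * ∑' g, ‖v (b, g)‖ ^ 2 := by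
  have hua := hu.comp_injective (Prod.mk_right_injective a)
  have hvb := hv.comp_injective (Prod.mk_right_injective b)
  obtain ⟨h1, h2⟩ := Real.summable_and_inner_le_Lp_mul_Lq_tsum_of_nonneg (f := fun g => ‖u (a, g)‖)
    (g := fun g => ‖v (b, g)‖) (p := 2) (q := 2) ⟨by norm_num, by norm_num, by norm_num⟩
    (fun _ => norm_nonneg _) (fun _ => norm_nonneg _)
    (by simpa [Function.comp_def] using hua) (by simpa [Function.comp_def] using hvb)
  have h3 : ‖∑' g, u (a, g) * v (b, g)‖ ≤ ∑' g, ‖u (a, g)‖ * ‖v (b, g)‖ := by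
    refine (norm_tsum_le_tsum_norm (by simpa using h1)).trans_eq ?_
    simp
  have h4 := h3.trans h2
  simp only [← Real.sqrt_eq_rpow, Real.rpow_two] at h4
  refine ⟨Summable.of_norm (by simpa using h1), ?_⟩
  calc ‖∑' g, u (a, g) * v (b, g)‖ ^ 2
      ≤ (√(∑' g, ‖u (a, g)‖ ^ 2) * √(∑' g, ‖v (b, g)‖ ^ 2)) ^ 2 := by gcongr
    _ = (∑' g, ‖u (a, g)‖ ^ 2) * ∑' g, ‖v (b, g)‖ ^ 2 := by
      rw [mul_pow, Real.sq_sqrt (tsum_nonneg fun g => by positivity),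
        Real.sq_sqrt (tsum_nonneg fun g => by positivity)]

/-- Cauchy–Schwarz in the contracted index for each fixed pair of free indices, then summation over
the free indices. -/
theorem tsum_contraction_le {A B G : Type*} {u : A × G → ℂ} {v : B × G → ℂ}
    (hu : Summable fun x => ‖u x‖ ^ 2) (hv : Summable fun x => ‖v x‖ ^ 2) :
    ∑' x : A × B, ‖∑' g, u (x.1, g) * v (x.2, g)‖ ^ 2 ≤
      (∑' x, ‖u x‖ ^ 2) * ∑' x, ‖v x‖ ^ 2 := by
  have hU : Summable fun a => ∑' g, ‖u (a, g)‖ ^ 2 := hu.prod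
  have hV : Summable fun b => ∑' g, ‖v (b, g)‖ ^ 2 := hv.prod
  have hUV : Summable fun x : A × B => (∑' g, ‖u (x.1, g)‖ ^ 2) * ∑' g, ‖v (x.2, g)‖ ^ 2 :=
    hU.mul_of_nonneg hV (fun a => tsum_nonneg fun g => by positivity)
      fun b => tsum_nonneg fun g => by positivity
  rw [hu.tsum_prod, hv.tsum_prod, hU.tsum_mul_tsum hV hUV]
  exact (contraction_summable hu hv).tsum_le_tsum
    (fun x => (summable_contraction hu hv x.1 x.2).2) hUV

/-- Re-indexing as a continuous linear map. -/
noncomputable def pullL {p q p' q' : ℕ}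
    (φ : (Fin p' → ι) × (Fin q' → ι) → (Fin p → ι) × (Fin q → ι)) (hφ : Function.Injective φ) :
    HTensor ι p q →L[ℂ] HTensor ι p' q' :=
  LinearMap.mkContinuous
    { toFun := pull φ hφ
      map_add' := fun _ _ => rfl
      map_smul' := fun _ _ => rfl } 1 fun f => by
    rw [one_mul, ← sq_le_sq₀ (norm_nonneg _) (norm_nonneg _), norm_sq_eq_tsum]
    exact tsum_norm_sq_comp_le f hφ

theorem exists_castTensor_clm {p q p' q' : ℕ} (hp : p = p') (hq : q = q') :
    ∃ T : HTensor ι p q →L[ℂ] HTensor ι p' q', ∀ f, T f = castTensor hp hq f :=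
  ⟨pullL (fun x => (fun k => x.1 (Fin.cast hp k), fun k => x.2 (Fin.cast hq k)))
    (by subst hp hq; exact fun _ _ h => h), fun _ => rfl⟩

theorem exists_symmetrize_clm (p q : ℕ) :
    ∃ T : HTensor ι p q →L[ℂ] HTensor ι p q, ∀ f, T f = symmetrize f := by
  have h : ∀ (σ : Equiv.Perm (Fin p)) (τ : Equiv.Perm (Fin q)),
      ∃ T : HTensor ι p q →L[ℂ] HTensor ι p q, ∀ f, T f = permute σ τ f :=
    fun σ τ => ⟨pullL (fun x => (fun k => x.1 (σ k), fun k => x.2 (τ k))) (by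
      rintro ⟨a, b⟩ ⟨a', b'⟩ h
      simp only [Prod.mk.injEq] at h
      exact Prod.ext (σ.surjective.injective_comp_right h.1)
        (τ.surjective.injective_comp_right h.2)), fun _ => rfl⟩
  choose T hT using h
  refine ⟨((p.factorial : ℂ) * (q.factorial : ℂ))⁻¹ • ∑ σ, ∑ τ, T σ τ, fun f => ?_⟩
  simp only [_root_.smul_apply, _root_.sum_apply, hT, symmetrize]

variable {a b c d : ℕ} (i j : ℕ)

theorem injective_append_left : Function.Injective
    fun x : ((Fin a → ι) × (Fin b → ι)) × ((Fin i → ι) × (Fin j → ι)) =>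
      ((Fin.append x.1.1 x.2.1, Fin.append x.1.2 x.2.2) :
        (Fin (a + i) → ι) × (Fin (b + j) → ι)) := by
  rintro ⟨⟨x1, x2⟩, x3, x4⟩ ⟨⟨y1, y2⟩, y3, y4⟩ h
  obtain ⟨rfl, rfl⟩ := append_inj (congrArg Prod.fst h)
  obtain ⟨rfl, rfl⟩ := append_inj (congrArg Prod.snd h)
  rfl

theorem injective_append_right : Function.Injective
    fun x : ((Fin c → ι) × (Fin d → ι)) × ((Fin i → ι) × (Fin j → ι)) =>
      ((Fin.append x.1.1 x.2.2, Fin.append x.1.2 x.2.1) :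
        (Fin (c + j) → ι) × (Fin (d + i) → ι)) := by
  rintro ⟨⟨x1, x2⟩, x3, x4⟩ ⟨⟨y1, y2⟩, y3, y4⟩ h
  obtain ⟨rfl, rfl⟩ := append_inj (congrArg Prod.fst h)
  obtain ⟨rfl, rfl⟩ := append_inj (congrArg Prod.snd h)
  rfl

theorem injective_split : Function.Injective
    fun x : (Fin (a + c) → ι) × (Fin (b + d) → ι) =>
      (((fun k => x.1 (Fin.castAdd c k), fun k => x.2 (Fin.castAdd d k)),
        (fun k => x.1 (Fin.natAdd a k), fun k => x.2 (Fin.natAdd b k))) :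
        ((Fin a → ι) × (Fin b → ι)) × ((Fin c → ι) × (Fin d → ι))) := by
  rintro ⟨x1, x2⟩ ⟨y1, y2⟩ h
  simp only [Prod.mk.injEq, funext_iff] at h
  obtain ⟨⟨h1, h2⟩, h3, h4⟩ := h
  refine Prod.ext (funext fun k => ?_) (funext fun k => ?_)
  · exact Fin.addCases (motive := fun k => x1 k = y1 k) h1 h3 k
  · exact Fin.addCases (motive := fun k => x2 k = y2 k) h2 h4 k

theorem summable_contractAux (f : HTensor ι (a + i) (b + j)) (g : HTensor ι (c + j) (d + i))
    (x : (Fin (a + c) → ι) × (Fin (b + d) → ι)) :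
    Summable fun y : (Fin i → ι) × (Fin j → ι) =>
      f (Fin.append (fun k => x.1 (Fin.castAdd c k)) y.1,
          Fin.append (fun k => x.2 (Fin.castAdd d k)) y.2) *
        g (Fin.append (fun k => x.1 (Fin.natAdd a k)) y.2,
          Fin.append (fun k => x.2 (Fin.natAdd b k)) y.1) :=
  (summable_contraction
    ((summable_sq f).comp_injective (injective_append_left (a := a) (b := b) i j))
    ((summable_sq g).comp_injective (injective_append_right (c := c) (d := d) i j))
    (fun k => x.1 (Fin.castAdd c k), fun k => x.2 (Fin.castAdd d k))
    (fun k => x.1 (Fin.natAdd a k), fun k => x.2 (Fin.natAdd b k))).1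

theorem norm_contractAux_le (f : HTensor ι (a + i) (b + j)) (g : HTensor ι (c + j) (d + i)) :
    ‖contractAux i j f g‖ ≤ ‖f‖ * ‖g‖ := by
  have hu := (summable_sq f).comp_injective (injective_append_left (a := a) (b := b) i j)
  have hv := (summable_sq g).comp_injective (injective_append_right (c := c) (d := d) i j)
  rw [← sq_le_sq₀ (norm_nonneg _) (by positivity), mul_pow, norm_sq_eq_tsum]
  have h1 := tsum_contraction_le hu hv
  have h2 := tsum_comp_le_tsum_of_inj (contraction_summable hu hv) (fun _ => by positivity)
    (injective_split (ι := ι) (a := a) (b := b) (c := c) (d := d))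
  refine (h2.trans h1).trans (mul_le_mul ?_ ?_ (tsum_nonneg fun _ => by positivity) (by positivity))
  · exact tsum_norm_sq_comp_le f (injective_append_left (a := a) (b := b) i j)
  · exact tsum_norm_sq_comp_le g (injective_append_right (c := c) (d := d) i j)

theorem exists_contractAux_clm : ∃ T : HTensor ι (a + i) (b + j) →L[ℂ]
    HTensor ι (c + j) (d + i) →L[ℂ] HTensor ι (a + c) (b + d),
    ∀ f g, T f g = contractAux i j f g := by
  refine ⟨LinearMap.mkContinuous₂ (LinearMap.mk₂ ℂ (contractAux i j) ?_ ?_ ?_ ?_) 1 ?_,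
    fun f g => rfl⟩
  · intro f f' g
    ext x
    rw [lp.coeFn_add, Pi.add_apply, contractAux_apply, contractAux_apply, contractAux_apply,
      ← (summable_contractAux i j f g x).tsum_add (summable_contractAux i j f' g x)]
    exact tsum_congr fun y => by rw [lp.coeFn_add, Pi.add_apply, add_mul]
  · intro s f g
    ext x
    rw [lp.coeFn_smul, Pi.smul_apply, contractAux_apply, contractAux_apply, smul_eq_mul,
      ← tsum_mul_left]
    exact tsum_congr fun y => by rw [lp.coeFn_smul, Pi.smul_apply, smul_eq_mul, mul_assoc]
  · intro f g g'
    ext x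
    rw [lp.coeFn_add, Pi.add_apply, contractAux_apply, contractAux_apply, contractAux_apply,
      ← (summable_contractAux i j f g x).tsum_add (summable_contractAux i j f g' x)]
    exact tsum_congr fun y => by rw [lp.coeFn_add, Pi.add_apply, mul_add]
  · intro s f g
    ext x
    rw [lp.coeFn_smul, Pi.smul_apply, contractAux_apply, contractAux_apply, smul_eq_mul,
      ← tsum_mul_left]
    exact tsum_congr fun y => by rw [lp.coeFn_smul, Pi.smul_apply, smul_eq_mul, mul_left_comm]
  · intro f g
    rw [one_mul]
    exact norm_contractAux_le i j f g

theorem exists_symContract_clm (p q : ℕ) : ∃ T : HTensor ι a b →L[ℂ] HTensor ι c d →L[ℂ]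
    HTensor ι p q, ∀ f g, T f g = symContract p q i j f g := by
  obtain ⟨S, hS⟩ := exists_symmetrize_clm (ι := ι) p q
  by_cases h : ((i ≤ a ∧ i ≤ d) ∧ (j ≤ b ∧ j ≤ c)) ∧ (a - i) + (c - j) = p ∧ (b - j) + (d - i) = q
  · obtain ⟨C1, h1⟩ := exists_castTensor_clm (ι := ι) (Nat.sub_add_cancel h.1.1.1).symm
      (Nat.sub_add_cancel h.1.2.1).symm
    obtain ⟨C2, h2⟩ := exists_castTensor_clm (ι := ι) (Nat.sub_add_cancel h.1.2.2).symm
      (Nat.sub_add_cancel h.1.1.2).symm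
    obtain ⟨C3, h3⟩ := exists_castTensor_clm (ι := ι) h.2.1 h.2.2
    obtain ⟨T, hT⟩ := exists_contractAux_clm (ι := ι) (a := a - i) (b := b - j) (c := c - j)
      (d := d - i) i j
    refine ⟨(ContinuousLinearMap.compL ℂ _ _ _ (S.comp C3)).comp (T.bilinearComp C1 C2),
      fun f g => ?_⟩
    rw [symContract, contract, dif_pos h, ← h1, ← h2, ← hT, ← h3, ← hS]
    rfl
  · refine ⟨0, fun f g => ?_⟩
    rw [symContract, contract, dif_neg h, ← hS, map_zero]
    rfl

theorem exists_weightedContract_clm (w : ℕ → ℕ → ℂ) (p q r : ℕ) :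
    ∃ T : HTensor ι a b →L[ℂ] HTensor ι c d →L[ℂ] HTensor ι p q,
      ∀ f g, T f g = weightedContract w p q r f g := by
  choose T hT using fun i j => exists_symContract_clm (ι := ι) (a := a) (b := b) (c := c) (d := d)
    i j p q
  refine ⟨∑ x ∈ Finset.HasAntidiagonal.antidiagonal r, w x.1 x.2 • T x.1 x.2, fun f g => ?_⟩
  simp only [_root_.sum_apply, _root_.smul_apply, hT, weightedContract]

theorem continuous_weightedContract {X : Type*} [TopologicalSpace X] (w : ℕ → ℕ → ℂ) (p q r : ℕ)
    {f : X → HTensor ι a b} {g : X → HTensor ι c d} (hf : Continuous f) (hg : Continuous g) :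
    Continuous fun x => weightedContract w p q r (f x) (g x) := by
  obtain ⟨T, hT⟩ := exists_weightedContract_clm (ι := ι) (a := a) (b := b) (c := c) (d := d) w p q r
  simp only [← hT]
  exact (T.continuous.comp hf).clm_apply hg

theorem weightedContract_sum_sum {κ : Type*} (w : ℕ → ℕ → ℂ) (p q r : ℕ) (s : Finset κ)
    (y z : κ → ℂ) (f : κ → HTensor ι a b) (g : κ → HTensor ι c d) :
    weightedContract w p q r (∑ k ∈ s, y k • f k) (∑ l ∈ s, z l • g l) =
      ∑ k ∈ s, ∑ l ∈ s, (y k * z l) • weightedContract w p q r (f k) (g l) := by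
  obtain ⟨T, hT⟩ := exists_weightedContract_clm (ι := ι) (a := a) (b := b) (c := c) (d := d) w p q r
  simp only [← hT, map_sum, _root_.sum_apply, map_smul, _root_.smul_apply,
    Finset.smul_sum, smul_smul]
  rw [Finset.sum_comm]
  exact Finset.sum_congr rfl fun k _ => Finset.sum_congr rfl fun l _ => by rw [mul_comm]

theorem inner_weightedContract_sum {κ : Type*} {a' b' c' d' : ℕ} (w w' : ℕ → ℕ → ℂ) (p q r : ℕ)
    (s : Finset κ) (y z y' z' : κ → ℂ) (f : κ → HTensor ι a b) (g : κ → HTensor ι c d)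
    (f' : κ → HTensor ι a' b') (g' : κ → HTensor ι c' d') :
    inner ℂ (weightedContract w' p q r (∑ k ∈ s, y' k • f' k) (∑ l ∈ s, z' l • g' l))
        (weightedContract w p q r (∑ k ∈ s, y k • f k) (∑ l ∈ s, z l • g l)) =
      ∑ k ∈ s, ∑ l ∈ s, ∑ k' ∈ s, ∑ l' ∈ s,
        (y k * z l * ((starRingEnd ℂ) (y' k') * (starRingEnd ℂ) (z' l'))) *
          inner ℂ (weightedContract w' p q r (f' k') (g' l'))
            (weightedContract w p q r (f k) (g l)) := by
  rw [weightedContract_sum_sum, weightedContract_sum_sum, inner_sum]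
  refine Finset.sum_congr rfl fun k _ => ?_
  rw [inner_sum]
  refine Finset.sum_congr rfl fun l _ => ?_
  rw [sum_inner]
  refine Finset.sum_congr rfl fun k' _ => ?_
  rw [sum_inner]
  refine Finset.sum_congr rfl fun l' _ => ?_
  rw [inner_smul_left, inner_smul_right, map_mul]
  ring

end continuity

/-! ### Moments of finite combinations -/

theorem conj_itoHermite (m n : ℕ) (z : ℂ) (ρ : ℝ) :
    (starRingEnd ℂ) (itoHermite m n z ρ) = itoHermite n m z ρ := by
  simp only [itoHermite, map_sum, map_mul, map_pow, map_neg, map_one, map_natCast,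
    Complex.conj_ofReal, Complex.conj_conj, min_comm m n]
  exact Finset.sum_congr rfl fun k _ => by ring

section finiteCombinations

variable {ι H : Type*} [NormedAddCommGroup H] [InnerProductSpace ℂ H]
  (e : HilbertBasis ι ℂ H) (J : H ≃ₗᵢ⋆[ℂ] H)

/-- The combination of the tensors `x^{⊗m} ⊗ (J x)^{⊗n}` with coefficients `c`. -/
noncomputable def tensorSum (m n : ℕ) (c : H →₀ ℂ) : HTensor ι m n :=
  c.sum fun x a => a • powTensor e J m n x

/-- The combination of the variables `J_{m,n}(Z(x), ‖x‖²)` with coefficients `c`. -/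
noncomputable def hermiteSum {Ω : Type*} (Z : H → Ω → ℂ) (m n : ℕ) (c : H →₀ ℂ) (ω : Ω) : ℂ :=
  c.sum fun x a => a * itoHermite m n (Z x ω) (‖x‖ ^ 2)

/-- The combination with conjugate coefficients. -/
noncomputable def conjCoeff (c : H →₀ ℂ) : H →₀ ℂ :=
  c.mapRange (starRingEnd ℂ) (map_zero _)

theorem tensorSum_conjCoeff (m n : ℕ) (c : H →₀ ℂ) :
    tensorSum e J m n (conjCoeff c) =
      ∑ x ∈ c.support, (starRingEnd ℂ) (c x) • powTensor e J m n x :=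
  Finsupp.sum_mapRange_index fun _ => zero_smul _ _

theorem tensorSum_sub (m n : ℕ) (c d : H →₀ ℂ) :
    tensorSum e J m n (c - d) = tensorSum e J m n c - tensorSum e J m n d :=
  Finsupp.sum_sub_index fun _ _ _ => sub_smul _ _ _

variable {Ω : Type*}

theorem hermiteSum_conjCoeff (Z : H → Ω → ℂ) (m n : ℕ) (c : H →₀ ℂ) (ω : Ω) :
    hermiteSum Z m n (conjCoeff c) ω =
      ∑ x ∈ c.support, (starRingEnd ℂ) (c x) * itoHermite m n (Z x ω) (‖x‖ ^ 2) :=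
  Finsupp.sum_mapRange_index fun _ => zero_mul _

theorem conj_hermiteSum (Z : H → Ω → ℂ) (m n : ℕ) (c : H →₀ ℂ) (ω : Ω) :
    (starRingEnd ℂ) (hermiteSum Z m n c ω) = hermiteSum Z n m (conjCoeff c) ω := by
  rw [hermiteSum_conjCoeff, hermiteSum, Finsupp.sum, map_sum]
  exact Finset.sum_congr rfl fun x _ => by rw [map_mul, conj_itoHermite]

theorem hermiteSum_sub (Z : H → Ω → ℂ) (m n : ℕ) (c d : H →₀ ℂ) (ω : Ω) :
    hermiteSum Z m n (c - d) ω = hermiteSum Z m n c ω - hermiteSum Z m n d ω :=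
  Finsupp.sum_sub_index fun _ _ _ => sub_mul _ _ _

variable [MeasurableSpace Ω] {P : Measure Ω} [IsProbabilityMeasure P] {Z : H → Ω → ℂ}

theorem HasMoments.pow {f : Ω → ℂ} (hf : HasMoments f P) (k : ℕ) :
    HasMoments (fun ω => f ω ^ k) P := by
  induction k with
  | zero => simpa using HasMoments.const (P := P) 1
  | succ k ih => simpa only [pow_succ] using ih.mul hf

theorem hasMoments_itoHermite (hZ : IsComplexIsonormal Z P) (m n : ℕ) (x : H) :
    HasMoments (fun ω => itoHermite m n (Z x ω) (‖x‖ ^ 2)) P := by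
  unfold itoHermite
  exact HasMoments.sum fun k => ((HasMoments.const _).mul ((hZ.hasMoments x).pow _)).mul
    ((hZ.hasMoments x).conj.pow _)

theorem hasMoments_hermiteSum (hZ : IsComplexIsonormal Z P) (m n : ℕ) (c : H →₀ ℂ) :
    HasMoments (hermiteSum Z m n c) P :=
  HasMoments.sum fun x => (HasMoments.const (c x)).mul (hasMoments_itoHermite hZ m n x)

/-- With two vertices each row of the generating polynomial is a single monomial, so there is at
most one type of contraction pattern. -/
theorem integral_itoHermite_mul (hZ : IsComplexIsonormal Z P) (m n p q : ℕ) (x y : H) :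
    ∫ ω, itoHermite m n (Z x ω) (‖x‖ ^ 2) * itoHermite p q (Z y ω) (‖y‖ ^ 2) ∂P =
      if m = q ∧ n = p then
        (m.factorial : ℂ) * n.factorial * (inner ℂ y x ^ m * inner ℂ x y ^ n) else 0 := by
  have h := hermiteExpect_eq_integral hZ ![x, y] ![m, p] ![n, q]
  have h' := hermiteExpect_eq_coeff hZ ![x, y] ![m, p] ![n, q]
  simp only [Fin.prod_univ_two, Matrix.cons_val_zero, Matrix.cons_val_one] at h h'
  rw [← h, h', rowProd]
  simp only [Fin.prod_univ_two, show (Finset.univ : Finset (Fin 2)).erase 0 = {1} by decide,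
    show (Finset.univ : Finset (Fin 2)).erase 1 = {0} by decide, Finset.sum_singleton,
    Matrix.cons_val_zero, Matrix.cons_val_one]
  rw [smul_pow, smul_pow, smul_mul_smul_comm, MvPolynomial.coeff_smul, MvPolynomial.X_pow_eq_monomial,
    MvPolynomial.X_pow_eq_monomial, MvPolynomial.monomial_mul, MvPolynomial.coeff_monomial]
  have hiff : (Finsupp.single 1 m + Finsupp.single 0 p =
      Finsupp.equivFunOnFinite.symm ![n, q]) ↔ m = q ∧ n = p := by
    rw [Finsupp.ext_iff, Fin.forall_fin_two]
    simp
    tauto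
  simp only [hiff]
  split_ifs with hc
  · obtain ⟨rfl, rfl⟩ := hc
    simp only [mul_one, smul_eq_mul]
    ring
  · simp

theorem integral_hermiteSum_mul {κ : Type*} (s : Finset κ) (y z : κ → ℂ) {U V : κ → Ω → ℂ}
    (hU : ∀ k, HasMoments (U k) P) (hV : ∀ k, HasMoments (V k) P) :
    ∫ ω, (∑ k ∈ s, y k * U k ω) * (∑ k ∈ s, z k * V k ω) ∂P =
      ∑ k ∈ s, ∑ l ∈ s, y k * z l * ∫ ω, U k ω * V l ω ∂P := by
  simp only [Finset.sum_mul_sum]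
  rw [integral_finsetSum]
  · refine Finset.sum_congr rfl fun k _ => ?_
    rw [integral_finsetSum]
    · refine Finset.sum_congr rfl fun l _ => ?_
      rw [← integral_const_mul]
      exact integral_congr_ae (Eventually.of_forall fun ω => by ring)
    · exact fun l _ => ((((HasMoments.const _).mul (hU k)).mul
        ((HasMoments.const _).mul (hV l)))).integrable
  · exact fun k _ => (HasMoments.sum fun l => (((HasMoments.const _).mul (hU k)).mul
        ((HasMoments.const _).mul (hV l)))).integrable

theorem integral_hermiteSum_sq (hZ : IsComplexIsonormal Z P) (hJ : ∀ x, J (J x) = x) (m n : ℕ)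
    (c : H →₀ ℂ) :
    ∫ ω, hermiteSum Z m n c ω * hermiteSum Z n m (conjCoeff c) ω ∂P =
      (m.factorial : ℂ) * n.factorial * inner ℂ (tensorSum e J m n c) (tensorSum e J m n c) := by
  simp only [hermiteSum_conjCoeff]
  simp only [hermiteSum, Finsupp.sum]
  rw [integral_hermiteSum_mul c.support c (fun x => (starRingEnd ℂ) (c x))
    (hasMoments_itoHermite hZ m n) (hasMoments_itoHermite hZ n m), tensorSum, Finsupp.sum,
    inner_sum, Finset.mul_sum]
  refine Finset.sum_congr rfl fun x _ => ?_
  rw [sum_inner, Finset.mul_sum]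
  refine Finset.sum_congr rfl fun y _ => ?_
  rw [integral_itoHermite_mul hZ, if_pos ⟨rfl, rfl⟩, inner_smul_left, inner_smul_right, powTensor,
    powTensor, inner_elemTensor e J hJ]
  simp only [Finset.prod_const, Finset.card_univ, Fintype.card_fin, inner_conj_conj]
  ring

/-- The isometry property on finite combinations; it is what later forces kernels to be unique. -/
theorem integral_norm_sq_hermiteSum (hZ : IsComplexIsonormal Z P) (hJ : ∀ x, J (J x) = x) (m n : ℕ)
    (c : H →₀ ℂ) :
    ∫ ω, ‖hermiteSum Z m n c ω‖ ^ 2 ∂P =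
      (m.factorial : ℝ) * n.factorial * ‖tensorSum e J m n c‖ ^ 2 := by
  have h := integral_hermiteSum_sq e J hZ hJ m n c
  simp only [← conj_hermiteSum, Complex.mul_conj'] at h
  rw [inner_self_eq_norm_sq_to_K] at h
  have h2 : ∫ ω, ((‖hermiteSum Z m n c ω‖ : ℂ) ^ 2) ∂P =
      ((∫ ω, ‖hermiteSum Z m n c ω‖ ^ 2 ∂P : ℝ) : ℂ) := by
    rw [← integral_complex_ofReal]
    simp only [Complex.ofReal_pow]
  rw [h2] at h
  refine Complex.ofReal_injective (h.trans ?_)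
  push_cast
  rfl

theorem integral_hermiteSum_fourfold {κ : Type*} (s : Finset κ) (y z : κ → ℂ) {U V : κ → Ω → ℂ}
    (hU : ∀ k, HasMoments (U k) P) (hV : ∀ k, HasMoments (V k) P) :
    ∫ ω, ((∑ k ∈ s, y k * U k ω) * (∑ k ∈ s, z k * V k ω)) *
        ((∑ k ∈ s, y k * U k ω) * (∑ k ∈ s, z k * V k ω)) ∂P =
      ∑ a ∈ s, ∑ b ∈ s, ∑ c ∈ s, ∑ d ∈ s, y a * z b * (y c * z d) *
        ∫ ω, U a ω * V b ω * (U c ω * V d ω) ∂P := by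
  have h := integral_hermiteSum_mul (P := P) (s ×ˢ s) (fun k => y k.1 * z k.2)
    (fun k => y k.1 * z k.2) (U := fun k ω => U k.1 ω * V k.2 ω)
    (V := fun k ω => U k.1 ω * V k.2 ω) (fun k => (hU _).mul (hV _)) (fun k => (hU _).mul (hV _))
  simp only [Finset.sum_product] at h
  rw [← h]
  congr 1
  funext ω
  simp only [Finset.sum_mul_sum]
  have : ∀ a b, y a * z b * (U a ω * V b ω) = y a * U a ω * (z b * V b ω) := fun a b => by ring
  simp only [this]

end finiteCombinations

/-! ### Second and fourth moments of finite combinations, and the contraction terms of extreme order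
-/

section fourthMoment

variable {ι H : Type*} [NormedAddCommGroup H] [InnerProductSpace ℂ H]
  (e : HilbertBasis ι ℂ H) (J : H ≃ₗᵢ⋆[ℂ] H)

/-- The order of the indices is dictated by the fourfold product: a and c carry y, b and d carry its
conjugate. Since ψ enters conjugate-linearly, its first argument receives d and its second receives
c. -/
theorem thetaPsi_sum {κ : Type*} {m n : ℕ} (s : Finset κ) (y : κ → ℂ)
    (E : κ → HTensor ι m n) (E' : κ → HTensor ι n m) (r : ℕ) :
    thetaPsi (∑ a ∈ s, y a • E a) (∑ a ∈ s, (starRingEnd ℂ) (y a) • E' a)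
        (∑ a ∈ s, y a • E a) (∑ a ∈ s, (starRingEnd ℂ) (y a) • E' a) r =
      ∑ a ∈ s, ∑ b ∈ s, ∑ c ∈ s, ∑ d ∈ s,
        y a * (starRingEnd ℂ) (y b) * (y c * (starRingEnd ℂ) (y d)) *
          thetaPsi (E a) (E' b) (E d) (E' c) r := by
  rw [thetaPsi, psi_eq, vartheta_eq, inner_weightedContract_sum]
  simp only [Finset.mul_sum]
  refine Finset.sum_congr rfl fun a _ => Finset.sum_congr rfl fun b _ => ?_
  rw [Finset.sum_comm]
  refine Finset.sum_congr rfl fun c _ => Finset.sum_congr rfl fun d _ => ?_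
  rw [thetaPsi, psi_eq, vartheta_eq, Complex.conj_conj]
  ring

theorem sigmaPhi_sum {κ : Type*} {m n : ℕ} (s : Finset κ) (y : κ → ℂ)
    (E : κ → HTensor ι m n) (r : ℕ) :
    sigmaPhi (∑ a ∈ s, y a • E a) (∑ a ∈ s, y a • E a) (∑ a ∈ s, y a • E a)
        (∑ a ∈ s, y a • E a) r =
      ∑ a ∈ s, ∑ b ∈ s, ∑ c ∈ s, ∑ d ∈ s,
        y a * (starRingEnd ℂ) (y b) * (y c * (starRingEnd ℂ) (y d)) *
          sigmaPhi (E a) (E c) (E d) (E b) r := by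
  rw [sigmaPhi, inner_weightedContract_sum]
  simp only [Finset.mul_sum]
  refine Finset.sum_congr rfl fun a _ => ?_
  rw [Finset.sum_comm_cycle]
  refine Finset.sum_congr rfl fun b _ => Finset.sum_congr rfl fun c _ =>
    Finset.sum_congr rfl fun d _ => ?_
  rw [sigmaPhi]
  ring

theorem contrWeight_self_left (m n : ℕ) :
    contrWeight m n n m m n = (m.factorial : ℂ) * n.factorial := by
  simp [contrWeight]

/-- The only contraction pattern of maximal order is the full one. -/
theorem weightedContract_top {a b c d : ℕ} (w : ℕ → ℕ → ℂ)
    (hw : ∀ i j, ¬ (i ≤ a ∧ j ≤ b) → w i j = 0) (p q : ℕ)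
    (f : HTensor ι a b) (g : HTensor ι c d) :
    weightedContract w p q (a + b) f g = w a b • symContract p q a b f g := by
  rw [weightedContract]
  refine Finset.sum_eq_single_of_mem (a, b) (Finset.HasAntidiagonal.mem_antidiagonal.2 rfl) ?_
  intro z hz hne
  rw [Finset.HasAntidiagonal.mem_antidiagonal] at hz
  rw [hw, zero_smul]
  rintro ⟨h1, h2⟩
  exact hne (Prod.ext (by simp; omega) (by simp; omega))

theorem weightedContract_eq_zero {a b c d : ℕ} (w : ℕ → ℕ → ℂ) (p q r : ℕ)
    (hw : ∀ i j, i + j = r → w i j = 0) (f : HTensor ι a b) (g : HTensor ι c d) :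
    weightedContract w p q r f g = 0 :=
  Finset.sum_eq_zero fun z hz => by
    rw [hw _ _ (Finset.HasAntidiagonal.mem_antidiagonal.1 hz), zero_smul]

theorem thetaPsi_zero {m n : ℕ} (f f' : HTensor ι m n) (h h' : HTensor ι n m) :
    thetaPsi f h f' h' 0 = 0 := by
  rw [thetaPsi, vartheta_eq, weightedContract_eq_zero, inner_zero_right, mul_zero]
  intro i j hij
  simp [derivWeight, show i = 0 by omega]

theorem sigmaPhi_zero {m n : ℕ} (f g f' g' : HTensor ι m n) : sigmaPhi f g f' g' 0 = 0 := by
  rw [sigmaPhi, weightedContract_eq_zero (derivWeight m n m n), inner_zero_right, mul_zero]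
  intro i j hij
  simp [derivWeight, show i = 0 by omega]

theorem thetaPsi_eq_zero {m n r : ℕ} (hr : m + n < r) (f f' : HTensor ι m n)
    (h h' : HTensor ι n m) : thetaPsi f h f' h' r = 0 := by
  rw [thetaPsi, psi_eq, weightedContract_eq_zero, inner_zero_left, mul_zero]
  exact fun i j hij => contrWeight_eq_zero (by omega)

/-- Contractions of f with itself need i, j ≤ min m n. -/
theorem sigmaPhi_eq_zero {m n r : ℕ} (hr : 2 * min m n < r) (f g f' g' : HTensor ι m n) :
    sigmaPhi f g f' g' r = 0 := by
  rw [sigmaPhi, weightedContract_eq_zero (contrWeight m n m n), inner_zero_left, mul_zero]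
  exact fun i j hij => contrWeight_eq_zero (by omega)

/-- At r = m + n only i = m, j = n survives, the factor i/m is 1, and no free slot remains, so the
pattern value is a product of two covariances. -/
theorem thetaPsi_powTensor_top (hJ : ∀ x, J (J x) = x) {m n : ℕ} (hm : 1 ≤ m) (x : Fin 4 → H) :
    thetaPsi (powTensor e J m n (x 0)) (powTensor e J n m (x 1)) (powTensor e J m n (x 3))
        (powTensor e J n m (x 2)) (m + n) =
      ((m.factorial : ℂ) * n.factorial * (inner ℂ (x 1) (x 0) ^ m * inner ℂ (x 0) (x 1) ^ n)) *
      ((m.factorial : ℂ) * n.factorial * (inner ℂ (x 3) (x 2) ^ m * inner ℂ (x 2) (x 3) ^ n)) := by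
  have hm' : (m : ℂ) ≠ 0 := by exact_mod_cast Nat.ne_of_gt hm
  have h := inner_symContract_powTensor e J hJ x ![m, n, m, n] ![n, m, n, m] (p := m + n - (m + n))
    (q := m + n - (m + n)) le_rfl le_rfl le_rfl le_rfl le_rfl le_rfl le_rfl le_rfl
    (by simp) (by simp) (by simp) (by simp)
  simp only [Matrix.cons_val, patternValue, blockPerm, blockPoly, Nat.sub_self] at h
  rw [thetaPsi, psi_eq, vartheta_eq, weightedContract_top, weightedContract_top, inner_smul_left,
    inner_smul_right, conj_contrWeight, derivWeight, contrWeight_self_left, div_self hm']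
  · simp at h ⊢
    rw [h]
    ring
  · exact fun i j hij => by rw [derivWeight, contrWeight_eq_zero (by omega), mul_zero]
  · exact fun i j hij => contrWeight_eq_zero (by omega)

theorem sigmaPhi_powTensor_top (hJ : ∀ x, J (J x) = x) {m : ℕ} (hm : 1 ≤ m) (x : Fin 4 → H) :
    sigmaPhi (powTensor e J m m (x 0)) (powTensor e J m m (x 2)) (powTensor e J m m (x 3))
        (powTensor e J m m (x 1)) (m + m) =
      ((m.factorial : ℂ) * m.factorial * (inner ℂ (x 2) (x 0) ^ m * inner ℂ (x 0) (x 2) ^ m)) *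
      ((m.factorial : ℂ) * m.factorial * (inner ℂ (x 3) (x 1) ^ m * inner ℂ (x 1) (x 3) ^ m)) := by
  have h := thetaPsi_powTensor_top e J hJ (n := m) hm ![x 0, x 2, x 1, x 3]
  simp only [Matrix.cons_val] at h
  rw [← h, sigmaPhi, thetaPsi, psi_eq, vartheta_eq, two_mul, sq]

variable {Ω : Type*} [MeasurableSpace Ω] {P : Measure Ω} [IsProbabilityMeasure P] {Z : H → Ω → ℂ}

/-- Multilinear expansion of the fourfold identity for powers of vectors; the coefficients of the
two conjugate factors are interchangeable, so both ϑψ-sums coincide. -/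
theorem integral_norm_pow_four_hermiteSum (hZ : IsComplexIsonormal Z P) (hJ : ∀ x, J (J x) = x)
    {m n : ℕ} (hm : 1 ≤ m) (c : H →₀ ℂ) {N : ℕ} (hN : 2 * (m + n) ≤ N) {f : HTensor ι m n}
    {h : HTensor ι n m} (hf : tensorSum e J m n c = f) (hh : tensorSum e J n m (conjCoeff c) = h) :
    ((∫ ω, ‖hermiteSum Z m n c ω‖ ^ 4 ∂P : ℝ) : ℂ) =
      ∑ r ∈ Finset.range (N + 1), (2 * thetaPsi f h f h r + sigmaPhi f f f f r) := by
  have h1 : ((∫ ω, ‖hermiteSum Z m n c ω‖ ^ 4 ∂P : ℝ) : ℂ) =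
      ∫ ω, (hermiteSum Z m n c ω * hermiteSum Z n m (conjCoeff c) ω) *
        (hermiteSum Z m n c ω * hermiteSum Z n m (conjCoeff c) ω) ∂P := by
    rw [← integral_complex_ofReal]
    congr 1
    funext ω
    rw [← conj_hermiteSum, Complex.mul_conj']
    push_cast
    ring
  have h2 : ∀ a b c d : H, ∫ ω, itoHermite m n (Z a ω) (‖a‖ ^ 2) *
        itoHermite n m (Z b ω) (‖b‖ ^ 2) * (itoHermite m n (Z c ω) (‖c‖ ^ 2) *
        itoHermite n m (Z d ω) (‖d‖ ^ 2)) ∂P = ∑ r ∈ Finset.range (N + 1),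
        (thetaPsi (powTensor e J m n a) (powTensor e J n m b) (powTensor e J m n d)
            (powTensor e J n m c) r +
          thetaPsi (powTensor e J m n a) (powTensor e J n m d) (powTensor e J m n b)
            (powTensor e J n m c) r +
          sigmaPhi (powTensor e J m n a) (powTensor e J m n c) (powTensor e J m n d)
            (powTensor e J m n b) r) := by
    intro a b c d
    have h := hermiteExpect_fourfold e J hJ hZ m n hm ![a, b, c, d] hN
    rw [hermiteExpect_eq_integral] at h
    simp only [Fin.prod_univ_four, Matrix.cons_val] at h
    rw [← h]
    simp only [mul_assoc]
  have hf' : f = ∑ x ∈ c.support, c x • powTensor e J m n x := hf.symm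
  have hh' : h = ∑ x ∈ c.support, (starRingEnd ℂ) (c x) • powTensor e J n m x := by
    rw [← hh, tensorSum_conjCoeff]
  rw [h1]
  simp only [hermiteSum_conjCoeff]
  simp only [hermiteSum, Finsupp.sum]
  rw [integral_hermiteSum_fourfold c.support c (fun x => (starRingEnd ℂ) (c x))
    (hasMoments_itoHermite hZ m n) (hasMoments_itoHermite hZ n m)]
  simp only [h2, Finset.sum_add_distrib, ← Finset.mul_sum, mul_add]
  have h3 : ∀ G : H → H → H → H → ℕ → ℂ, ∑ a ∈ c.support, ∑ b ∈ c.support, ∑ x ∈ c.support,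
      ∑ d ∈ c.support, c a * (starRingEnd ℂ) (c b) * (c x * (starRingEnd ℂ) (c d)) *
        ∑ r ∈ Finset.range (N + 1), G a b x d r =
      ∑ r ∈ Finset.range (N + 1), ∑ a ∈ c.support, ∑ b ∈ c.support, ∑ x ∈ c.support,
      ∑ d ∈ c.support, c a * (starRingEnd ℂ) (c b) * (c x * (starRingEnd ℂ) (c d)) *
        G a b x d r := by
    intro G
    simp only [Finset.mul_sum]
    simp only [Finset.sum_comm (t := Finset.range (N + 1))]
  rw [h3 fun a b x d r => thetaPsi (powTensor e J m n a) (powTensor e J n m b)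
    (powTensor e J m n d) (powTensor e J n m x) r, h3 fun a b x d r => thetaPsi
    (powTensor e J m n a) (powTensor e J n m d) (powTensor e J m n b) (powTensor e J n m x) r,
    h3 fun a b x d r => sigmaPhi (powTensor e J m n a) (powTensor e J m n x) (powTensor e J m n d)
    (powTensor e J m n b) r]
  -- Relabelling b ↔ d turns this sum into the previous one.
  have h4 : ∀ r, ∑ a ∈ c.support, ∑ b ∈ c.support, ∑ x ∈ c.support,
      ∑ d ∈ c.support, c a * (starRingEnd ℂ) (c b) * (c x * (starRingEnd ℂ) (c d)) *
        thetaPsi (powTensor e J m n a) (powTensor e J n m d) (powTensor e J m n b)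
          (powTensor e J n m x) r = thetaPsi f h f h r := by
    intro r
    rw [hf', hh', thetaPsi_sum]
    refine Finset.sum_congr rfl fun a _ => ?_
    rw [Finset.sum_comm_cycle]
    refine Finset.sum_congr rfl fun b _ => ?_
    rw [Finset.sum_comm]
    refine Finset.sum_congr rfl fun x _ => Finset.sum_congr rfl fun d _ => by ring
  simp only [h4]
  rw [hf', hh']
  simp only [← thetaPsi_sum, ← sigmaPhi_sum, two_mul]

theorem sq_integral_norm_sq_hermiteSum (hZ : IsComplexIsonormal Z P) (hJ : ∀ x, J (J x) = x)
    {m n : ℕ} (hm : 1 ≤ m) (c : H →₀ ℂ) {f : HTensor ι m n}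
    {h : HTensor ι n m} (hf : tensorSum e J m n c = f) (hh : tensorSum e J n m (conjCoeff c) = h) :
    ((∫ ω, ‖hermiteSum Z m n c ω‖ ^ 2 ∂P : ℝ) : ℂ) ^ 2 = thetaPsi f h f h (m + n) := by
  have h1 : ((∫ ω, ‖hermiteSum Z m n c ω‖ ^ 2 ∂P : ℝ) : ℂ) =
      ∫ ω, hermiteSum Z m n c ω * hermiteSum Z n m (conjCoeff c) ω ∂P := by
    rw [← integral_complex_ofReal]
    congr 1
    funext ω
    rw [← conj_hermiteSum, Complex.mul_conj', Complex.ofReal_pow]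
  have hf' : f = ∑ x ∈ c.support, c x • powTensor e J m n x := hf.symm
  have hh' : h = ∑ x ∈ c.support, (starRingEnd ℂ) (c x) • powTensor e J n m x := by
    rw [← hh, tensorSum_conjCoeff]
  rw [h1, hf', hh', thetaPsi_sum]
  simp only [hermiteSum_conjCoeff]
  simp only [hermiteSum, Finsupp.sum]
  rw [integral_hermiteSum_mul c.support c (fun x => (starRingEnd ℂ) (c x))
    (hasMoments_itoHermite hZ m n) (hasMoments_itoHermite hZ n m)]
  rw [pow_two]
  simp only [Finset.sum_mul]
  refine Finset.sum_congr rfl fun a _ => Finset.sum_congr rfl fun b _ => ?_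
  simp only [Finset.mul_sum]
  refine
    Finset.sum_congr rfl fun x _ => Finset.sum_congr rfl fun d _ => ?_
  have := thetaPsi_powTensor_top e J hJ (n := n) hm ![a, b, x, d]
  simp only [Matrix.cons_val] at this
  rw [this, integral_itoHermite_mul hZ, integral_itoHermite_mul hZ, if_pos ⟨rfl, rfl⟩,
    if_pos ⟨rfl, rfl⟩]
  ring

theorem norm_sq_integral_hermiteSum_sq (hZ : IsComplexIsonormal Z P) (hJ : ∀ x, J (J x) = x)
    {m n : ℕ} (hm : 1 ≤ m) (c : H →₀ ℂ) {f : HTensor ι m n} (hf : tensorSum e J m n c = f) :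
    ((‖∫ ω, hermiteSum Z m n c ω ^ 2 ∂P‖ : ℝ) : ℂ) ^ 2 = sigmaPhi f f f f (m + n) := by
  have hf' : f = ∑ x ∈ c.support, c x • powTensor e J m n x := hf.symm
  have h1 : ∫ ω, hermiteSum Z m n c ω ^ 2 ∂P = ∑ a ∈ c.support, ∑ b ∈ c.support, c a * c b *
      ∫ ω, itoHermite m n (Z a ω) (‖a‖ ^ 2) * itoHermite m n (Z b ω) (‖b‖ ^ 2) ∂P := by
    simp only [hermiteSum, Finsupp.sum]
    simp only [pow_two (Finset.sum _ _)]
    exact integral_hermiteSum_mul c.support c c (hasMoments_itoHermite hZ m n)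
      (hasMoments_itoHermite hZ m n)
  -- For m ≠ n both sides vanish: E[F²] by bidegree, the top term because m + n > 2 min m n.
  by_cases hmn : m = n
  · subst hmn
    rw [← Complex.mul_conj', h1, hf', sigmaPhi_sum, map_sum, Finset.sum_mul_sum]
    refine Finset.sum_congr rfl fun a _ => Finset.sum_congr rfl fun b _ => ?_
    rw [map_sum, Finset.sum_mul_sum]
    refine Finset.sum_congr rfl fun x _ => Finset.sum_congr rfl fun d _ => ?_
    have := sigmaPhi_powTensor_top e J hJ hm ![a, b, x, d]
    simp only [Matrix.cons_val] at this
    rw [this, integral_itoHermite_mul hZ, integral_itoHermite_mul hZ, if_pos ⟨rfl, rfl⟩,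
      if_pos ⟨rfl, rfl⟩]
    simp only [map_mul, map_pow, inner_conj_symm, map_natCast]
    ring
  · rw [h1, sigmaPhi_eq_zero (by omega)]
    simp [integral_itoHermite_mul hZ, hmn]

end fourthMoment

/-! ### Conjugation of tensors -/

section conjTensor

variable {ι : Type*}

/-- The conjugate of a tensor, with the two groups of slots exchanged. -/
noncomputable def conjTensor {p q : ℕ} (f : HTensor ι p q) : HTensor ι q p :=
  ⟨fun z => (starRingEnd ℂ) (f z.swap), memlp_two_iff.2
    (((summable_sq f).comp_injective Prod.swap_injective).congr fun z => by simp)⟩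

theorem conjTensor_apply {p q : ℕ} (f : HTensor ι p q) (z : (Fin q → ι) × (Fin p → ι)) :
    conjTensor f z = (starRingEnd ℂ) (f z.swap) := rfl

theorem conjTensor_sub {p q : ℕ} (f g : HTensor ι p q) :
    conjTensor (f - g) = conjTensor f - conjTensor g := by
  ext z
  simp [conjTensor_apply]

theorem norm_conjTensor {p q : ℕ} (f : HTensor ι p q) : ‖conjTensor f‖ = ‖f‖ := by
  rw [← sq_eq_sq₀ (norm_nonneg _) (norm_nonneg _), norm_sq_eq_tsum, norm_sq_eq_tsum,
    ← (Equiv.prodComm _ _).tsum_eq]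
  simp [conjTensor_apply]

theorem continuous_conjTensor {p q : ℕ} :
    Continuous (conjTensor : HTensor ι p q → HTensor ι q p) := by
  refine Isometry.continuous (Isometry.of_dist_eq fun f g => ?_)
  rw [dist_eq_norm, dist_eq_norm, ← conjTensor_sub, norm_conjTensor]

variable {H : Type*} [NormedAddCommGroup H] [InnerProductSpace ℂ H]
  (e : HilbertBasis ι ℂ H) (J : H ≃ₗᵢ⋆[ℂ] H)

theorem conjTensor_powTensor (m n : ℕ) (x : H) :
    conjTensor (powTensor e J m n x) = powTensor e J n m x := by
  ext z
  rw [conjTensor_apply, powTensor_apply, powTensor_apply]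
  simp [mul_comm]

theorem tensorSum_conjCoeff_eq (m n : ℕ) (c : H →₀ ℂ) :
    tensorSum e J n m (conjCoeff c) = conjTensor (tensorSum e J m n c) := by
  ext z
  rw [tensorSum_conjCoeff, conjTensor_apply, tensorSum, Finsupp.sum]
  simp only [lp.coeFn_sum, Finset.sum_apply, lp.coeFn_smul, Pi.smul_apply, smul_eq_mul, map_sum,
    map_mul, ← conjTensor_powTensor e J m n, conjTensor_apply]

/-- The value of the fourth absolute moment in terms of the kernel. -/
noncomputable def fourthMoment {m n : ℕ} (f : HTensor ι m n) : ℂ :=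
  ∑ r ∈ Finset.range (2 * (m + n) + 1),
    (2 * thetaPsi f (conjTensor f) f (conjTensor f) r + sigmaPhi f f f f r)

theorem continuous_thetaPsi {m n : ℕ} (r : ℕ) : Continuous fun f : HTensor ι m n =>
    thetaPsi f (conjTensor f) f (conjTensor f) r := by
  simp only [thetaPsi, psi_eq, vartheta_eq]
  exact continuous_const.mul
    (Continuous.inner (𝕜 := ℂ)
      (continuous_weightedContract _ _ _ _ continuous_id continuous_conjTensor)
      (continuous_weightedContract _ _ _ _ continuous_id continuous_conjTensor))

theorem continuous_sigmaPhi {m n : ℕ} (r : ℕ) : Continuous fun f : HTensor ι m n =>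
    sigmaPhi f f f f r := by
  simp only [sigmaPhi]
  exact continuous_const.mul
    (Continuous.inner (𝕜 := ℂ) (continuous_weightedContract _ _ _ _ continuous_id continuous_id)
      (continuous_weightedContract _ _ _ _ continuous_id continuous_id))

theorem continuous_fourthMoment {m n : ℕ} :
    Continuous (fourthMoment : HTensor ι m n → ℂ) :=
  continuous_finsetSum _ fun r _ =>
    (continuous_const.mul (continuous_thetaPsi r)).add (continuous_sigmaPhi r)

theorem sum_range_eq_sum_Icc_add {a : ℕ → ℂ} {l : ℕ} (hl : 1 ≤ l) (h0 : a 0 = 0)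
    (ha : ∀ r, l < r → a r = 0) :
    ∑ r ∈ Finset.range (2 * l + 1), a r = ∑ r ∈ Finset.Icc 1 (l - 1), a r + a l := by
  obtain ⟨k, rfl⟩ := Nat.exists_eq_add_of_le' hl
  rw [← Finset.sum_subset (Finset.range_mono (show k + 2 ≤ 2 * (k + 1) + 1 by omega))
    fun r _ hr => ha r (by simpa [Nat.succ_le_iff] using hr), Finset.sum_range_succ,
    Nat.add_sub_cancel, Finset.sum_range_succ', h0, add_zero,
    Finset.range_eq_Ico, Finset.sum_Ico_add' a 0 k 1]
  rfl

/-- The terms r = 0 and r > l vanish and the terms r = l are subtracted, leaving 1 ≤ r ≤ l - 1. The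
cutoff at 2 min m n removes only zero terms. -/
theorem fourthMoment_sub {m n : ℕ} (hm : 1 ≤ m) (f : HTensor ι m n) :
    fourthMoment f - 2 * thetaPsi f (conjTensor f) f (conjTensor f) (m + n) -
        sigmaPhi f f f f (m + n) =
      2 * (∑ r ∈ Finset.Icc 1 (m + n - 1), ((m + n - r).factorial : ℂ) ^ 2 *
          inner ℂ (psi f (conjTensor f) r) (vartheta f (conjTensor f) r)) +
        ∑ r ∈ Finset.Icc 1 (min (2 * min m n) (m + n - 1)),
          ((2 * m - r).factorial : ℂ) * ((2 * n - r).factorial : ℂ) *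
            inner ℂ (phi f r) (varsigma f r) := by
  have h1 : ∑ r ∈ Finset.Icc 1 (min (2 * min m n) (m + n - 1)), sigmaPhi f f f f r =
      ∑ r ∈ Finset.Icc 1 (m + n - 1), sigmaPhi f f f f r := by
    refine Finset.sum_subset (Finset.Icc_subset_Icc_right (min_le_right _ _)) fun r hr hr' => ?_
    rw [Finset.mem_Icc] at hr hr'
    exact sigmaPhi_eq_zero (by omega) _ _ _ _
  simp only [phi_eq, varsigma_eq]
  change _ = 2 * (∑ r ∈ Finset.Icc 1 (m + n - 1), thetaPsi f (conjTensor f) f (conjTensor f) r) +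
    ∑ r ∈ Finset.Icc 1 (min (2 * min m n) (m + n - 1)), sigmaPhi f f f f r
  rw [h1, fourthMoment, Finset.sum_add_distrib, ← Finset.mul_sum,
    sum_range_eq_sum_Icc_add (by omega) (thetaPsi_zero f f _ _)
      fun r hr => thetaPsi_eq_zero hr f f _ _,
    sum_range_eq_sum_Icc_add (by omega) (sigmaPhi_zero f f f f)
      fun r hr => sigmaPhi_eq_zero (by omega) f f f f]
  ring

end conjTensor

/-! ### Passage to the limit -/

section limits

variable {Ω : Type*} [MeasurableSpace Ω] {P : Measure Ω}

theorem integral_norm_pow_eq {F : Ω → ℂ} {k : ℕ} (hk : k ≠ 0) (hF : MemLp F k P) :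
    ∫ ω, ‖F ω‖ ^ k ∂P = (eLpNorm F k P).toReal ^ k := by
  rw [hF.eLpNorm_eq_integral_rpow_norm (by exact_mod_cast hk) (ENNReal.natCast_ne_top k),
    ENNReal.toReal_ofReal (by positivity)]
  simp only [ENNReal.toReal_natCast, Real.rpow_natCast]
  rw [Real.rpow_inv_natCast_pow (integral_nonneg fun _ => by positivity) hk]

theorem tendsto_toLp {F : Ω → ℂ} {G : ℕ → Ω → ℂ} {p : ℝ≥0∞} [Fact (1 ≤ p)] (hF : MemLp F p P)
    (hG : ∀ k, MemLp (G k) p P)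
    (h : Tendsto (fun k => eLpNorm (fun ω => F ω - G k ω) p P) atTop (𝓝 0)) :
    Tendsto (fun k => (hG k).toLp) atTop (𝓝 hF.toLp) := by
  rw [Lp.tendsto_Lp_iff_tendsto_eLpNorm'' _ hG _ hF]
  refine h.congr fun k => ?_
  rw [← eLpNorm_neg]
  congr 1
  funext ω
  simp

theorem tendsto_integral_norm_pow {F : Ω → ℂ} {G : ℕ → Ω → ℂ} {j : ℕ} (hj : 1 ≤ j)
    (hF : MemLp F j P) (hG : ∀ k, MemLp (G k) j P)
    (h : Tendsto (fun k => eLpNorm (fun ω => F ω - G k ω) j P) atTop (𝓝 0)) :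
    Tendsto (fun k => ∫ ω, ‖G k ω‖ ^ j ∂P) atTop (𝓝 (∫ ω, ‖F ω‖ ^ j ∂P)) := by
  have : Fact (1 ≤ (j : ℝ≥0∞)) := ⟨by exact_mod_cast hj⟩
  have := ((tendsto_toLp hF hG h).norm).pow j
  simp only [Lp.norm_toLp] at this
  simpa only [integral_norm_pow_eq (Nat.one_le_iff_ne_zero.1 hj) hF,
    integral_norm_pow_eq (Nat.one_le_iff_ne_zero.1 hj) (hG _)] using this

theorem tendsto_integral_sq {F : Ω → ℂ} {G : ℕ → Ω → ℂ}
    (hF : MemLp F 2 P) (hG : ∀ k, MemLp (G k) 2 P)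
    (h : Tendsto (fun k => eLpNorm (fun ω => F ω - G k ω) 2 P) atTop (𝓝 0)) :
    Tendsto (fun k => ∫ ω, G k ω ^ 2 ∂P) atTop (𝓝 (∫ ω, F ω ^ 2 ∂P)) := by
  -- E[U²] is the inner product of the conjugate of U with U, hence continuous in L².
  have key : ∀ {U : Ω → ℂ} (hU : MemLp U 2 P),
      inner ℂ hU.star.toLp hU.toLp = ∫ ω, U ω ^ 2 ∂P := by
    intro U hU
    rw [L2.inner_def]
    refine integral_congr_ae ?_
    filter_upwards [hU.coeFn_toLp, hU.star.coeFn_toLp] with ω h1 h2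
    rw [h1, h2]
    simp [sq]
  have h1 := tendsto_toLp hF hG h
  have h2 := tendsto_toLp hF.star (fun k => (hG k).star) (h.congr fun k => by
    refine eLpNorm_congr_norm_ae (Eventually.of_forall fun ω => ?_)
    simp only [Pi.star_apply, ← star_sub, norm_star])
  simpa only [key] using Filter.Tendsto.inner (𝕜 := ℂ) h2 h1

end limits

/-! ### Uniqueness of the conjugate kernel and convergence in L⁴ -/

section main

variable {ι H : Type*} [NormedAddCommGroup H] [InnerProductSpace ℂ H]
  {e : HilbertBasis ι ℂ H} {J : H ≃ₗᵢ⋆[ℂ] H}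
  {Ω : Type*} [MeasurableSpace Ω] {P : Measure Ω} [IsProbabilityMeasure P] {Z : H → Ω → ℂ}

theorem integral_norm_pow_four_eq_fourthMoment (hZ : IsComplexIsonormal Z P)
    (hJ : ∀ x, J (J x) = x) {m : ℕ} (n : ℕ) (hm : 1 ≤ m) (c : H →₀ ℂ) :
    ((∫ ω, ‖hermiteSum Z m n c ω‖ ^ 4 ∂P : ℝ) : ℂ) = fourthMoment (tensorSum e J m n c) :=
  integral_norm_pow_four_hermiteSum e J hZ hJ hm c le_rfl rfl (tensorSum_conjCoeff_eq e J m n c)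

/-- The kernel of the conjugate of a Wiener-Itô integral is the conjugate kernel. -/
theorem IsWienerIto.conj_kernel_eq (hZ : IsComplexIsonormal Z P) (hJ : ∀ x, J (J x) = x)
    {m n : ℕ} {f : HTensor ι m n} {h : HTensor ι n m} {F : Ω → ℂ}
    (hF : IsWienerIto e J Z P m n f F)
    (hFbar : IsWienerIto e J Z P n m h (fun ω => (starRingEnd ℂ) (F ω))) :
    h = conjTensor f := by
  obtain ⟨hF2, c, hc, hcF⟩ := hF
  obtain ⟨-, d, hd, hdF⟩ := hFbar
  change Tendsto (fun k => tensorSum e J m n (c k)) _ _ at hc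
  change Tendsto (fun k => tensorSum e J n m (d k)) _ _ at hd
  change Tendsto (fun k => eLpNorm (fun ω => F ω - hermiteSum Z m n (c k) ω) 2 P) _ _ at hcF
  change Tendsto (fun k => eLpNorm (fun ω => (starRingEnd ℂ) (F ω) -
    hermiteSum Z n m (d k) ω) 2 P) _ _ at hdF
  have h1 : Tendsto (fun k => tensorSum e J n m (d k - conjCoeff (c k))) atTop
      (𝓝 (h - conjTensor f)) := by
    simp only [tensorSum_sub, tensorSum_conjCoeff_eq]
    exact hd.sub ((continuous_conjTensor.tendsto f).comp hc)
  have h2 : Tendsto (fun k => eLpNorm (hermiteSum Z n m (d k - conjCoeff (c k))) 2 P) atTop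
      (𝓝 0) := by
    have hb : ∀ k, eLpNorm (hermiteSum Z n m (d k - conjCoeff (c k))) 2 P ≤
        eLpNorm (fun ω => F ω - hermiteSum Z m n (c k) ω) 2 P +
        eLpNorm (fun ω => (starRingEnd ℂ) (F ω) - hermiteSum Z n m (d k) ω) 2 P := by
      intro k
      have hs1 : MemLp (fun ω => F ω - hermiteSum Z m n (c k) ω) 2 P :=
        hF2.sub (hasMoments_hermiteSum hZ m n (c k) 2 (by simp))
      have hs2 : MemLp (fun ω => (starRingEnd ℂ) (F ω) - hermiteSum Z n m (d k) ω) 2 P :=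
        hF2.star.sub (hasMoments_hermiteSum hZ n m (d k) 2 (by simp))
      have h3 := eLpNorm_sub_le hs1.star.1 hs2.1 (p := 2) (by norm_num)
      rw [eLpNorm_star] at h3
      refine le_of_eq_of_le ?_ h3
      congr 1
      funext ω
      simp only [hermiteSum_sub, ← conj_hermiteSum, Pi.sub_apply, Pi.star_apply, star_sub,
        Complex.star_def]
      ring
    exact tendsto_of_tendsto_of_tendsto_of_le_of_le tendsto_const_nhds
      (by simpa using hcF.add hdF) (fun _ => zero_le) hb
  have h3 : Tendsto (fun k => ∫ ω, ‖hermiteSum Z n m (d k - conjCoeff (c k)) ω‖ ^ 2 ∂P) atTop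
      (𝓝 0) := by
    have h4 := ((ENNReal.tendsto_toReal ENNReal.zero_ne_top).comp h2).pow 2
    simp only [Function.comp_def, ENNReal.toReal_zero, ne_eq, OfNat.ofNat_ne_zero,
      not_false_eq_true, zero_pow] at h4
    refine h4.congr fun k => ?_
    exact (integral_norm_pow_eq two_ne_zero
      (hasMoments_hermiteSum hZ n m (d k - conjCoeff (c k)) _ (by simp))).symm
  simp only [integral_norm_sq_hermiteSum e J hZ hJ] at h3
  -- By the isometry, the L² norms squared tend both to 0 and to n! m! ‖h - conjTensor f‖².
  have h5 := tendsto_nhds_unique h3 ((h1.norm.pow 2).const_mul ((n.factorial : ℝ) * m.factorial))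
  have h6 : ((n.factorial : ℝ) * m.factorial) ≠ 0 := by positivity
  have h7 : ‖h - conjTensor f‖ ^ 2 = 0 := by
    rcases mul_eq_zero.1 h5.symm with h | h
    · exact absurd h h6
    · exact h
  exact sub_eq_zero.1 (norm_eq_zero.1 (pow_eq_zero_iff two_ne_zero |>.1 h7))

/-- Convergence of the kernels implies convergence of the integrals in `L⁴`. -/
theorem memLp_four_and_tendsto (hZ : IsComplexIsonormal Z P) (hJ : ∀ x, J (J x) = x)
    {m n : ℕ} (hm : 1 ≤ m) {f : HTensor ι m n} {F : Ω → ℂ} (hF : MemLp F 2 P)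
    {c : ℕ → H →₀ ℂ} (hc : Tendsto (fun k => tensorSum e J m n (c k)) atTop (𝓝 f))
    (hcF : Tendsto (fun k => eLpNorm (fun ω => F ω - hermiteSum Z m n (c k) ω) 2 P) atTop (𝓝 0)) :
    MemLp F 4 P ∧
      Tendsto (fun k => eLpNorm (fun ω => F ω - hermiteSum Z m n (c k) ω) 4 P) atTop (𝓝 0) := by
  have : Fact ((1 : ℝ≥0∞) ≤ 4) := ⟨by norm_num⟩
  have hG : ∀ k, MemLp (hermiteSum Z m n (c k)) 4 P := fun k =>
    hasMoments_hermiteSum hZ m n (c k) 4 (by simp)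
  have hG2 : ∀ k, MemLp (hermiteSum Z m n (c k)) 2 P := fun k =>
    hasMoments_hermiteSum hZ m n (c k) 2 (by simp)
  -- A difference of combinations is again a combination, so its L⁴ norm is a continuous function of
  -- the difference of the kernels; this gives the Cauchy property without an appeal to
  -- hypercontractivity.
  have hdist : ∀ k l, dist (hG k).toLp (hG l).toLp =
      ((fourthMoment (tensorSum e J m n (c k) - tensorSum e J m n (c l))).re) ^
        ((4 : ℕ) : ℝ)⁻¹ := by
    intro k l
    rw [← tensorSum_sub, ← integral_norm_pow_four_eq_fourthMoment hZ hJ n hm, Complex.ofReal_re,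
      integral_norm_pow_eq (k := 4) (by norm_num) (hasMoments_hermiteSum hZ m n _ _ (by simp)),
      Real.pow_rpow_inv_natCast ENNReal.toReal_nonneg (by norm_num), dist_eq_norm,
      ← MemLp.toLp_sub, Lp.norm_toLp]
    congr 2
    funext ω
    rw [hermiteSum_sub]
    rfl
  have h0 : fourthMoment (0 : HTensor ι m n) = 0 := by
    have h := integral_norm_pow_four_eq_fourthMoment (e := e) (J := J) hZ hJ n hm 0
    simpa [tensorSum, hermiteSum] using h.symm
  have hcauchy : CauchySeq fun k => (hG k).toLp := by
    rw [cauchySeq_iff_tendsto_dist_atTop_0]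
    simp only [hdist]
    have h1 : Tendsto (fun k : ℕ × ℕ => tensorSum e J m n (c k.1) - tensorSum e J m n (c k.2))
        atTop (𝓝 0) := by
      rw [← prod_atTop_atTop_eq, ← sub_self f]
      exact (hc.comp tendsto_fst).sub (hc.comp tendsto_snd)
    have h2 := (Complex.continuous_re.tendsto _).comp ((continuous_fourthMoment.tendsto _).comp h1)
    rw [h0, Complex.zero_re] at h2
    simpa using h2.rpow_const (p := ((4 : ℕ) : ℝ)⁻¹) (Or.inr (by positivity))
  obtain ⟨G, hGlim⟩ := cauchySeq_tendsto_of_complete hcauchy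
  have hG4 : MemLp G 4 P := Lp.memLp G
  have hG4' : Tendsto (fun k => eLpNorm (fun ω => G ω - hermiteSum Z m n (c k) ω) 4 P) atTop
      (𝓝 0) := by
    have h1 : Tendsto (fun k => (hG k).toLp) atTop (𝓝 hG4.toLp) := by
      rwa [Lp.toLp_coeFn]
    rw [Lp.tendsto_Lp_iff_tendsto_eLpNorm'' _ hG _ hG4] at h1
    refine h1.congr fun k => ?_
    rw [← eLpNorm_neg]
    congr 1
    funext ω
    simp
  have hGG2 : MemLp G 2 P := hG4.mono_exponent (by norm_num)
  have hG2' : Tendsto (fun k => eLpNorm (fun ω => G ω - hermiteSum Z m n (c k) ω) 2 P) atTop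
      (𝓝 0) :=
    tendsto_of_tendsto_of_tendsto_of_le_of_le tendsto_const_nhds hG4' (fun _ => zero_le)
      fun k => eLpNorm_le_eLpNorm_of_exponent_le (by norm_num) (hG4.sub (hG k)).1
  -- On a probability space L⁴ convergence implies L² convergence, so F and G are limits of the same
  -- sequence in L².
  have hFG : F =ᵐ[P] G := by
    have h1 := tendsto_nhds_unique (tendsto_toLp hF hG2 hcF) (tendsto_toLp hGG2 hG2 hG2')
    exact (MemLp.toLp_eq_toLp_iff hF hGG2).1 h1
  refine ⟨(memLp_congr_ae hFG).2 hG4, hG4'.congr fun k => eLpNorm_congr_ae ?_⟩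
  filter_upwards [hFG] with ω hω
  rw [hω]

end main

end ComplexWiener

open ComplexWiener in
theorem proposition1p2
    {H : Type*} [NormedAddCommGroup H] [InnerProductSpace ℂ H] [CompleteSpace H]
    [TopologicalSpace.SeparableSpace H]
    (J : H ≃ₗᵢ⋆[ℂ] H) (hJ : ∀ x, J (J x) = x)
    {ι : Type*} (e : HilbertBasis ι ℂ H)
    {Ω : Type*} [MeasurableSpace Ω] (P : Measure Ω) [IsProbabilityMeasure P]
    (Z : H → Ω → ℂ) (hZ : IsComplexIsonormal Z P)
    (m n : ℕ) (hm : 1 ≤ m)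
    (f : HTensor ι m n) (hf : IsSymm f) (h : HTensor ι n m) (hh : IsSymm h)
    (F : Ω → ℂ) (hF : IsWienerIto e J Z P m n f F)
    (hFbar : IsWienerIto e J Z P n m h (fun ω => (starRingEnd ℂ) (F ω))) :
    MemLp F 4 P ∧
    (((∫ ω, ‖F ω‖ ^ 4 ∂P) - 2 * (∫ ω, ‖F ω‖ ^ 2 ∂P) ^ 2 - ‖∫ ω, F ω ^ 2 ∂P‖ ^ 2 : ℝ) : ℂ) =
      2 * (∑ r ∈ Finset.Icc 1 (m + n - 1),
          ((m + n - r).factorial : ℂ) ^ 2 * inner ℂ (psi f h r) (vartheta f h r)) +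
        ∑ r ∈ Finset.Icc 1 (min (2 * min m n) (m + n - 1)),
          ((2 * m - r).factorial : ℂ) * ((2 * n - r).factorial : ℂ) *
            inner ℂ (phi f r) (varsigma f r) := by
  have hconj := IsWienerIto.conj_kernel_eq hZ hJ hF hFbar
  obtain ⟨hF2, c, hc, hcF⟩ := hF
  change Tendsto (fun k => tensorSum e J m n (c k)) _ _ at hc
  change Tendsto (fun k => eLpNorm (fun ω => F ω - hermiteSum Z m n (c k) ω) 2 P) _ _ at hcF
  obtain ⟨hF4, hcF4⟩ := memLp_four_and_tendsto hZ hJ hm hF2 hc hcF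
  refine ⟨hF4, ?_⟩
  have hG : ∀ k (p : ℕ), MemLp (hermiteSum Z m n (c k)) p P := fun k p =>
    hasMoments_hermiteSum hZ m n (c k) p (by simp)
  have h4 := (tendsto_integral_norm_pow (j := 4) (by norm_num) hF4 (fun k => hG k 4) hcF4)
  have h2 := (tendsto_integral_norm_pow (j := 2) (by norm_num) hF2 (fun k => hG k 2) hcF)
  have h1 := tendsto_integral_sq hF2 (fun k => hG k 2) hcF
  -- Each of the three moments is identified in the same way: the formula for finite combinations
  -- passes to the limit, the moment being continuous in L⁴ or L² and the right-hand side continuous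
  -- in the kernel.
  have e4 : ((∫ ω, ‖F ω‖ ^ 4 ∂P : ℝ) : ℂ) = fourthMoment f := by
    refine tendsto_nhds_unique ((Complex.continuous_ofReal.tendsto _).comp h4) ?_
    refine ((continuous_fourthMoment.tendsto f).comp hc).congr fun k => ?_
    exact (integral_norm_pow_four_eq_fourthMoment hZ hJ n hm (c k)).symm
  have e2 : ((∫ ω, ‖F ω‖ ^ 2 ∂P : ℝ) : ℂ) ^ 2 =
      thetaPsi f (conjTensor f) f (conjTensor f) (m + n) := by
    refine tendsto_nhds_unique (((Complex.continuous_ofReal.tendsto _).comp h2).pow 2) ?_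
    refine (((continuous_thetaPsi (m + n)).tendsto f).comp hc).congr fun k => ?_
    exact (sq_integral_norm_sq_hermiteSum e J hZ hJ hm (c k) rfl
      (tensorSum_conjCoeff_eq e J m n (c k))).symm
  have e1 : ((‖∫ ω, F ω ^ 2 ∂P‖ : ℝ) : ℂ) ^ 2 = sigmaPhi f f f f (m + n) := by
    refine tendsto_nhds_unique (((Complex.continuous_ofReal.tendsto _).comp h1.norm).pow 2) ?_
    refine (((continuous_sigmaPhi (m + n)).tendsto f).comp hc).congr fun k => ?_
    exact (norm_sq_integral_hermiteSum_sq e J hZ hJ hm (c k) rfl).symm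
  rw [hconj, ← fourthMoment_sub hm, ← e4, ← e2, ← e1]
  push_cast
  rfl
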